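/- **The calculus.** There are two fragments, pure and mixed. Scalars are complex numbers in the pure fragment and non-negative reals in the mixed one. Pure propositions are $P ::= \top \mid 1 \mid P\multimap P \mid P\,\&\,P \mid P\otimes P$; mixed propositions are $A ::= 0 \mid 1 \mid A\multimap A \mid A\oplus A\mid A\otimes A\mid \mathcal B(P)$ with $P$ pure. Terms, modulo $\alpha$-equivalence, are built in both fragments from variables, $M+N$, $\alpha\cdot M$, $*$, $\delta_1(M,N)$, $\lambda x.M$, $M\,N$, $M\otimes N$, $\delta_\otimes(M,xy.N)$; in the pure fragment also from $\langle\rangle$, $\langle m,n\rangle$, $\delta_\&^i(m,x.n)$ ($i=1,2$); in the mixed fragment also from $\delta_0(m)$, $\mathrm{inl}(m)$, $\mathrm{inr}(m)$, $\delta_\oplus(m,x.n,y.o)$, $\tau(m)$, and $\mathcal B(m)$ with $m$ pure. Typing $\Gamma\vdash M:T$ is natural deduction for intuitionistic multiplicative additive linear logic (multiplicative rules split the context, with exchange; $\langle\rangle:\top$ is typable in every pure context; $\Gamma\vdash m:0$ gives $\Gamma,\Delta\vdash\delta_0(m):A$) together with the rules: $\Gamma\vdash M+N:S$ if $\Gamma\vdash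 M:S$ and $\Gamma\vdash N:S$; $\Gamma\vdash\alpha\cdot M:S$ if $\Gamma\vdash M:S$; $\vdash\mathcal B(m):\mathcal B(P)$ if $\vdash m:P$; $\Gamma,\Delta\vdash m\,n:\mathcal B(Q)$ if $\Gamma\vdash m:\mathcal B(P\multimap Q)$ and $\Delta\vdash n:\mathcal B(P)$; $\Gamma\vdash\tau(m):\mathcal B(P\otimes Q)$ if $\Gamma\vdash m:\mathcal B(P)\otimes\mathcal B(Q)$. **Values.** All sums are non-empty, have pairwise distinct summands and may be bracketed in any way. Pure: $v_b ::= *\mid x\mid v_n\otimes v_n$, $v_n::=\langle\rangle\mid\lambda x.m\mid\langle v,v\rangle\mid v_b$. Mixed: $v_b::=*\mid x\mid \mathrm{inl}(v_n)\mid\mathrm{inr}(v_n)\mid v_n\otimes v_n\mid\mathcal B(v)$ ($v$ a pure value), $v_n::=\lambda x.m\mid v_b$. In both fragments $v ::= v_n\mid \sum_i a_i\cdot v_{bi}+\sum_j v_{bj}\mid\sum_i 0\cdot v_{bi}$ with $a_i\ne 0,1$. **Reduction.** $\leftrightarrows$ is the congruence on terms generated by $1\cdot M\leftrightarrows M$,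 commutativity and associativity of $+$, $\alpha\cdot M+\beta\cdot M\leftrightarrows(\alpha+\beta)\cdot M$, $\alpha\cdot(\beta\cdot M)\leftrightarrows\alpha\beta\cdot M$, $\alpha\cdot(M+N)\leftrightarrows\alpha\cdot M+\alpha\cdot N$, $M+0\cdot N\leftrightarrows M$ if $M$ is not of the form $0\cdot M'$, and bilinearity of $\otimes$ with respect to $+$ and $\cdot$. Base forms are the terms $x$, $\langle\rangle$, $*$, $b\otimes b'$ with $b,b'$ base forms, and the terms headed by any other constructor except $+$ and $\cdot$ all of whose immediate subterms are algebraic forms; algebraic forms are the sums $\sum_i\alpha_i\cdot b_i$ of base forms whose coefficients are all non-zero or all zero. In algebraic forms and on the left-hand sides below a coefficient $1$ may be omitted, but in the rules marked $(\dagger)$ the combination is not a single summand whose coefficient is omitted. $\to$ is the closure of the following rules under the evaluation contexts $K::=[.]\mid K+M\mid\alpha\cdot K\mid\delta_0(K)\mid\delta_1(K,M)\mid K\,M\mid V\,K\mid\langle K,m\rangle\mid\langle v,K\rangle\mid\delta^i_\&(K,x.m)\mid\mathrm{inl}(K)\mid\mathrm{inr}(K)\mid\delta_\oplus(K,x.m,y.n)\mid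 K\otimes M\mid V\otimes K\mid\delta_\otimes(K,xy.M)\mid\mathcal B(K)\mid\tau(K)$, where $V,W,v,w$ (with indices) are values, $V_n,W_n$ and $V_b,v_b$ values of the indicated class, and $(V/x)M$ is substitution: * $\delta_1(\alpha\cdot *,M)\to\alpha\cdot M$; $(\lambda x.M)V\to(V/x)M$; $\delta_\&^1(\langle v,w\rangle,x.t)\to(v/x)t$; $\delta_\&^2(\langle v,w\rangle,x.t)\to(w/x)t$; $\delta_\oplus(\mathrm{inl}(v),x.m,y.n)\to(v/x)m$; $\delta_\oplus(\mathrm{inr}(v),x.m,y.n)\to(v/y)n$; $\delta_\otimes(V_n\otimes W_n,xy.M)\to(V_n/x,W_n/y)M$; * $(\dagger)$ $a\cdot\langle\rangle\to\langle\rangle$; $(\dagger)$ $\sum\alpha_i\cdot\lambda x.M_i\to\lambda x.\sum\alpha_i\cdot M_i$; $(\dagger)$ $\sum a_i\cdot\langle v_i,w_i\rangle\to\langle\sum a_i\cdot v_i,\sum a_i\cdot w_i\rangle$; $(\dagger)$ $C(\sum\alpha_i\cdot V_{bi})\to\sum\alpha_i\cdot C(V_{bi})$ for $C$ any of $\delta_\oplus(-,x.o,y.s)$,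 $\delta_\otimes(-,xy.M)$, $\mathrm{inl}$, $\mathrm{inr}$, $\tau$; * $\tau(\mathcal B(v)\otimes\mathcal B(w))\to\mathcal B(v\otimes w)$; $\mathcal B(a\cdot v_b)\to|a|^2\cdot\mathcal B(v_b)$ (with $a\neq1$ written explicitly); $(\sum_i p_i\cdot\mathcal B(v_i))(\sum_j q_j\cdot\mathcal B(w_j))\to\sum_{i,j}p_iq_j\cdot\mathcal B(v_i\,w_j)$. The reduction $\hookrightarrow$ is given by: $M\hookrightarrow N$ if $M\to N$; $M\hookrightarrow V$ if $M\leftrightarrows V$ and $V$ is a value; $M\hookrightarrow N$ if $M$ has no $\to$-reduct, $M\leftrightarrows A$ for an algebraic form $A$, and $A\to N$. Its reflexive transitive closure is $\hookrightarrow^*$. **Contextual equivalence.** Elimination contexts are the terms with the hole $[.]$ as only free variable given by $E::=[.]\mid\delta_0(E)\mid\delta_1(E,M)\mid E\,M\mid\delta_\&^i(E,x.m)\mid\delta_\oplus(E,x.m,y.n)\mid\delta_\otimes(E,xy.M)$. Closed terms $M,N$ of proposition $U$ are contextually equivalent, $M\sim N$, if for every elimination context $[.]:U\vdash E:T$ in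 the same fragment, where $T$ is the pure $1$, the mixed $1$ or $\mathcal B(1)$, there is a value $V$ with $E[M]\hookrightarrow^*V$ and $E[N]\hookrightarrow^*V$. Terms $M,N$ of proposition $U$ in a context $\Delta$ are contextually equivalent if $\sigma M\sim\sigma N$ for every substitution $\sigma$ of closed terms of the declared propositions for the variables of $\Delta$. **Corollary (Linearity).** Let $x:S\vdash M:T$, $\Delta\vdash N_1:S$ and $\Delta\vdash N_2:S$ be derivable, all in the same fragment, and let $\alpha,\beta$ be scalars of that fragment. Then $$(\lambda x.M)\,(\alpha\cdot N_1+\beta\cdot N_2)\;\sim\;\alpha\cdot\big((\lambda x.M)\,N_1\big)+\beta\cdot\big((\lambda x.M)\,N_2\big).$$ -/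

import Mathlib

open scoped NNReal

namespace BIMALL

/-- The two fragments of the calculus. -/
inductive Frag : Type
  | pure
  | mixed

/-- Scalars: complex numbers in the pure fragment, non-negative reals in the mixed one. -/
@[reducible]
def Scal : Frag → Type
  | .pure => ℂ
  | .mixed => ℝ≥0

noncomputable instance instCommSemiringScal : (f : Frag) → CommSemiring (Scal f)
  | .pure => inferInstanceAs (CommSemiring ℂ)
  | .mixed => inferInstanceAs (CommSemiring ℝ≥0)

/-- Pure and mixed propositions. -/
inductive Ty : Frag → Type
  | top : Ty .pure
  | zero : Ty .mixed
  | one {f : Frag} : Ty f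
  | lolli {f : Frag} (S T : Ty f) : Ty f
  | tensor {f : Frag} (S T : Ty f) : Ty f
  | conj (P Q : Ty .pure) : Ty .pure
  | plus (A B : Ty .mixed) : Ty .mixed
  | bang (P : Ty .pure) : Ty .mixed

/-- Pure and mixed proof terms modulo alpha-equivalence, with de Bruijn indices. Pure and mixed
variables are numbered independently. In `elimTens m n` the body `n` binds two variables `x y`:
`y` is index `0` and `x` is index `1`. -/
inductive Tm : Frag → Type
  | var {f : Frag} (n : ℕ) : Tm f
  | add {f : Frag} (m n : Tm f) : Tm f
  | smul {f : Frag} (a : Scal f) (m : Tm f) : Tm f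
  | star {f : Frag} : Tm f
  | elimOne {f : Frag} (m n : Tm f) : Tm f
  | lam {f : Frag} (m : Tm f) : Tm f
  | app {f : Frag} (m n : Tm f) : Tm f
  | tens {f : Frag} (m n : Tm f) : Tm f
  | elimTens {f : Frag} (m n : Tm f) : Tm f
  | topI : Tm .pure
  | pair (m n : Tm .pure) : Tm .pure
  | elimFst (m n : Tm .pure) : Tm .pure
  | elimSnd (m n : Tm .pure) : Tm .pure
  | elimZero (m : Tm .mixed) : Tm .mixed
  | inl (m : Tm .mixed) : Tm .mixed
  | inr (m : Tm .mixed) : Tm .mixed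
  | elimPlus (m n o : Tm .mixed) : Tm .mixed
  | bang (m : Tm .pure) : Tm .mixed
  | tau (m : Tm .mixed) : Tm .mixed

namespace Tm

/-- Lifting of a renaming under one binder. -/
def upr (r : ℕ → ℕ) : ℕ → ℕ
  | 0 => 0
  | n + 1 => r n + 1

/-- Renaming of the free variables of a term. The pure term in `bang m` has no variables of the
mixed fragment. -/
def rename : {f : Frag} → (ℕ → ℕ) → Tm f → Tm f
  | _, r, var n => var (r n)
  | _, r, add m n => add (rename r m) (rename r n)
  | _, r, smul a m => smul a (rename r m)
  | _, _, star => star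
  | _, r, elimOne m n => elimOne (rename r m) (rename r n)
  | _, r, lam m => lam (rename (upr r) m)
  | _, r, app m n => app (rename r m) (rename r n)
  | _, r, tens m n => tens (rename r m) (rename r n)
  | _, r, elimTens m n => elimTens (rename r m) (rename (upr (upr r)) n)
  | _, _, topI => topI
  | _, r, pair m n => pair (rename r m) (rename r n)
  | _, r, elimFst m n => elimFst (rename r m) (rename (upr r) n)
  | _, r, elimSnd m n => elimSnd (rename r m) (rename (upr r) n)
  | _, r, elimZero m => elimZero (rename r m)
  | _, r, inl m => inl (rename r m)
  | _, r, inr m => inr (rename r m)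
  | _, r, elimPlus m n o => elimPlus (rename r m) (rename (upr r) n) (rename (upr r) o)
  | _, _, bang m => bang m
  | _, r, tau m => tau (rename r m)

/-- Extension of a substitution by a term for index `0`. -/
def scons {f : Frag} (m : Tm f) (s : ℕ → Tm f) : ℕ → Tm f
  | 0 => m
  | n + 1 => s n

/-- Lifting of a substitution under one binder. -/
def up {f : Frag} (s : ℕ → Tm f) : ℕ → Tm f :=
  scons (var 0) (fun n => rename Nat.succ (s n))

/-- Simultaneous capture-avoiding substitution. -/
def subst : {f : Frag} → (ℕ → Tm f) → Tm f → Tm f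
  | _, s, var n => s n
  | _, s, add m n => add (subst s m) (subst s n)
  | _, s, smul a m => smul a (subst s m)
  | _, _, star => star
  | _, s, elimOne m n => elimOne (subst s m) (subst s n)
  | _, s, lam m => lam (subst (up s) m)
  | _, s, app m n => app (subst s m) (subst s n)
  | _, s, tens m n => tens (subst s m) (subst s n)
  | _, s, elimTens m n => elimTens (subst s m) (subst (up (up s)) n)
  | _, _, topI => topI
  | _, s, pair m n => pair (subst s m) (subst s n)
  | _, s, elimFst m n => elimFst (subst s m) (subst (up s) n)
  | _, s, elimSnd m n => elimSnd (subst s m) (subst (up s) n)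
  | _, s, elimZero m => elimZero (subst s m)
  | _, s, inl m => inl (subst s m)
  | _, s, inr m => inr (subst s m)
  | _, s, elimPlus m n o => elimPlus (subst s m) (subst (up s) n) (subst (up s) o)
  | _, _, bang m => bang m
  | _, s, tau m => tau (subst s m)

/-- `inst V M` is `(V/x)M`, where `x` is index `0` of `M`. -/
def inst {f : Frag} (V M : Tm f) : Tm f :=
  subst (scons V var) M

/-- `inst₂ V W M` is `(V/x, W/y)M`, where `x` is index `1` and `y` is index `0` of `M`. -/
def inst₂ {f : Frag} (V W M : Tm f) : Tm f :=
  subst (scons W (scons V var)) M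

end Tm

open Tm

/-- Linear contexts: position `i` holds the proposition of variable `i` if this variable is
declared, and `none` if it is not. Variables are identified by their positions, so that
the exchange rule is built in. -/
abbrev Ctx (f : Frag) : Type := List (Option (Ty f))

/-- The context declares no variable. -/
def Ctx.IsEmpty {f : Frag} (Γ : Ctx f) : Prop := ∀ o ∈ Γ, o = none

/-- The context declares exactly one variable, variable `n`, of proposition `S`. -/
inductive Ctx.Single {f : Frag} : Ctx f → ℕ → Ty f → Prop
  | here {Γ : Ctx f} {S : Ty f} (h : Γ.IsEmpty) : Ctx.Single (some S :: Γ) 0 S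
  | there {Γ : Ctx f} {n : ℕ} {S : Ty f} (h : Ctx.Single Γ n S) :
      Ctx.Single (none :: Γ) (n + 1) S

/-- `Split Γ Γ₁ Γ₂`: `Γ` is, up to exchange, the concatenation of the disjoint contexts
`Γ₁` and `Γ₂`. -/
inductive Ctx.Split {f : Frag} : Ctx f → Ctx f → Ctx f → Prop
  | nil : Ctx.Split [] [] []
  | none {Γ Γ₁ Γ₂ : Ctx f} (h : Ctx.Split Γ Γ₁ Γ₂) :
      Ctx.Split (.none :: Γ) (.none :: Γ₁) (.none :: Γ₂)
  | left {Γ Γ₁ Γ₂ : Ctx f} (S : Ty f) (h : Ctx.Split Γ Γ₁ Γ₂) :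
      Ctx.Split (some S :: Γ) (some S :: Γ₁) (.none :: Γ₂)
  | right {Γ Γ₁ Γ₂ : Ctx f} (S : Ty f) (h : Ctx.Split Γ Γ₁ Γ₂) :
      Ctx.Split (some S :: Γ) (.none :: Γ₁) (some S :: Γ₂)

/-- The derivation rules, `Γ ⊢ M : T`. -/
inductive HasType : {f : Frag} → Ctx f → Tm f → Ty f → Prop
  | ax {f : Frag} {Γ : Ctx f} {n : ℕ} {S : Ty f} (h : Γ.Single n S) : HasType Γ (var n) S
  | sum {f : Frag} {Γ : Ctx f} {M N : Tm f} {S : Ty f}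
      (hM : HasType Γ M S) (hN : HasType Γ N S) : HasType Γ (add M N) S
  | prod {f : Frag} {Γ : Ctx f} {M : Tm f} {S : Ty f} (a : Scal f)
      (hM : HasType Γ M S) : HasType Γ (smul a M) S
  | topI (Γ : Ctx .pure) : HasType Γ topI .top
  | zeroE {Γ Γ₁ Γ₂ : Ctx .mixed} {m : Tm .mixed} (A : Ty .mixed) (hs : Γ.Split Γ₁ Γ₂)
      (hm : HasType Γ₁ m .zero) : HasType Γ (elimZero m) A
  | oneI {f : Frag} {Γ : Ctx f} (h : Γ.IsEmpty) : HasType Γ star .one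
  | oneE {f : Frag} {Γ Γ₁ Γ₂ : Ctx f} {M N : Tm f} {S : Ty f} (hs : Γ.Split Γ₁ Γ₂)
      (hM : HasType Γ₁ M .one) (hN : HasType Γ₂ N S) : HasType Γ (elimOne M N) S
  | lolliI {f : Frag} {Γ : Ctx f} {M : Tm f} {S T : Ty f}
      (hM : HasType (some S :: Γ) M T) : HasType Γ (lam M) (.lolli S T)
  | lolliE {f : Frag} {Γ Γ₁ Γ₂ : Ctx f} {M N : Tm f} {S T : Ty f} (hs : Γ.Split Γ₁ Γ₂)
      (hM : HasType Γ₁ M (.lolli S T)) (hN : HasType Γ₂ N S) : HasType Γ (app M N) T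
  | conjI {Γ : Ctx .pure} {m n : Tm .pure} {P Q : Ty .pure}
      (hm : HasType Γ m P) (hn : HasType Γ n Q) : HasType Γ (pair m n) (.conj P Q)
  | conjE₁ {Γ Γ₁ Γ₂ : Ctx .pure} {m n : Tm .pure} {P Q R : Ty .pure} (hs : Γ.Split Γ₁ Γ₂)
      (hm : HasType Γ₁ m (.conj P Q)) (hn : HasType (some P :: Γ₂) n R) :
      HasType Γ (elimFst m n) R
  | conjE₂ {Γ Γ₁ Γ₂ : Ctx .pure} {m n : Tm .pure} {P Q R : Ty .pure} (hs : Γ.Split Γ₁ Γ₂)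
      (hm : HasType Γ₁ m (.conj P Q)) (hn : HasType (some Q :: Γ₂) n R) :
      HasType Γ (elimSnd m n) R
  | plusI₁ {Γ : Ctx .mixed} {m : Tm .mixed} {A : Ty .mixed} (B : Ty .mixed)
      (hm : HasType Γ m A) : HasType Γ (inl m) (.plus A B)
  | plusI₂ {Γ : Ctx .mixed} {m : Tm .mixed} (A : Ty .mixed) {B : Ty .mixed}
      (hm : HasType Γ m B) : HasType Γ (inr m) (.plus A B)
  | plusE {Γ Γ₁ Γ₂ : Ctx .mixed} {m n o : Tm .mixed} {A B C : Ty .mixed} (hs : Γ.Split Γ₁ Γ₂)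
      (hm : HasType Γ₁ m (.plus A B)) (hn : HasType (some A :: Γ₂) n C)
      (ho : HasType (some B :: Γ₂) o C) : HasType Γ (elimPlus m n o) C
  | tensorI {f : Frag} {Γ Γ₁ Γ₂ : Ctx f} {M N : Tm f} {S T : Ty f} (hs : Γ.Split Γ₁ Γ₂)
      (hM : HasType Γ₁ M S) (hN : HasType Γ₂ N T) : HasType Γ (tens M N) (.tensor S T)
  | tensorE {f : Frag} {Γ Γ₁ Γ₂ : Ctx f} {M N : Tm f} {S₁ S₂ T : Ty f} (hs : Γ.Split Γ₁ Γ₂)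
      (hM : HasType Γ₁ M (.tensor S₁ S₂)) (hN : HasType (some S₂ :: some S₁ :: Γ₂) N T) :
      HasType Γ (elimTens M N) T
  | bangI {Γ : Ctx .mixed} {m : Tm .pure} {P : Ty .pure} (h : Γ.IsEmpty)
      (hm : HasType [] m P) : HasType Γ (bang m) (.bang P)
  | bangE {Γ Γ₁ Γ₂ : Ctx .mixed} {m n : Tm .mixed} {P Q : Ty .pure} (hs : Γ.Split Γ₁ Γ₂)
      (hm : HasType Γ₁ m (.bang (.lolli P Q))) (hn : HasType Γ₂ n (.bang P)) :
      HasType Γ (app m n) (.bang Q)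
  | tau {Γ : Ctx .mixed} {m : Tm .mixed} {P Q : Ty .pure}
      (hm : HasType Γ m (.tensor (.bang P) (.bang Q))) :
      HasType Γ (tau m) (.bang (.tensor P Q))

/-- `IsSum [t₁, …, tₙ] t`: the term `t` is `t₁ + ⋯ + tₙ`, for some bracketing (`n ≥ 1`). -/
inductive IsSum {f : Frag} : List (Tm f) → Tm f → Prop
  | single (t : Tm f) : IsSum [t] t
  | add {l k : List (Tm f)} {s t : Tm f} (hs : IsSum l s) (ht : IsSum k t) :
      IsSum (l ++ k) (add s t)

/-- `IsLin [(a₁, t₁), …, (aₙ, tₙ)] t`: the term `t` is the linear combination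
`a₁ · t₁ + ⋯ + aₙ · tₙ`, for some bracketing (`n ≥ 1`), where a coefficient `1` may be
omitted. -/
inductive IsLin {f : Frag} : List (Scal f × Tm f) → Tm f → Prop
  | unit (t : Tm f) : IsLin [(1, t)] t
  | smul (a : Scal f) (t : Tm f) : IsLin [(a, t)] (smul a t)
  | add {l k : List (Scal f × Tm f)} {s t : Tm f} (hs : IsLin l s) (ht : IsLin k t) :
      IsLin (l ++ k) (add s t)

/-- The head of the term is a sum or a scalar multiplication. It serves to exclude the
combination that consists of a single bare summand. -/
inductive IsComb {f : Frag} : Tm f → Prop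
  | add (s t : Tm f) : IsComb (add s t)
  | smul (a : Scal f) (t : Tm f) : IsComb (smul a t)

mutual

/-- The values `v_b`. -/
inductive IsVb : {f : Frag} → Tm f → Prop
  | star {f : Frag} : IsVb (star : Tm f)
  | var {f : Frag} (n : ℕ) : IsVb (var n : Tm f)
  | tens {f : Frag} {v w : Tm f} (hv : IsVn v) (hw : IsVn w) : IsVb (tens v w)
  | inl {v : Tm .mixed} (hv : IsVn v) : IsVb (inl v)
  | inr {v : Tm .mixed} (hv : IsVn v) : IsVb (inr v)
  | bang {v : Tm .pure} (hv : IsVal v) : IsVb (bang v)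

/-- The values `v_n`. -/
inductive IsVn : {f : Frag} → Tm f → Prop
  | topI : IsVn topI
  | lam {f : Frag} (m : Tm f) : IsVn (lam m)
  | pair {v w : Tm .pure} (hv : IsVal v) (hw : IsVal w) : IsVn (pair v w)
  | vb {f : Frag} {v : Tm f} (hv : IsVb v) : IsVn v

/-- The values: the `v_n`, the combinations `∑ aᵢ · v_bᵢ + ∑ v_bⱼ` with `aᵢ ≠ 0, 1`, and the
combinations `∑ 0 · v_bᵢ`, all summands being distinct. -/
inductive IsVal : {f : Frag} → Tm f → Prop
  | vn {f : Frag} {v : Tm f} (hv : IsVn v) : IsVal v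
  | comb {f : Frag} {t : Tm f} (l : List (Scal f × Tm f)) (k : List (Tm f))
      (ht : IsSum (l.map (fun p => smul p.1 p.2) ++ k) t)
      (hd : (l.map Prod.snd ++ k).Nodup)
      (hl : ∀ p ∈ l, p.1 ≠ 0 ∧ p.1 ≠ 1)
      (hvl : ∀ p ∈ l, IsVb p.2) (hvk : ∀ v ∈ k, IsVb v) : IsVal t
  | null {f : Frag} {t : Tm f} (l : List (Tm f))
      (ht : IsSum (l.map (fun v => smul 0 v)) t)
      (hd : l.Nodup) (hv : ∀ v ∈ l, IsVb v) : IsVal t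

end

mutual

/-- Base forms. -/
inductive IsBase : {f : Frag} → Tm f → Prop
  | var {f : Frag} (n : ℕ) : IsBase (var n : Tm f)
  | star {f : Frag} : IsBase (star : Tm f)
  | elimOne {f : Frag} {a b : Tm f} (ha : IsAlg a) (hb : IsAlg b) : IsBase (elimOne a b)
  | lam {f : Frag} {a : Tm f} (ha : IsAlg a) : IsBase (lam a)
  | app {f : Frag} {a b : Tm f} (ha : IsAlg a) (hb : IsAlg b) : IsBase (app a b)
  | tens {f : Frag} {a b : Tm f} (ha : IsBase a) (hb : IsBase b) : IsBase (tens a b)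
  | elimTens {f : Frag} {a b : Tm f} (ha : IsAlg a) (hb : IsAlg b) : IsBase (elimTens a b)
  | topI : IsBase topI
  | pair {a b : Tm .pure} (ha : IsAlg a) (hb : IsAlg b) : IsBase (pair a b)
  | elimFst {a b : Tm .pure} (ha : IsAlg a) (hb : IsAlg b) : IsBase (elimFst a b)
  | elimSnd {a b : Tm .pure} (ha : IsAlg a) (hb : IsAlg b) : IsBase (elimSnd a b)
  | elimZero {a : Tm .mixed} (ha : IsAlg a) : IsBase (elimZero a)
  | inl {a : Tm .mixed} (ha : IsAlg a) : IsBase (inl a)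
  | inr {a : Tm .mixed} (ha : IsAlg a) : IsBase (inr a)
  | elimPlus {a b c : Tm .mixed} (ha : IsAlg a) (hb : IsAlg b) (hc : IsAlg c) :
      IsBase (elimPlus a b c)
  | bang {a : Tm .pure} (ha : IsAlg a) : IsBase (bang a)
  | tau {a : Tm .mixed} (ha : IsAlg a) : IsBase (tau a)

/-- Algebraic forms: linear combinations of distinct base forms, with coefficients that are
either all zero or all nonzero. -/
inductive IsAlg : {f : Frag} → Tm f → Prop
  | null {f : Frag} {t : Tm f} (l : List (Tm f))
      (ht : IsSum (l.map (fun b => smul 0 b)) t)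
      (hd : l.Nodup) (hb : ∀ b ∈ l, IsBase b) : IsAlg t
  | comb {f : Frag} {t : Tm f} (l : List (Scal f × Tm f)) (ht : IsLin l t)
      (hd : (l.map Prod.snd).Nodup) (hl : ∀ p ∈ l, p.1 ≠ 0)
      (hb : ∀ p ∈ l, IsBase p.2) : IsAlg t

end

/-- The algebraic equivalence `⇆`: the least congruence that contains the listed identities. -/
inductive AlgEq : {f : Frag} → Tm f → Tm f → Prop
  | refl {f : Frag} (M : Tm f) : AlgEq M M
  | symm {f : Frag} {M N : Tm f} (h : AlgEq M N) : AlgEq N M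
  | trans {f : Frag} {M N O : Tm f} (h : AlgEq M N) (h' : AlgEq N O) : AlgEq M O
  | one_smul {f : Frag} (M : Tm f) : AlgEq (smul 1 M) M
  | add_comm {f : Frag} (M N : Tm f) : AlgEq (add M N) (add N M)
  | add_assoc {f : Frag} (M N O : Tm f) : AlgEq (add M (add N O)) (add (add M N) O)
  | add_smul {f : Frag} (a b : Scal f) (M : Tm f) :
      AlgEq (add (smul a M) (smul b M)) (smul (a + b) M)
  | mul_smul {f : Frag} (a b : Scal f) (M : Tm f) :
      AlgEq (smul a (smul b M)) (smul (a * b) M)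
  | smul_add {f : Frag} (a : Scal f) (M N : Tm f) :
      AlgEq (smul a (add M N)) (add (smul a M) (smul a N))
  | add_null {f : Frag} (M N : Tm f) (h : ∀ M' : Tm f, M ≠ smul 0 M') :
      AlgEq (add M (smul 0 N)) M
  | tens_smul {f : Frag} (a : Scal f) (M N : Tm f) :
      AlgEq (tens M (smul a N)) (smul a (tens M N))
  | smul_tens {f : Frag} (a : Scal f) (M N : Tm f) :
      AlgEq (tens (smul a M) N) (smul a (tens M N))
  | add_tens {f : Frag} (M₁ M₂ N : Tm f) :
      AlgEq (tens (add M₁ M₂) N) (add (tens M₁ N) (tens M₂ N))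
  | tens_add {f : Frag} (M N₁ N₂ : Tm f) :
      AlgEq (tens M (add N₁ N₂)) (add (tens M N₁) (tens M N₂))
  | congr_add {f : Frag} {M M' N N' : Tm f} (hM : AlgEq M M') (hN : AlgEq N N') :
      AlgEq (add M N) (add M' N')
  | congr_smul {f : Frag} (a : Scal f) {M M' : Tm f} (hM : AlgEq M M') :
      AlgEq (smul a M) (smul a M')
  | congr_elimOne {f : Frag} {M M' N N' : Tm f} (hM : AlgEq M M') (hN : AlgEq N N') :
      AlgEq (elimOne M N) (elimOne M' N')
  | congr_lam {f : Frag} {M M' : Tm f} (hM : AlgEq M M') : AlgEq (lam M) (lam M')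
  | congr_app {f : Frag} {M M' N N' : Tm f} (hM : AlgEq M M') (hN : AlgEq N N') :
      AlgEq (app M N) (app M' N')
  | congr_tens {f : Frag} {M M' N N' : Tm f} (hM : AlgEq M M') (hN : AlgEq N N') :
      AlgEq (tens M N) (tens M' N')
  | congr_elimTens {f : Frag} {M M' N N' : Tm f} (hM : AlgEq M M') (hN : AlgEq N N') :
      AlgEq (elimTens M N) (elimTens M' N')
  | congr_pair {m m' n n' : Tm .pure} (hm : AlgEq m m') (hn : AlgEq n n') :
      AlgEq (pair m n) (pair m' n')
  | congr_elimFst {m m' n n' : Tm .pure} (hm : AlgEq m m') (hn : AlgEq n n') :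
      AlgEq (elimFst m n) (elimFst m' n')
  | congr_elimSnd {m m' n n' : Tm .pure} (hm : AlgEq m m') (hn : AlgEq n n') :
      AlgEq (elimSnd m n) (elimSnd m' n')
  | congr_elimZero {m m' : Tm .mixed} (hm : AlgEq m m') : AlgEq (elimZero m) (elimZero m')
  | congr_inl {m m' : Tm .mixed} (hm : AlgEq m m') : AlgEq (inl m) (inl m')
  | congr_inr {m m' : Tm .mixed} (hm : AlgEq m m') : AlgEq (inr m) (inr m')
  | congr_elimPlus {m m' n n' o o' : Tm .mixed} (hm : AlgEq m m') (hn : AlgEq n n')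
      (ho : AlgEq o o') : AlgEq (elimPlus m n o) (elimPlus m' n' o')
  | congr_bang {m m' : Tm .pure} (hm : AlgEq m m') : AlgEq (bang m) (bang m')
  | congr_tau {m m' : Tm .mixed} (hm : AlgEq m m') : AlgEq (tau m) (tau m')

/-- The cut-reduction relation `→`. -/
inductive Step : {f : Frag} → Tm f → Tm f → Prop
  -- cut elimination
  | one {f : Frag} {a : Scal f} {s : Tm f} (M : Tm f) (hs : IsLin [(a, star)] s) :
      Step (elimOne s M) (smul a M)
  | beta {f : Frag} (M : Tm f) {V : Tm f} (hV : IsVal V) : Step (app (lam M) V) (inst V M)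
  | fst {v w : Tm .pure} (t : Tm .pure) (hv : IsVal v) (hw : IsVal w) :
      Step (elimFst (pair v w) t) (inst v t)
  | snd {v w : Tm .pure} (t : Tm .pure) (hv : IsVal v) (hw : IsVal w) :
      Step (elimSnd (pair v w) t) (inst w t)
  | caseInl {v : Tm .mixed} (m n : Tm .mixed) (hv : IsVal v) :
      Step (elimPlus (inl v) m n) (inst v m)
  | caseInr {v : Tm .mixed} (m n : Tm .mixed) (hv : IsVal v) :
      Step (elimPlus (inr v) m n) (inst v n)
  | tensor {f : Frag} {V W : Tm f} (M : Tm f) (hV : IsVn V) (hW : IsVn W) :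
      Step (elimTens (tens V W) M) (inst₂ V W M)
  -- commutation of sums and scalars with the connectives
  | commTop (a : Scal .pure) : Step (smul a topI) topI
  | commLam {f : Frag} (l : List (Scal f × Tm f)) {s t : Tm f}
      (hs : IsLin (l.map (fun p => (p.1, lam p.2))) s) (hc : IsComb s)
      (hd : (l.map Prod.snd).Nodup)
      (ht : IsSum (l.map (fun p => smul p.1 p.2)) t) : Step s (lam t)
  | commPair (l : List (Scal .pure × (Tm .pure × Tm .pure))) {s t u : Tm .pure}
      (hs : IsLin (l.map (fun p => (p.1, pair p.2.1 p.2.2))) s) (hc : IsComb s)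
      (hd : (l.map Prod.snd).Nodup) (hv : ∀ p ∈ l, IsVal p.2.1 ∧ IsVal p.2.2)
      (ht : IsSum (l.map (fun p => smul p.1 p.2.1)) t)
      (hu : IsSum (l.map (fun p => smul p.1 p.2.2)) u) : Step s (pair t u)
  | commPlus (l : List (Scal .mixed × Tm .mixed)) {s t : Tm .mixed} (m n : Tm .mixed)
      (hs : IsLin l s) (hc : IsComb s) (hd : (l.map Prod.snd).Nodup) (hv : ∀ p ∈ l, IsVb p.2)
      (ht : IsSum (l.map (fun p => smul p.1 (elimPlus p.2 m n))) t) : Step (elimPlus s m n) t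
  | commTens {f : Frag} (l : List (Scal f × Tm f)) {s t : Tm f} (M : Tm f)
      (hs : IsLin l s) (hc : IsComb s) (hd : (l.map Prod.snd).Nodup) (hv : ∀ p ∈ l, IsVb p.2)
      (ht : IsSum (l.map (fun p => smul p.1 (elimTens p.2 M))) t) : Step (elimTens s M) t
  | commInl (l : List (Scal .mixed × Tm .mixed)) {s t : Tm .mixed}
      (hs : IsLin l s) (hc : IsComb s) (hd : (l.map Prod.snd).Nodup) (hv : ∀ p ∈ l, IsVb p.2)
      (ht : IsSum (l.map (fun p => smul p.1 (inl p.2))) t) : Step (inl s) t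
  | commInr (l : List (Scal .mixed × Tm .mixed)) {s t : Tm .mixed}
      (hs : IsLin l s) (hc : IsComb s) (hd : (l.map Prod.snd).Nodup) (hv : ∀ p ∈ l, IsVb p.2)
      (ht : IsSum (l.map (fun p => smul p.1 (inr p.2))) t) : Step (inr s) t
  -- the modality
  | cast {v w : Tm .pure} (hv : IsVal v) (hw : IsVal w) :
      Step (tau (tens (bang v) (bang w))) (bang (tens v w))
  | commTau (l : List (Scal .mixed × Tm .mixed)) {s t : Tm .mixed}
      (hs : IsLin l s) (hc : IsComb s) (hd : (l.map Prod.snd).Nodup) (hv : ∀ p ∈ l, IsVb p.2)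
      (ht : IsSum (l.map (fun p => smul p.1 (tau p.2))) t) : Step (tau s) t
  | commBang (a : ℂ) {v : Tm .pure} (ha : a ≠ 1) (hv : IsVb v) :
      Step (bang (smul (f := .pure) a v)) (smul (f := .mixed) (‖a‖₊ ^ 2) (bang v))
  | commBangApp (l k : List (Scal .mixed × Tm .pure)) {s t u : Tm .mixed}
      (hs : IsLin (l.map (fun p => (p.1, bang p.2))) s) (hdl : (l.map Prod.snd).Nodup)
      (hvl : ∀ p ∈ l, IsVal p.2)
      (ht : IsLin (k.map (fun q => (q.1, bang q.2))) t) (hdk : (k.map Prod.snd).Nodup)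
      (hvk : ∀ q ∈ k, IsVal q.2)
      (hu : IsSum ((l.product k).map
        (fun r => smul (r.1.1 * r.2.1) (bang (app r.1.2 r.2.2)))) u) : Step (app s t) u
  -- evaluation contexts
  | ctxAdd {f : Frag} {M M' : Tm f} (N : Tm f) (h : Step M M') : Step (add M N) (add M' N)
  | ctxSmul {f : Frag} (a : Scal f) {M M' : Tm f} (h : Step M M') : Step (smul a M) (smul a M')
  | ctxElimZero {m m' : Tm .mixed} (h : Step m m') : Step (elimZero m) (elimZero m')
  | ctxElimOne {f : Frag} {M M' : Tm f} (N : Tm f) (h : Step M M') :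
      Step (elimOne M N) (elimOne M' N)
  | ctxAppL {f : Frag} {M M' : Tm f} (N : Tm f) (h : Step M M') : Step (app M N) (app M' N)
  | ctxAppR {f : Frag} {V N N' : Tm f} (hV : IsVal V) (h : Step N N') :
      Step (app V N) (app V N')
  | ctxPairL {m m' : Tm .pure} (n : Tm .pure) (h : Step m m') : Step (pair m n) (pair m' n)
  | ctxPairR {v n n' : Tm .pure} (hv : IsVal v) (h : Step n n') : Step (pair v n) (pair v n')
  | ctxElimFst {m m' : Tm .pure} (n : Tm .pure) (h : Step m m') :
      Step (elimFst m n) (elimFst m' n)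
  | ctxElimSnd {m m' : Tm .pure} (n : Tm .pure) (h : Step m m') :
      Step (elimSnd m n) (elimSnd m' n)
  | ctxInl {m m' : Tm .mixed} (h : Step m m') : Step (inl m) (inl m')
  | ctxInr {m m' : Tm .mixed} (h : Step m m') : Step (inr m) (inr m')
  | ctxElimPlus {m m' : Tm .mixed} (n o : Tm .mixed) (h : Step m m') :
      Step (elimPlus m n o) (elimPlus m' n o)
  | ctxTensL {f : Frag} {M M' : Tm f} (N : Tm f) (h : Step M M') : Step (tens M N) (tens M' N)
  | ctxTensR {f : Frag} {V N N' : Tm f} (hV : IsVal V) (h : Step N N') :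
      Step (tens V N) (tens V N')
  | ctxElimTens {f : Frag} {M M' : Tm f} (N : Tm f) (h : Step M M') :
      Step (elimTens M N) (elimTens M' N)
  | ctxBang {m m' : Tm .pure} (h : Step m m') : Step (bang m) (bang m')
  | ctxTau {m m' : Tm .mixed} (h : Step m m') : Step (tau m) (tau m')

/-- The composite reduction relation `↪`. -/
inductive Red {f : Frag} : Tm f → Tm f → Prop
  | step {M N : Tm f} (h : Step M N) : Red M N
  | val {M V : Tm f} (h : AlgEq M V) (hV : IsVal V) : Red M V
  | alg {M A N : Tm f} (hM : ¬ ∃ N', Step M N') (h : AlgEq M A) (hA : IsAlg A)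
      (hN : Step A N) : Red M N

/-- The reflexive and transitive closure of `↪`. -/
def Reds {f : Frag} : Tm f → Tm f → Prop := Relation.ReflTransGen Red

/-- Elimination contexts: terms whose only free variable, index `0`, is the hole `[.]`. (When
such a term is well typed with the hole as only declared variable, linearity forbids the hole
in the side terms.) -/
inductive IsElimCtx : {f : Frag} → Tm f → Prop
  | hole {f : Frag} : IsElimCtx (var 0 : Tm f)
  | elimZero {E : Tm .mixed} (hE : IsElimCtx E) : IsElimCtx (elimZero E)
  | elimOne {f : Frag} {E : Tm f} (hE : IsElimCtx E) (M : Tm f) : IsElimCtx (elimOne E M)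
  | app {f : Frag} {E : Tm f} (hE : IsElimCtx E) (M : Tm f) : IsElimCtx (app E M)
  | elimFst {E : Tm .pure} (hE : IsElimCtx E) (m : Tm .pure) : IsElimCtx (elimFst E m)
  | elimSnd {E : Tm .pure} (hE : IsElimCtx E) (m : Tm .pure) : IsElimCtx (elimSnd E m)
  | elimPlus {E : Tm .mixed} (hE : IsElimCtx E) (m n : Tm .mixed) :
      IsElimCtx (elimPlus E m n)
  | elimTens {f : Frag} {E : Tm f} (hE : IsElimCtx E) (M : Tm f) : IsElimCtx (elimTens E M)

/-- The propositions at which one observes: the units of both fragments, and the modality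
applied to the pure unit. -/
inductive IsObs : {f : Frag} → Ty f → Prop
  | one {f : Frag} : IsObs (.one : Ty f)
  | bang : IsObs (.bang .one)

/-- Contextual equivalence of closed terms of proposition `U`: in every elimination context of
observable proposition, the two terms reduce to a common value. -/
def CtxEquiv {f : Frag} (U : Ty f) (M N : Tm f) : Prop :=
  ∀ (E : Tm f) (T : Ty f), IsElimCtx E → IsObs T → HasType [some U] E T →
    ∃ V : Tm f, IsVal V ∧ Reds (inst M E) V ∧ Reds (inst N E) V

/-- The substitution `s` replaces each variable declared in `Δ` by a closed term of the declared
proposition. -/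
def Closes {f : Frag} (s : ℕ → Tm f) (Δ : Ctx f) : Prop :=
  ∀ (i : ℕ) (S : Ty f), Δ[i]? = some (some S) → HasType [] (s i) S

/-- Contextual equivalence of terms of proposition `U` in a context `Δ`: contextual equivalence
of all their closed instances. -/
def CtxEquivIn {f : Frag} (Δ : Ctx f) (U : Ty f) (M N : Tm f) : Prop :=
  ∀ s : ℕ → Tm f, Closes s Δ → CtxEquiv U (subst s M) (subst s N)

end BIMALL

namespace BIMALL
open Tm

/-! ### Contexts -/

-- The corollary follows from a denotational semantics in which linearity is evident, once that
-- semantics is known to determine observable behaviour.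
--
-- A proposition `T` is read as the space of complex vectors with coordinates in the finite set `idx
-- T`; tensor and implication use pairs of indices, the two additive connectives a disjoint union.
-- The modality sends `P` to the tensor product of its space with the conjugate space, and `bang m`
-- denotes `v ⊗ conj v` if `m` denotes `v`. A derivation then denotes a map that is linear in every
-- declared variable (`Den.linear`). Application is bilinear, so the two sides of the corollary
-- denote the same map, and it remains to show that equal denotations imply contextual equivalence
-- (`Den.ctxEquivIn`).
--
-- By the substitution lemma `Den.subst`, plugging closed instances of both sides into an
-- elimination context gives closed terms of an observable proposition with the same denotation.
-- Such a term reduces to a multiple of `star` or of `bang star` (`CDen.reds`), and the coefficient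
-- can be read off the denotation. Hence both terms reach the same value. No confluence is needed:
-- any reduction sequence that ends at a multiple of this term ends at the right one.
--
-- Adequacy has three ingredients. Soundness: `Step` preserves the typing and denotation of closed
-- terms and decreases a lexicographic measure (`Step.sound`). Progress: every closed typed term is
-- algebraically equivalent to an algebraic form that reduces or is a value (`CDen.good`,
-- `exists_whn`). Normalisation: passing to that form neither changes the denotation nor increases
-- the measure (`Better`). The last point has to be directed, because `AlgEq` read backwards can
-- introduce untypable summands.
--
-- Terms carry no annotations, so one judgement may have derivations that differ in the propositions
-- of their cuts. That they all denote the same map (`Den.coherent`) is shown by a logical relation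
-- between the spaces of two possibly different propositions (`Rel`, `Den.rel`, `rel_self`).

theorem Ctx.Split.append_isEmpty {f : Frag} {Γ Γ₁ Γ₂ : Ctx f} (h : Γ.Split Γ₁ Γ₂) {Θ : Ctx f}
    (hΘ : Θ.IsEmpty) : Ctx.Split (Γ ++ Θ) (Γ₁ ++ Θ) (Γ₂ ++ Θ) := by
  induction h with
  | nil =>
    induction Θ with
    | nil => exact .nil
    | cons o Θ ih =>
      obtain rfl := hΘ o (by simp)
      exact .none (ih fun o' h' => hΘ o' (by simp [h']))
  | none h ih => exact .none ih
  | left S h ih => exact .left S ih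
  | right S h ih => exact .right S ih

theorem Ctx.Single.append_isEmpty {f : Frag} {Γ : Ctx f} {n : ℕ} {S : Ty f} (h : Γ.Single n S)
    {Θ : Ctx f} (hΘ : Θ.IsEmpty) : Ctx.Single (Γ ++ Θ) n S := by
  induction h with
  | here h =>
    refine .here fun o ho => ?_
    rcases List.mem_append.1 ho with h' | h'
    exacts [h o h', hΘ o h']
  | there h ih => exact .there ih

theorem Ctx.IsEmpty.append {f : Frag} {Γ Θ : Ctx f} (h : Γ.IsEmpty) (hΘ : Θ.IsEmpty) :
    Ctx.IsEmpty (Γ ++ Θ) := fun o ho => by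
  rcases List.mem_append.1 ho with h' | h'
  exacts [h o h', hΘ o h']

theorem Ctx.isEmpty_append {f : Frag} {Γ Θ : Ctx f} :
    Ctx.IsEmpty (Γ ++ Θ) ↔ Γ.IsEmpty ∧ Θ.IsEmpty :=
  ⟨fun h => ⟨fun o ho => h o (by simp [ho]), fun o ho => h o (by simp [ho])⟩,
    fun h => h.1.append h.2⟩

theorem Ctx.isEmpty_nil {f : Frag} : Ctx.IsEmpty ([] : Ctx f) := fun _ h => by simp at h

/-- In a substitution the prefix `Γ` holds the variables bound on the way down and `Θ` those to be
replaced. The lengths are recorded because the length of the prefix is the number of liftings of the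
substitution. -/
theorem Ctx.Split.exists_append {f : Frag} {Γ Θ : Ctx f} {Ξ₁ Ξ₂ : Ctx f}
    (h : Ctx.Split (Γ ++ Θ) Ξ₁ Ξ₂) : ∃ Γ₁ Γ₂ Θ₁ Θ₂, Ξ₁ = Γ₁ ++ Θ₁ ∧ Ξ₂ = Γ₂ ++ Θ₂ ∧
      Γ₁.length = Γ.length ∧ Γ₂.length = Γ.length ∧ Ctx.Split Γ Γ₁ Γ₂ ∧ Ctx.Split Θ Θ₁ Θ₂ := by
  induction Γ generalizing Ξ₁ Ξ₂ with
  | nil => exact ⟨[], [], Ξ₁, Ξ₂, rfl, rfl, rfl, rfl, .nil, h⟩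
  | cons o Γ ih =>
    rw [List.cons_append] at h
    cases h with
    | none h =>
      obtain ⟨Γ₁, Γ₂, Θ₁, Θ₂, rfl, rfl, h1, h2, h3, h4⟩ := ih h
      exact ⟨.none :: Γ₁, .none :: Γ₂, Θ₁, Θ₂, rfl, rfl, by simp [h1], by simp [h2], .none h3, h4⟩
    | left S h =>
      obtain ⟨Γ₁, Γ₂, Θ₁, Θ₂, rfl, rfl, h1, h2, h3, h4⟩ := ih h
      exact ⟨some S :: Γ₁, .none :: Γ₂, Θ₁, Θ₂, rfl, rfl, by simp [h1], by simp [h2], .left S h3, h4⟩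
    | right S h =>
      obtain ⟨Γ₁, Γ₂, Θ₁, Θ₂, rfl, rfl, h1, h2, h3, h4⟩ := ih h
      exact ⟨.none :: Γ₁, some S :: Γ₂, Θ₁, Θ₂, rfl, rfl, by simp [h1], by simp [h2], .right S h3, h4⟩

theorem Ctx.Split.length {f : Frag} {Γ Γ₁ Γ₂ : Ctx f} (h : Γ.Split Γ₁ Γ₂) :
    Γ₁.length = Γ.length ∧ Γ₂.length = Γ.length := by
  induction h <;> simp_all

/-- The context declares variable `i` with proposition `S`. -/
def Ctx.Has {f : Frag} (Γ : Ctx f) (i : ℕ) (S : Ty f) : Prop := Γ[i]? = some (some S)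

@[simp] theorem Ctx.has_zero {f : Frag} {o : Option (Ty f)} {Γ : Ctx f} {S : Ty f} :
    Ctx.Has (o :: Γ) 0 S ↔ o = some S := by simp [Ctx.Has]

@[simp] theorem Ctx.has_succ {f : Frag} {o : Option (Ty f)} {Γ : Ctx f} {i : ℕ} {S : Ty f} :
    Ctx.Has (o :: Γ) (i + 1) S ↔ Ctx.Has Γ i S := by simp [Ctx.Has]

@[simp] theorem Ctx.not_has_nil {f : Frag} {i : ℕ} {S : Ty f} : ¬ Ctx.Has [] i S := by
  simp [Ctx.Has]

theorem Ctx.Has.unique {f : Frag} {Γ : Ctx f} {i : ℕ} {S S' : Ty f} (h : Γ.Has i S)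
    (h' : Γ.Has i S') : S = S' := by
  unfold Ctx.Has at h h'; simp_all

theorem Ctx.IsEmpty.not_has {f : Frag} {Γ : Ctx f} (h : Γ.IsEmpty) {i : ℕ} {S : Ty f} :
    ¬ Γ.Has i S := fun h' => by
  have := h _ (List.mem_of_getElem? h'); simp at this

theorem Ctx.Single.has {f : Frag} {Γ : Ctx f} {n : ℕ} {S : Ty f} (h : Γ.Single n S) :
    Γ.Has n S := by
  induction h <;> simp_all

theorem Ctx.Single.eq_of_has {f : Frag} {Γ : Ctx f} {n : ℕ} {S : Ty f} (h : Γ.Single n S)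
    {i : ℕ} {S' : Ty f} (hi : Γ.Has i S') : i = n := by
  induction h generalizing i with
  | here h =>
    cases i with
    | zero => rfl
    | succ i => exact absurd (Ctx.has_succ.1 hi) h.not_has
  | there h ih =>
    cases i with
    | zero => simp at hi
    | succ i => rw [ih (Ctx.has_succ.1 hi)]

theorem Ctx.Split.has_iff {f : Frag} {Γ Γ₁ Γ₂ : Ctx f} (h : Γ.Split Γ₁ Γ₂) {i : ℕ} {S : Ty f} :
    Γ.Has i S ↔ Γ₁.Has i S ∨ Γ₂.Has i S := by
  induction h generalizing i with
  | nil => simp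
  | none h ih => cases i <;> simp [ih]
  | left S h ih => cases i <;> simp [ih]
  | right S h ih => cases i <;> simp [ih]

theorem Ctx.Split.disjoint {f : Frag} {Γ Γ₁ Γ₂ : Ctx f} (h : Γ.Split Γ₁ Γ₂) {i : ℕ} {S S' : Ty f}
    (h₁ : Γ₁.Has i S) (h₂ : Γ₂.Has i S') : False := by
  induction h generalizing i with
  | nil => simp at h₁
  | none h ih => cases i <;> simp_all
  | left S h ih => cases i <;> simp_all
  | right S h ih => cases i <;> simp_all

theorem Ctx.split_nil {f : Frag} {Γ₁ Γ₂ : Ctx f} (h : Ctx.Split [] Γ₁ Γ₂) : Γ₁ = [] ∧ Γ₂ = [] := by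
  cases h; simp

/-- Contexts are positional, so a closed term used beside `Δ` needs a context of the same length
that declares nothing. -/
theorem Ctx.exists_isEmpty_split {f : Frag} (Δ : Ctx f) :
    ∃ Θ : Ctx f, Θ.IsEmpty ∧ Ctx.Split Δ Θ Δ := by
  induction Δ with
  | nil => exact ⟨[], Ctx.isEmpty_nil, .nil⟩
  | cons o Δ ih =>
    obtain ⟨Θ, h1, h2⟩ := ih
    refine ⟨none :: Θ, fun o ho => ?_, ?_⟩
    · rcases List.mem_cons.1 ho with rfl | h
      exacts [rfl, h1 _ h]
    · cases o with
      | none => exact .none h2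
      | some S => exact .right S h2

/-! ### Renamings and iterated lifting -/

theorem Tm.upr_eq_self {r : ℕ → ℕ} {k : ℕ} (h : ∀ i < k, r i = i) : ∀ i < k + 1, upr r i = i := by
  intro i hi
  cases i with
  | zero => rfl
  | succ i => simp [upr, h i (by omega)]

/-- Only indices below the length of the context can occur free. For the empty context this makes a
closed term invariant under every renaming, so that carrying it under binders does not change it. -/
theorem HasType.rename_eq_self {f : Frag} {Γ : Ctx f} {M : Tm f} {T : Ty f} (h : HasType Γ M T) :
    ∀ {r : ℕ → ℕ}, (∀ i < Γ.length, r i = i) → rename r M = M := by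
  induction h with
  | @ax f Γ n S h =>
    intro r hr
    have : n < Γ.length := by
      have := h.has; unfold Ctx.Has at this
      exact (List.getElem?_eq_some_iff.1 this).1
    simp [rename, hr n this]
  | sum _ _ ih ih' => intro r hr; simp [rename, ih hr, ih' hr]
  | prod a _ ih => intro r hr; simp [rename, ih hr]
  | topI Γ => intro r hr; rfl
  | zeroE A hs _ ih => intro r hr; simp [rename, ih (r := r) (by rwa [hs.length.1])]
  | oneI h => intro r hr; rfl
  | oneE hs _ _ ih ih' =>
    intro r hr
    simp [rename, ih (r := r) (by rwa [hs.length.1]), ih' (r := r) (by rwa [hs.length.2])]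
  | lolliI _ ih => intro r hr; simp [rename, ih (upr_eq_self hr)]
  | lolliE hs _ _ ih ih' =>
    intro r hr
    simp [rename, ih (r := r) (by rwa [hs.length.1]), ih' (r := r) (by rwa [hs.length.2])]
  | conjI _ _ ih ih' => intro r hr; simp [rename, ih hr, ih' hr]
  | conjE₁ hs _ _ ih ih' =>
    intro r hr
    rw [← hs.length.2] at hr
    simp [rename, ih (r := r) (by rwa [hs.length.1, ← hs.length.2]), ih' (upr_eq_self hr)]
  | conjE₂ hs _ _ ih ih' =>
    intro r hr
    rw [← hs.length.2] at hr
    simp [rename, ih (r := r) (by rwa [hs.length.1, ← hs.length.2]), ih' (upr_eq_self hr)]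
  | plusI₁ B _ ih => intro r hr; simp [rename, ih hr]
  | plusI₂ A _ ih => intro r hr; simp [rename, ih hr]
  | plusE hs _ _ _ ih ih' ih'' =>
    intro r hr
    rw [← hs.length.2] at hr
    simp [rename, ih (r := r) (by rwa [hs.length.1, ← hs.length.2]), ih' (upr_eq_self hr),
      ih'' (upr_eq_self hr)]
  | tensorI hs _ _ ih ih' =>
    intro r hr
    simp [rename, ih (r := r) (by rwa [hs.length.1]), ih' (r := r) (by rwa [hs.length.2])]
  | tensorE hs _ _ ih ih' =>
    intro r hr
    rw [← hs.length.2] at hr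
    simp [rename, ih (r := r) (by rwa [hs.length.1, ← hs.length.2]),
      ih' (upr_eq_self (upr_eq_self hr))]
  | bangI h _ ih => intro r hr; rfl
  | bangE hs _ _ ih ih' =>
    intro r hr
    simp [rename, ih (r := r) (by rwa [hs.length.1]), ih' (r := r) (by rwa [hs.length.2])]
  | tau _ ih => intro r hr; simp [rename, ih hr]

/-- A substitution lifted under `k` binders. -/
def Tm.upn {f : Frag} : ℕ → (ℕ → Tm f) → ℕ → Tm f
  | 0, s => s
  | k + 1, s => up (upn k s)

theorem Tm.upn_var_lt {f : Frag} {k : ℕ} {s : ℕ → Tm f} {n : ℕ} (h : n < k) :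
    upn k s n = var n := by
  induction k generalizing n with
  | zero => omega
  | succ k ih =>
    cases n with
    | zero => rfl
    | succ n => simp [upn, up, scons, ih (by omega : n < k), rename]

theorem Tm.upn_add_of_closed {f : Frag} {s : ℕ → Tm f} {j : ℕ} {S : Ty f}
    (h : HasType [] (s j) S) (k : ℕ) : upn k s (k + j) = s j := by
  induction k with
  | zero => simp [upn]
  | succ k ih =>
    rw [show k + 1 + j = (k + j) + 1 by omega]
    simp [upn, up, scons, ih, h.rename_eq_self]

theorem Ctx.Single.append_cases {f : Frag} {Γ Θ : Ctx f} {n : ℕ} {S : Ty f}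
    (h : Ctx.Single (Γ ++ Θ) n S) : (n < Γ.length ∧ Γ.Single n S ∧ Θ.IsEmpty) ∨
      ∃ j, n = Γ.length + j ∧ Γ.IsEmpty ∧ Θ.Single j S := by
  induction Γ generalizing n with
  | nil => exact .inr ⟨n, by simp, Ctx.isEmpty_nil, h⟩
  | cons o Γ ih =>
    rw [List.cons_append] at h
    cases h with
    | here h =>
      rw [Ctx.isEmpty_append] at h
      exact .inl ⟨by simp, .here h.1, h.2⟩
    | there h =>
      rcases ih h with ⟨h1, h2, h3⟩ | ⟨j, rfl, h2, h3⟩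
      · exact .inl ⟨by simpa using h1, .there h2, h3⟩
      · refine .inr ⟨j, by simp; omega, fun o ho => ?_, h3⟩
        rcases List.mem_cons.1 ho with rfl | h
        exacts [rfl, h2 _ h]

/-! ### The measure -/

namespace Tm

/-- The head of the term is a sum or a scalar multiple, possibly below tensors. -/
def comb : {f : Frag} → Tm f → Bool
  | _, add _ _ => true
  | _, smul _ _ => true
  | _, tens m n => comb m || comb n
  | _, _ => false

/-- A weight that is linear in each linear variable and that cut elimination decreases. -/
def wt : {f : Frag} → Tm f → ℕ
  | _, var _ => 1
  | _, add m n => wt m + wt n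
  | _, smul _ m => wt m
  | _, star => 1
  -- A contracted cut weighs at most the product of the weights of its parts; the factor 2 makes the
  -- redex strictly heavier.
  | _, elimOne m n => 2 * wt m * wt n
  -- The extra 1 here and in `pair` is counted once per summand of a combination and only once after
  -- the combination has moved inside, so the weight drops as soon as there are two summands.
  | _, lam m => wt m + 1
  | _, app m n => 2 * wt m * wt n
  | _, tens m n => wt m * wt n
  | _, elimTens m n => 2 * wt m * wt n
  | _, topI => 1
  | _, pair m n => wt m + wt n + 1
  | _, elimFst m n => 2 * wt m * wt n
  | _, elimSnd m n => 2 * wt m * wt n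
  | _, elimZero m => wt m
  | _, inl m => wt m
  | _, inr m => wt m
  | _, elimPlus m n o => 2 * wt m * (wt n + wt o)
  -- With this factor the product of two combinations of `bang` terms, once expanded, weighs exactly
  -- the product of their weights.
  | _, bang m => 2 * wt m
  | _, tau m => 2 * wt m

/-- The number of combinations that can still move out of a constructor. -/
def outc (c e w : ℕ) (b : Bool) : ℕ := c * (2 * e + if b then w else 0)

/-- The potential of the combinations that commute outwards. -/
def outw : {f : Frag} → Tm f → ℕ
  | _, var _ => 0
  | _, add m n => outw m + outw n
  | _, smul _ m => outw m
  | _, star => 0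
  | _, elimOne m _ => outw m
  | _, lam _ => 0
  | _, app m n => outw m + outw n
  | _, tens m n => outw m * wt n + wt m * outw n
  -- The first argument of `outc` is the factor by which the constructor multiplies the weight of
  -- its argument. Inside `outc` the potential of the argument is doubled: when an inner commutation
  -- exposes a new combination here, half of the potential lost below pays for the weight that is
  -- now waiting to move out.
  | _, elimTens m n => outc (2 * wt n) (outw m) (wt m) (comb m)
  | _, topI => 0
  | _, pair m n => outw m + outw n
  | _, elimFst m _ => outw m
  | _, elimSnd m _ => outw m
  | _, elimZero m => outw m
  | _, inl m => outc 1 (outw m) (wt m) (comb m)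
  | _, inr m => outc 1 (outw m) (wt m) (comb m)
  | _, elimPlus m n o => outc (2 * (wt n + wt o)) (outw m) (wt m) (comb m)
  | _, bang m => outc 2 (outw m) (wt m) (comb m)
  | _, tau m => outc 2 (outw m) (wt m) (comb m)

/-- The potential of the scalars that commute inwards. -/
def inw : {f : Frag} → Tm f → ℕ
  | _, var _ => 0
  | _, add m n => inw m + inw n
  | _, smul _ m => inw m + wt m
  | _, star => 0
  | _, elimOne m _ => inw m
  | _, lam _ => 0
  | _, app m n => inw m + inw n
  | _, tens m n => inw m * wt n + wt m * inw n
  | _, elimTens m _ => inw m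
  | _, topI => 0
  | _, pair m n => inw m + inw n
  | _, elimFst m _ => inw m
  | _, elimSnd m _ => inw m
  | _, elimZero m => inw m
  | _, inl m => inw m
  | _, inr m => inw m
  | _, elimPlus m _ _ => inw m
  | _, bang m => inw m
  | _, tau m => inw m

theorem wt_pos {f : Frag} (M : Tm f) : 0 < wt M := by
  induction M <;> simp_all [wt]

end Tm

/-- The product of the weights of the terms substituted for the declared variables. -/
def Ctx.wprod {f : Frag} : Ctx f → (ℕ → Tm f) → ℕ
  | [], _ => 1
  | none :: Θ, s => Ctx.wprod Θ (fun i => s (i + 1))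
  | some _ :: Θ, s => wt (s 0) * Ctx.wprod Θ (fun i => s (i + 1))

theorem Ctx.wprod_pos {f : Frag} (Θ : Ctx f) (s : ℕ → Tm f) : 0 < Θ.wprod s := by
  induction Θ generalizing s with
  | nil => simp [Ctx.wprod]
  | cons o Θ ih => cases o <;> simp [Ctx.wprod, ih, wt_pos]

theorem Ctx.Split.wprod {f : Frag} {Θ Θ₁ Θ₂ : Ctx f} (h : Θ.Split Θ₁ Θ₂) (s : ℕ → Tm f) :
    Θ.wprod s = Θ₁.wprod s * Θ₂.wprod s := by
  induction h generalizing s with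
  | nil => simp [Ctx.wprod]
  | none h ih => simp [Ctx.wprod, ih]
  | left S h ih => simp [Ctx.wprod, ih, mul_assoc]
  | right S h ih => simp [Ctx.wprod, ih]; ring

theorem Ctx.Single.le_wprod {f : Frag} {Θ : Ctx f} {n : ℕ} {S : Ty f} (h : Θ.Single n S)
    (s : ℕ → Tm f) : wt (s n) ≤ Θ.wprod s := by
  induction h generalizing s with
  | here h => exact Nat.le_mul_of_pos_right _ (Ctx.wprod_pos _ _)
  | there h ih => exact ih fun i => s (i + 1)

/-! ### Scalars as complex numbers -/

/-- The complex number denoted by a scalar. -/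
noncomputable def sc : {f : Frag} → Scal f → ℂ
  | .pure, a => a
  | .mixed, a => ((a : ℝ) : ℂ)

@[simp] theorem sc_zero {f : Frag} : sc (0 : Scal f) = 0 := by
  cases f
  · rfl
  · exact congrArg ((↑) : ℝ → ℂ) NNReal.coe_zero

@[simp] theorem sc_one {f : Frag} : sc (1 : Scal f) = 1 := by
  cases f
  · rfl
  · exact congrArg ((↑) : ℝ → ℂ) NNReal.coe_one

@[simp] theorem sc_add {f : Frag} (a b : Scal f) : sc (a + b) = sc a + sc b := by
  cases f
  · rfl
  · exact (congrArg ((↑) : ℝ → ℂ) (NNReal.coe_add a b)).trans (Complex.ofReal_add _ _)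

@[simp] theorem sc_mul {f : Frag} (a b : Scal f) : sc (a * b) = sc a * sc b := by
  cases f
  · rfl
  · exact (congrArg ((↑) : ℝ → ℂ) (NNReal.coe_mul a b)).trans (Complex.ofReal_mul _ _)

/-- Both fragments are interpreted over the complex numbers. Injectivity allows a coefficient to be
recovered from a denotation. -/
theorem sc_injective {f : Frag} : Function.Injective (sc : Scal f → ℂ) := by
  cases f
  · exact fun _ _ h => h
  · exact fun _ _ h => NNReal.coe_injective (Complex.ofReal_injective h)

/-! ### Vectors -/

/-- Indices of basis vectors. -/
inductive Ix : Type
  | unit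
  | pr (i j : Ix)
  | inl (i : Ix)
  | inr (i : Ix)
  deriving DecidableEq

/-- The indices of the basis of the space that interprets a proposition. -/
def idx : {f : Frag} → Ty f → Finset Ix
  | _, .top => ∅
  | _, .zero => ∅
  | _, .one => {.unit}
  | _, .lolli S T => (idx S ×ˢ idx T).image fun p => .pr p.1 p.2
  | _, .tensor S T => (idx S ×ˢ idx T).image fun p => .pr p.1 p.2
  | _, .conj P Q => (idx P).image .inl ∪ (idx Q).image .inr
  | _, .plus A B => (idx A).image .inl ∪ (idx B).image .inr
  | _, .bang P => (idx P ×ˢ idx P).image fun p => .pr p.1 p.2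

/-- One ambient space serves all propositions, so that vectors arising from different derivations
can be compared; the proposition enters through `Supp` only. -/
abbrev Vec : Type := Ix → ℂ

/-- The vector belongs to the space that interprets the proposition. -/
def Supp {f : Frag} (T : Ty f) (v : Vec) : Prop := ∀ i, i ∉ idx T → v i = 0

/-- Basis vectors. -/
def bas (i : Ix) : Vec := Pi.single i 1

def vunit : Vec := bas .unit

def vtens (v w : Vec) : Vec
  | .pr i j => v i * w j
  | _ => 0

/-- Conjugation in the fixed basis, so that `vtens v (vconj v)` is the matrix of the projection-like
operator `v v*` that interprets `bang`. -/
noncomputable def vconj (v : Vec) : Vec := fun i => starRingEnd ℂ (v i)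

/-- The matrix of `g`, which is sampled at the basis vectors of the space of `S` only; a linear `g`
is recovered from it by `Den.vapp_vlam`. -/
def vlam {f : Frag} (S : Ty f) (g : Vec → Vec) : Vec
  | .pr i j => if i ∈ idx S then g (bas i) j else 0
  | _ => 0

noncomputable def vapp {f : Frag} (S : Ty f) (g v : Vec) : Vec :=
  fun j => ∑ i ∈ idx S, g (.pr i j) * v i

/-- The coordinates of the operator come grouped as (input, output) for the space and for its
conjugate. The sum pairs both inputs with the two indices of the argument and thereby applies the
operator on both sides at once. -/
noncomputable def vapp₂ {f : Frag} (S : Ty f) (g v : Vec) : Vec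
  | .pr j j' => ∑ p ∈ idx S ×ˢ idx S, g (.pr (.pr p.1 j) (.pr p.2 j')) * v (.pr p.1 p.2)
  | _ => 0

/-- The linear map on the tensor product that a bilinear `g` induces, given by its values on pairs
of basis vectors. -/
noncomputable def velim {f : Frag} (S T : Ty f) (z : Vec) (g : Vec → Vec → Vec) : Vec :=
  ∑ p ∈ idx S ×ˢ idx T, z (.pr p.1 p.2) • g (bas p.1) (bas p.2)

def vpair (v w : Vec) : Vec
  | .inl i => v i
  | .inr i => w i
  | _ => 0

def vfst (v : Vec) : Vec := fun i => v (.inl i)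

def vsnd (v : Vec) : Vec := fun i => v (.inr i)

/-- The exchange of the two middle factors, from (P ⊗ conj P) ⊗ (Q ⊗ conj Q) to (P ⊗ Q) ⊗ conj (P ⊗
Q). -/
def vtau (z : Vec) : Vec
  | .pr (.pr i j) (.pr i' j') => z (.pr (.pr i i') (.pr j j'))
  | _ => 0

/-- Extension of an environment by a vector for index `0`. -/
def econs (v : Vec) (ρ : ℕ → Vec) : ℕ → Vec
  | 0 => v
  | n + 1 => ρ n

/-- Derivations together with the multilinear maps they denote. -/
inductive Den : {f : Frag} → Ctx f → Tm f → Ty f → ((ℕ → Vec) → Vec) → Prop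
  | ax {f : Frag} {Γ : Ctx f} {n : ℕ} {S : Ty f} (h : Γ.Single n S) :
      Den Γ (var n) S (fun ρ => ρ n)
  | sum {f : Frag} {Γ : Ctx f} {M N : Tm f} {S : Ty f} {d e}
      (hM : Den Γ M S d) (hN : Den Γ N S e) : Den Γ (add M N) S (fun ρ => d ρ + e ρ)
  | prod {f : Frag} {Γ : Ctx f} {M : Tm f} {S : Ty f} {d} (a : Scal f)
      (hM : Den Γ M S d) : Den Γ (smul a M) S (fun ρ => sc a • d ρ)
  -- This rule and `zeroE` may discard declared variables; the zero map is still linear in them.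
  | topI (Γ : Ctx .pure) : Den Γ topI .top (fun _ => 0)
  | zeroE {Γ Γ₁ Γ₂ : Ctx .mixed} {m : Tm .mixed} {d} (A : Ty .mixed) (hs : Γ.Split Γ₁ Γ₂)
      (hm : Den Γ₁ m .zero d) : Den Γ (elimZero m) A (fun _ => 0)
  | oneI {f : Frag} {Γ : Ctx f} (h : Γ.IsEmpty) : Den Γ star .one (fun _ => vunit)
  | oneE {f : Frag} {Γ Γ₁ Γ₂ : Ctx f} {M N : Tm f} {S : Ty f} {d e} (hs : Γ.Split Γ₁ Γ₂)
      (hM : Den Γ₁ M .one d) (hN : Den Γ₂ N S e) :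
      Den Γ (elimOne M N) S (fun ρ => d ρ .unit • e ρ)
  | lolliI {f : Frag} {Γ : Ctx f} {M : Tm f} {S T : Ty f} {d}
      (hM : Den (some S :: Γ) M T d) :
      Den Γ (lam M) (.lolli S T) (fun ρ => vlam S fun v => d (econs v ρ))
  | lolliE {f : Frag} {Γ Γ₁ Γ₂ : Ctx f} {M N : Tm f} {S T : Ty f} {d e} (hs : Γ.Split Γ₁ Γ₂)
      (hM : Den Γ₁ M (.lolli S T) d) (hN : Den Γ₂ N S e) :
      Den Γ (app M N) T (fun ρ => vapp S (d ρ) (e ρ))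
  | conjI {Γ : Ctx .pure} {m n : Tm .pure} {P Q : Ty .pure} {d e}
      (hm : Den Γ m P d) (hn : Den Γ n Q e) :
      Den Γ (pair m n) (.conj P Q) (fun ρ => vpair (d ρ) (e ρ))
  | conjE₁ {Γ Γ₁ Γ₂ : Ctx .pure} {m n : Tm .pure} {P Q R : Ty .pure} {d e} (hs : Γ.Split Γ₁ Γ₂)
      (hm : Den Γ₁ m (.conj P Q) d) (hn : Den (some P :: Γ₂) n R e) :
      Den Γ (elimFst m n) R (fun ρ => e (econs (vfst (d ρ)) ρ))
  | conjE₂ {Γ Γ₁ Γ₂ : Ctx .pure} {m n : Tm .pure} {P Q R : Ty .pure} {d e} (hs : Γ.Split Γ₁ Γ₂)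
      (hm : Den Γ₁ m (.conj P Q) d) (hn : Den (some Q :: Γ₂) n R e) :
      Den Γ (elimSnd m n) R (fun ρ => e (econs (vsnd (d ρ)) ρ))
  | plusI₁ {Γ : Ctx .mixed} {m : Tm .mixed} {A : Ty .mixed} {d} (B : Ty .mixed)
      (hm : Den Γ m A d) : Den Γ (inl m) (.plus A B) (fun ρ => vpair (d ρ) 0)
  | plusI₂ {Γ : Ctx .mixed} {m : Tm .mixed} (A : Ty .mixed) {B : Ty .mixed} {d}
      (hm : Den Γ m B d) : Den Γ (inr m) (.plus A B) (fun ρ => vpair 0 (d ρ))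
  | plusE {Γ Γ₁ Γ₂ : Ctx .mixed} {m n o : Tm .mixed} {A B C : Ty .mixed} {d e e'}
      (hs : Γ.Split Γ₁ Γ₂) (hm : Den Γ₁ m (.plus A B) d) (hn : Den (some A :: Γ₂) n C e)
      (ho : Den (some B :: Γ₂) o C e') :
      Den Γ (elimPlus m n o) C
        (fun ρ => e (econs (vfst (d ρ)) ρ) + e' (econs (vsnd (d ρ)) ρ))
  | tensorI {f : Frag} {Γ Γ₁ Γ₂ : Ctx f} {M N : Tm f} {S T : Ty f} {d e} (hs : Γ.Split Γ₁ Γ₂)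
      (hM : Den Γ₁ M S d) (hN : Den Γ₂ N T e) :
      Den Γ (tens M N) (.tensor S T) (fun ρ => vtens (d ρ) (e ρ))
  | tensorE {f : Frag} {Γ Γ₁ Γ₂ : Ctx f} {M N : Tm f} {S₁ S₂ T : Ty f} {d e}
      (hs : Γ.Split Γ₁ Γ₂)
      (hM : Den Γ₁ M (.tensor S₁ S₂) d) (hN : Den (some S₂ :: some S₁ :: Γ₂) N T e) :
      Den Γ (elimTens M N) T
        (fun ρ => velim S₁ S₂ (d ρ) fun v w => e (econs w (econs v ρ)))
  -- The value is quadratic in the denotation of `m`, which does no harm to multilinearity since `m`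
  -- is closed.
  | bangI {Γ : Ctx .mixed} {m : Tm .pure} {P : Ty .pure} {d} (h : Γ.IsEmpty)
      (hm : Den [] m P d) : Den Γ (bang m) (.bang P) (fun _ => vtens (d 0) (vconj (d 0)))
  | bangE {Γ Γ₁ Γ₂ : Ctx .mixed} {m n : Tm .mixed} {P Q : Ty .pure} {d e} (hs : Γ.Split Γ₁ Γ₂)
      (hm : Den Γ₁ m (.bang (.lolli P Q)) d) (hn : Den Γ₂ n (.bang P) e) :
      Den Γ (app m n) (.bang Q) (fun ρ => vapp₂ P (d ρ) (e ρ))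
  | tau {Γ : Ctx .mixed} {m : Tm .mixed} {P Q : Ty .pure} {d}
      (hm : Den Γ m (.tensor (.bang P) (.bang Q)) d) :
      Den Γ (tau m) (.bang (.tensor P Q)) (fun ρ => vtau (d ρ))

theorem HasType.exists_den {f : Frag} {Γ : Ctx f} {M : Tm f} {T : Ty f} (h : HasType Γ M T) :
    ∃ d, Den Γ M T d := by
  induction h with
  | ax h => exact ⟨_, .ax h⟩
  | sum _ _ ih ih' => obtain ⟨⟨_, h⟩, ⟨_, h'⟩⟩ := And.intro ih ih'; exact ⟨_, .sum h h'⟩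
  | prod a _ ih => obtain ⟨_, h⟩ := ih; exact ⟨_, .prod a h⟩
  | topI Γ => exact ⟨_, .topI Γ⟩
  | zeroE A hs _ ih => obtain ⟨_, h⟩ := ih; exact ⟨_, .zeroE A hs h⟩
  | oneI h => exact ⟨_, .oneI h⟩
  | oneE hs _ _ ih ih' =>
    obtain ⟨⟨_, h⟩, ⟨_, h'⟩⟩ := And.intro ih ih'; exact ⟨_, .oneE hs h h'⟩
  | lolliI _ ih => obtain ⟨_, h⟩ := ih; exact ⟨_, .lolliI h⟩
  | lolliE hs _ _ ih ih' =>
    obtain ⟨⟨_, h⟩, ⟨_, h'⟩⟩ := And.intro ih ih'; exact ⟨_, .lolliE hs h h'⟩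
  | conjI _ _ ih ih' => obtain ⟨⟨_, h⟩, ⟨_, h'⟩⟩ := And.intro ih ih'; exact ⟨_, .conjI h h'⟩
  | conjE₁ hs _ _ ih ih' =>
    obtain ⟨⟨_, h⟩, ⟨_, h'⟩⟩ := And.intro ih ih'; exact ⟨_, .conjE₁ hs h h'⟩
  | conjE₂ hs _ _ ih ih' =>
    obtain ⟨⟨_, h⟩, ⟨_, h'⟩⟩ := And.intro ih ih'; exact ⟨_, .conjE₂ hs h h'⟩
  | plusI₁ B _ ih => obtain ⟨_, h⟩ := ih; exact ⟨_, .plusI₁ B h⟩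
  | plusI₂ A _ ih => obtain ⟨_, h⟩ := ih; exact ⟨_, .plusI₂ A h⟩
  | plusE hs _ _ _ ih ih' ih'' =>
    obtain ⟨⟨_, h⟩, ⟨_, h'⟩, ⟨_, h''⟩⟩ := And.intro ih (And.intro ih' ih'')
    exact ⟨_, .plusE hs h h' h''⟩
  | tensorI hs _ _ ih ih' =>
    obtain ⟨⟨_, h⟩, ⟨_, h'⟩⟩ := And.intro ih ih'; exact ⟨_, .tensorI hs h h'⟩
  | tensorE hs _ _ ih ih' =>
    obtain ⟨⟨_, h⟩, ⟨_, h'⟩⟩ := And.intro ih ih'; exact ⟨_, .tensorE hs h h'⟩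
  | bangI h _ ih => obtain ⟨_, h'⟩ := ih; exact ⟨_, .bangI h h'⟩
  | bangE hs _ _ ih ih' =>
    obtain ⟨⟨_, h⟩, ⟨_, h'⟩⟩ := And.intro ih ih'; exact ⟨_, .bangE hs h h'⟩
  | tau _ ih => obtain ⟨_, h⟩ := ih; exact ⟨_, .tau h⟩

theorem Den.hasType {f : Frag} {Γ : Ctx f} {M : Tm f} {T : Ty f} {d} (h : Den Γ M T d) :
    HasType Γ M T := by
  induction h with
  | ax h => exact .ax h
  | sum _ _ ih ih' => exact .sum ih ih'
  | prod a _ ih => exact .prod a ih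
  | topI Γ => exact .topI Γ
  | zeroE A hs _ ih => exact .zeroE A hs ih
  | oneI h => exact .oneI h
  | oneE hs _ _ ih ih' => exact .oneE hs ih ih'
  | lolliI _ ih => exact .lolliI ih
  | lolliE hs _ _ ih ih' => exact .lolliE hs ih ih'
  | conjI _ _ ih ih' => exact .conjI ih ih'
  | conjE₁ hs _ _ ih ih' => exact .conjE₁ hs ih ih'
  | conjE₂ hs _ _ ih ih' => exact .conjE₂ hs ih ih'
  | plusI₁ B _ ih => exact .plusI₁ B ih
  | plusI₂ A _ ih => exact .plusI₂ A ih
  | plusE hs _ _ _ ih ih' ih'' => exact .plusE hs ih ih' ih''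
  | tensorI hs _ _ ih ih' => exact .tensorI hs ih ih'
  | tensorE hs _ _ ih ih' => exact .tensorE hs ih ih'
  | bangI h _ ih => exact .bangI h ih
  | bangE hs _ _ ih ih' => exact .bangE hs ih ih'
  | tau _ ih => exact .tau ih

/-! ### Bilinearity -/

section Bilinear
variable {f : Frag} (S T : Ty f) (a b : ℂ) (v v' w w' : Vec)

theorem vtens_lin_left : vtens (a • v + b • v') w = a • vtens v w + b • vtens v' w := by
  funext i; cases i <;> simp [vtens]; ring
theorem vtens_lin_right : vtens w (a • v + b • v') = a • vtens w v + b • vtens w v' := by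
  funext i; cases i <;> simp [vtens]; ring
theorem vpair_lin :
    vpair (a • v + b • v') (a • w + b • w') = a • vpair v w + b • vpair v' w' := by
  funext i; cases i <;> simp [vpair]
theorem vfst_lin : vfst (a • v + b • v') = a • vfst v + b • vfst v' := rfl
theorem vsnd_lin : vsnd (a • v + b • v') = a • vsnd v + b • vsnd v' := rfl
theorem vtau_lin : vtau (a • v + b • v') = a • vtau v + b • vtau v' := by
  funext i; unfold vtau; simp only [Pi.add_apply, Pi.smul_apply]; split <;> simp
theorem vapp_lin_left : vapp S (a • v + b • v') w = a • vapp S v w + b • vapp S v' w := by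
  funext j
  simp only [vapp, Pi.add_apply, Pi.smul_apply, smul_eq_mul, Finset.mul_sum,
    ← Finset.sum_add_distrib]
  exact Finset.sum_congr rfl fun i _ => by ring
theorem vapp_lin_right : vapp S w (a • v + b • v') = a • vapp S w v + b • vapp S w v' := by
  funext j
  simp only [vapp, Pi.add_apply, Pi.smul_apply, smul_eq_mul, Finset.mul_sum,
    ← Finset.sum_add_distrib]
  exact Finset.sum_congr rfl fun i _ => by ring
theorem vapp₂_lin_left : vapp₂ S (a • v + b • v') w = a • vapp₂ S v w + b • vapp₂ S v' w := by
  funext j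
  cases j <;> simp only [vapp₂, Pi.add_apply, Pi.smul_apply, smul_eq_mul, Finset.mul_sum,
    ← Finset.sum_add_distrib]
  · simp
  · exact Finset.sum_congr rfl fun i _ => by ring
  · simp
  · simp
theorem vapp₂_lin_right : vapp₂ S w (a • v + b • v') = a • vapp₂ S w v + b • vapp₂ S w v' := by
  funext j
  cases j <;> simp only [vapp₂, Pi.add_apply, Pi.smul_apply, smul_eq_mul, Finset.mul_sum,
    ← Finset.sum_add_distrib]
  · simp
  · exact Finset.sum_congr rfl fun i _ => by ring
  · simp
  · simp
theorem velim_lin_left (g : Vec → Vec → Vec) :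
    velim S T (a • v + b • v') g = a • velim S T v g + b • velim S T v' g := by
  simp only [velim, Pi.add_apply, Pi.smul_apply, smul_eq_mul, Finset.smul_sum,
    ← Finset.sum_add_distrib]
  exact Finset.sum_congr rfl fun i _ => by rw [add_smul, mul_smul, mul_smul]
theorem velim_lin_right {g g' h : Vec → Vec → Vec}
    (H : ∀ i j, h (bas i) (bas j) = a • g (bas i) (bas j) + b • g' (bas i) (bas j)) :
    velim S T w h = a • velim S T w g + b • velim S T w g' := by
  simp only [velim, Finset.smul_sum, ← Finset.sum_add_distrib]
  exact Finset.sum_congr rfl fun i _ => by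
    rw [H, smul_add, smul_comm, smul_comm _ b]
theorem vlam_lin {g g' h : Vec → Vec}
    (H : ∀ i, h (bas i) = a • g (bas i) + b • g' (bas i)) :
    vlam S h = a • vlam S g + b • vlam S g' := by
  funext i; cases i <;> simp [vlam, H]; split <;> simp

end Bilinear

/-- The environments agree on the declared variables. -/
def Agree {f : Frag} (Γ : Ctx f) (ρ ρ' : ℕ → Vec) : Prop := ∀ i S, Γ.Has i S → ρ i = ρ' i

theorem Agree.econs {f : Frag} {Γ : Ctx f} {ρ ρ' : ℕ → Vec} (h : Agree Γ ρ ρ') (v : Vec)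
    (o : Option (Ty f)) : Agree (o :: Γ) (econs v ρ) (econs v ρ') := by
  intro i S hi
  cases i with
  | zero => rfl
  | succ i => exact h i S (Ctx.has_succ.1 hi)

theorem Agree.left {f : Frag} {Γ Γ₁ Γ₂ : Ctx f} {ρ ρ' : ℕ → Vec} (h : Agree Γ ρ ρ')
    (hs : Γ.Split Γ₁ Γ₂) : Agree Γ₁ ρ ρ' := fun i S hi => h i S (hs.has_iff.2 (.inl hi))

theorem Agree.right {f : Frag} {Γ Γ₁ Γ₂ : Ctx f} {ρ ρ' : ℕ → Vec} (h : Agree Γ ρ ρ')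
    (hs : Γ.Split Γ₁ Γ₂) : Agree Γ₂ ρ ρ' := fun i S hi => h i S (hs.has_iff.2 (.inr hi))

/-- Its use is to freeze the premise of a multiplicative rule that does not contain the variable
under consideration. -/
theorem Den.agree {f : Frag} {Γ : Ctx f} {M : Tm f} {T : Ty f} {d} (h : Den Γ M T d) :
    ∀ {ρ ρ' : ℕ → Vec}, Agree Γ ρ ρ' → d ρ = d ρ' := by
  induction h with
  | ax h => exact fun H => H _ _ h.has
  | sum _ _ ih ih' => intro ρ ρ' H; simp only [ih H, ih' H]
  | prod a _ ih => intro ρ ρ' H; simp only [ih H]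
  | topI Γ => intros; rfl
  | zeroE A hs _ ih => intros; rfl
  | oneI h => intros; rfl
  | oneE hs _ _ ih ih' => intro ρ ρ' H; simp only [ih (H.left hs), ih' (H.right hs)]
  | lolliI _ ih => intro ρ ρ' H; simp only [ih (H.econs _ _)]
  | lolliE hs _ _ ih ih' => intro ρ ρ' H; simp only [ih (H.left hs), ih' (H.right hs)]
  | conjI _ _ ih ih' => intro ρ ρ' H; simp only [ih H, ih' H]
  | conjE₁ hs _ _ ih ih' =>
    intro ρ ρ' H; simp only [ih (H.left hs), ih' ((H.right hs).econs _ _)]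
  | conjE₂ hs _ _ ih ih' =>
    intro ρ ρ' H; simp only [ih (H.left hs), ih' ((H.right hs).econs _ _)]
  | plusI₁ B _ ih => intro ρ ρ' H; simp only [ih H]
  | plusI₂ A _ ih => intro ρ ρ' H; simp only [ih H]
  | plusE hs _ _ _ ih ih' ih'' =>
    intro ρ ρ' H
    simp only [ih (H.left hs), ih' ((H.right hs).econs _ _), ih'' ((H.right hs).econs _ _)]
  | tensorI hs _ _ ih ih' => intro ρ ρ' H; simp only [ih (H.left hs), ih' (H.right hs)]
  | tensorE hs _ _ ih ih' =>
    intro ρ ρ' H; simp only [ih (H.left hs), ih' (((H.right hs).econs _ _).econs _ _)]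
  | bangI h _ ih => intros; rfl
  | bangE hs _ _ ih ih' => intro ρ ρ' H; simp only [ih (H.left hs), ih' (H.right hs)]
  | tau _ ih => intro ρ ρ' H; simp only [ih H]

theorem Den.eq_const {f : Frag} {M : Tm f} {T : Ty f} {d} (h : Den [] M T d) (ρ : ℕ → Vec) :
    d ρ = d 0 := h.agree fun i S hi => by simp at hi

/-- The three environments differ in variable `k` only, and the third one is there the
combination of the other two. -/
def Mix {f : Frag} (Γ : Ctx f) (k : ℕ) (a b : ℂ) (ρ₁ ρ₂ ρ : ℕ → Vec) : Prop :=
  (∀ i S, Γ.Has i S → i ≠ k → ρ i = ρ₁ i ∧ ρ i = ρ₂ i) ∧ ρ k = a • ρ₁ k + b • ρ₂ k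

theorem Mix.econs {f : Frag} {Γ : Ctx f} {k : ℕ} {a b : ℂ} {ρ₁ ρ₂ ρ : ℕ → Vec}
    (h : Mix Γ k a b ρ₁ ρ₂ ρ) (v : Vec) (o : Option (Ty f)) :
    Mix (o :: Γ) (k + 1) a b (econs v ρ₁) (econs v ρ₂) (econs v ρ) := by
  refine ⟨fun i S hi hk => ?_, h.2⟩
  cases i with
  | zero => exact ⟨rfl, rfl⟩
  | succ i => exact h.1 i S (Ctx.has_succ.1 hi) (by omega)

theorem Mix.head {f : Frag} (Γ : Ctx f) (a b : ℂ) (v w : Vec) (ρ : ℕ → Vec) :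
    Mix Γ 0 a b (BIMALL.econs v ρ) (BIMALL.econs w ρ) (BIMALL.econs (a • v + b • w) ρ) := by
  refine ⟨fun i S hi hk => ?_, rfl⟩
  cases i with
  | zero => exact absurd rfl hk
  | succ i => exact ⟨rfl, rfl⟩

theorem Mix.left {f : Frag} {Γ Γ₁ Γ₂ : Ctx f} {k : ℕ} {a b : ℂ} {ρ₁ ρ₂ ρ : ℕ → Vec}
    (h : Mix Γ k a b ρ₁ ρ₂ ρ) (hs : Γ.Split Γ₁ Γ₂) : Mix Γ₁ k a b ρ₁ ρ₂ ρ :=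
  ⟨fun i S hi => h.1 i S (hs.has_iff.2 (.inl hi)), h.2⟩

theorem Mix.right {f : Frag} {Γ Γ₁ Γ₂ : Ctx f} {k : ℕ} {a b : ℂ} {ρ₁ ρ₂ ρ : ℕ → Vec}
    (h : Mix Γ k a b ρ₁ ρ₂ ρ) (hs : Γ.Split Γ₁ Γ₂) : Mix Γ₂ k a b ρ₁ ρ₂ ρ :=
  ⟨fun i S hi => h.1 i S (hs.has_iff.2 (.inr hi)), h.2⟩

theorem Mix.agree {f : Frag} {Γ : Ctx f} {k : ℕ} {a b : ℂ} {ρ₁ ρ₂ ρ : ℕ → Vec}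
    (h : Mix Γ k a b ρ₁ ρ₂ ρ) (hk : ∀ S, ¬ Γ.Has k S) : Agree Γ ρ ρ₁ ∧ Agree Γ ρ ρ₂ := by
  have : ∀ i S, Γ.Has i S → i ≠ k := fun i S hi e => hk S (e ▸ hi)
  exact ⟨fun i S hi => (h.1 i S hi (this i S hi)).1, fun i S hi => (h.1 i S hi (this i S hi)).2⟩

theorem Ctx.Split.not_right {f : Frag} {Γ Γ₁ Γ₂ : Ctx f} (hs : Γ.Split Γ₁ Γ₂) {k : ℕ} {S : Ty f}
    (h : Γ₁.Has k S) : ∀ S', ¬ Γ₂.Has k S' := fun _ h' => hs.disjoint h h'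

theorem Ctx.Split.not_left {f : Frag} {Γ Γ₁ Γ₂ : Ctx f} (hs : Γ.Split Γ₁ Γ₂) {k : ℕ} {S : Ty f}
    (h : Γ₂.Has k S) : ∀ S', ¬ Γ₁.Has k S' := fun _ h' => hs.disjoint h' h

/-- Denotations are linear in each declared variable. -/
theorem Den.linear {f : Frag} {Γ : Ctx f} {M : Tm f} {T : Ty f} {d} (h : Den Γ M T d) :
    ∀ {k : ℕ} {S : Ty f} {a b : ℂ} {ρ₁ ρ₂ ρ : ℕ → Vec}, Γ.Has k S → Mix Γ k a b ρ₁ ρ₂ ρ →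
      d ρ = a • d ρ₁ + b • d ρ₂ := by
  induction h with
  | ax h =>
    intro k S a b ρ₁ ρ₂ ρ hk H
    rw [← h.eq_of_has hk]; exact H.2
  | sum _ _ ih ih' =>
    intro k S a b ρ₁ ρ₂ ρ hk H
    simp only [ih hk H, ih' hk H]; module
  | prod a _ ih =>
    intro k S a b ρ₁ ρ₂ ρ hk H
    simp only [ih hk H]; module
  | topI Γ => intros; simp
  | zeroE A hs _ ih => intros; simp
  | oneI h => intro k S a b ρ₁ ρ₂ ρ hk H; exact absurd hk h.not_has
  | oneE hs hM hN ih ih' =>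
    intro k S a b ρ₁ ρ₂ ρ hk H
    -- In every multiplicative rule the variable `k` occurs in exactly one premise; the other
    -- premise takes the same value in the three environments.
    rcases hs.has_iff.1 hk with h1 | h1
    · obtain ⟨A1, A2⟩ := (H.right hs).agree (hs.not_right h1)
      simp only [ih h1 (H.left hs), ← hN.agree A1, ← hN.agree A2, Pi.add_apply, Pi.smul_apply,
        smul_eq_mul]
      module
    · obtain ⟨A1, A2⟩ := (H.left hs).agree (hs.not_left h1)
      simp only [ih' h1 (H.right hs), ← hM.agree A1, ← hM.agree A2]
      module
  | lolliI _ ih =>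
    intro k S a b ρ₁ ρ₂ ρ hk H
    exact vlam_lin _ _ _ fun i => ih (Ctx.has_succ.2 hk) (H.econs _ _)
  | lolliE hs hM hN ih ih' =>
    intro k S a b ρ₁ ρ₂ ρ hk H
    rcases hs.has_iff.1 hk with h1 | h1
    · obtain ⟨A1, A2⟩ := (H.right hs).agree (hs.not_right h1)
      simp only [ih h1 (H.left hs), ← hN.agree A1, ← hN.agree A2, vapp_lin_left]
    · obtain ⟨A1, A2⟩ := (H.left hs).agree (hs.not_left h1)
      simp only [ih' h1 (H.right hs), ← hM.agree A1, ← hM.agree A2, vapp_lin_right]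
  | conjI _ _ ih ih' =>
    intro k S a b ρ₁ ρ₂ ρ hk H
    simp only [ih hk H, ih' hk H, vpair_lin]
  | conjE₁ hs hM hN ih ih' =>
    intro k S a b ρ₁ ρ₂ ρ hk H
    rcases hs.has_iff.1 hk with h1 | h1
    · obtain ⟨A1, A2⟩ := (H.right hs).agree (hs.not_right h1)
      beta_reduce
      rw [ih h1 (H.left hs), ← hN.agree (A1.econs _ _), ← hN.agree (A2.econs _ _)]
      -- The variable `k` lies in the scrutinee, so the combination reaches the body through its
      -- bound variable, index `0`.
      exact ih' (Ctx.has_zero.2 rfl) (Mix.head _ a b (vfst _) (vfst _) ρ)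
    · obtain ⟨A1, A2⟩ := (H.left hs).agree (hs.not_left h1)
      simp only [← hM.agree A1, ← hM.agree A2]
      exact ih' (Ctx.has_succ.2 h1) ((H.right hs).econs _ _)
  | conjE₂ hs hM hN ih ih' =>
    intro k S a b ρ₁ ρ₂ ρ hk H
    rcases hs.has_iff.1 hk with h1 | h1
    · obtain ⟨A1, A2⟩ := (H.right hs).agree (hs.not_right h1)
      beta_reduce
      rw [ih h1 (H.left hs), ← hN.agree (A1.econs _ _), ← hN.agree (A2.econs _ _)]
      exact ih' (Ctx.has_zero.2 rfl) (Mix.head _ a b (vsnd _) (vsnd _) ρ)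
    · obtain ⟨A1, A2⟩ := (H.left hs).agree (hs.not_left h1)
      simp only [← hM.agree A1, ← hM.agree A2]
      exact ih' (Ctx.has_succ.2 h1) ((H.right hs).econs _ _)
  | plusI₁ B _ ih =>
    intro k S a b ρ₁ ρ₂ ρ hk H
    simp only [ih hk H]; rw [← vpair_lin]; simp
  | plusI₂ A _ ih =>
    intro k S a b ρ₁ ρ₂ ρ hk H
    simp only [ih hk H]; rw [← vpair_lin]; simp
  | plusE hs hM hN hO ih ih' ih'' =>
    intro k S a b ρ₁ ρ₂ ρ hk H
    rcases hs.has_iff.1 hk with h1 | h1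
    · obtain ⟨A1, A2⟩ := (H.right hs).agree (hs.not_right h1)
      beta_reduce
      rw [ih h1 (H.left hs), ← hN.agree (A1.econs _ _), ← hN.agree (A2.econs _ _),
        ← hO.agree (A1.econs _ _), ← hO.agree (A2.econs _ _),
        vfst_lin, vsnd_lin, ih' (Ctx.has_zero.2 rfl) (Mix.head _ a b _ _ ρ),
        ih'' (Ctx.has_zero.2 rfl) (Mix.head _ a b _ _ ρ)]
      module
    · obtain ⟨A1, A2⟩ := (H.left hs).agree (hs.not_left h1)
      simp only [← hM.agree A1, ← hM.agree A2]
      rw [ih' (Ctx.has_succ.2 h1) ((H.right hs).econs _ _),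
        ih'' (Ctx.has_succ.2 h1) ((H.right hs).econs _ _)]
      module
  | tensorI hs hM hN ih ih' =>
    intro k S a b ρ₁ ρ₂ ρ hk H
    rcases hs.has_iff.1 hk with h1 | h1
    · obtain ⟨A1, A2⟩ := (H.right hs).agree (hs.not_right h1)
      simp only [ih h1 (H.left hs), ← hN.agree A1, ← hN.agree A2, vtens_lin_left]
    · obtain ⟨A1, A2⟩ := (H.left hs).agree (hs.not_left h1)
      simp only [ih' h1 (H.right hs), ← hM.agree A1, ← hM.agree A2, vtens_lin_right]
  | tensorE hs hM hN ih ih' =>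
    intro k S a b ρ₁ ρ₂ ρ hk H
    rcases hs.has_iff.1 hk with h1 | h1
    · obtain ⟨A1, A2⟩ := (H.right hs).agree (hs.not_right h1)
      simp only [ih h1 (H.left hs), ← hN.agree ((A1.econs _ _).econs _ _),
        ← hN.agree ((A2.econs _ _).econs _ _), velim_lin_left]
    · obtain ⟨A1, A2⟩ := (H.left hs).agree (hs.not_left h1)
      simp only [← hM.agree A1, ← hM.agree A2]
      exact velim_lin_right _ _ _ _ _ fun i j =>
        ih' (Ctx.has_succ.2 (Ctx.has_succ.2 h1)) (((H.right hs).econs _ _).econs _ _)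
  | bangI h _ ih => intro k S a b ρ₁ ρ₂ ρ hk H; exact absurd hk h.not_has
  | bangE hs hM hN ih ih' =>
    intro k S a b ρ₁ ρ₂ ρ hk H
    rcases hs.has_iff.1 hk with h1 | h1
    · obtain ⟨A1, A2⟩ := (H.right hs).agree (hs.not_right h1)
      simp only [ih h1 (H.left hs), ← hN.agree A1, ← hN.agree A2, vapp₂_lin_left]
    · obtain ⟨A1, A2⟩ := (H.left hs).agree (hs.not_left h1)
      simp only [ih' h1 (H.right hs), ← hM.agree A1, ← hM.agree A2, vapp₂_lin_right]
  | tau _ ih =>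
    intro k S a b ρ₁ ρ₂ ρ hk H
    simp only [ih hk H, vtau_lin]

/-! ### Supports -/

theorem mem_idx_lolli {f : Frag} {S T : Ty f} {i j : Ix} :
    .pr i j ∈ idx (.lolli S T) ↔ i ∈ idx S ∧ j ∈ idx T := by simp [idx]

theorem mem_idx_tensor {f : Frag} {S T : Ty f} {i j : Ix} :
    .pr i j ∈ idx (.tensor S T) ↔ i ∈ idx S ∧ j ∈ idx T := by simp [idx]

theorem mem_idx_bang {P : Ty .pure} {i j : Ix} :
    .pr i j ∈ idx (.bang P) ↔ i ∈ idx P ∧ j ∈ idx P := by simp [idx]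

section Supp
variable {f : Frag} {S T : Ty f} {v w : Vec}

theorem Supp.zero : Supp T 0 := fun _ _ => rfl

theorem Supp.lin (hv : Supp T v) (hw : Supp T w) (a b : ℂ) : Supp T (a • v + b • w) :=
  fun i hi => by simp [hv i hi, hw i hi]

theorem Supp.add (hv : Supp T v) (hw : Supp T w) : Supp T (v + w) :=
  fun i hi => by simp [hv i hi, hw i hi]

theorem Supp.smul (hv : Supp T v) (a : ℂ) : Supp T (a • v) := fun i hi => by simp [hv i hi]

theorem supp_bas {i : Ix} (h : i ∈ idx T) : Supp T (bas i) := fun j hj => by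
  have : j ≠ i := by rintro rfl; exact hj h
  simp [bas, this]

theorem Supp.eq_sum (hv : Supp T v) : v = ∑ i ∈ idx T, v i • bas i := by
  funext j
  simp only [Finset.sum_apply, Pi.smul_apply, smul_eq_mul, bas, Pi.single_apply, mul_ite, mul_one,
    mul_zero, Finset.sum_ite_eq]
  split
  · rfl
  · exact hv j ‹_›

theorem Supp.vtens (hv : Supp S v) (hw : Supp T w) : Supp (.tensor S T) (vtens v w) := by
  intro i hi
  cases i with
  | pr i j =>
    rw [mem_idx_tensor, not_and_or] at hi
    rcases hi with h | h
    · simp [BIMALL.vtens, hv i h]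
    · simp [BIMALL.vtens, hw j h]
  | _ => rfl

theorem Supp.vconj (hv : Supp S v) : Supp S (vconj v) := fun i hi => by
  simp [BIMALL.vconj, hv i hi]

theorem Supp.vbang {P : Ty .pure} (hv : Supp P v) (hw : Supp P w) :
    Supp (.bang P) (BIMALL.vtens v w) := by
  intro i hi
  cases i with
  | pr i j =>
    rw [mem_idx_bang, not_and_or] at hi
    rcases hi with h | h
    · simp [BIMALL.vtens, hv i h]
    · simp [BIMALL.vtens, hw j h]
  | _ => rfl

theorem Supp.vlam {g : Vec → Vec} (hg : ∀ i ∈ idx S, Supp T (g (bas i))) :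
    Supp (.lolli S T) (vlam S g) := by
  intro i hi
  cases i with
  | pr i j =>
    rw [mem_idx_lolli, not_and_or] at hi
    by_cases h : i ∈ idx S
    · simp only [BIMALL.vlam, h, if_true]
      exact hg i h j (hi.resolve_left (not_not.2 h))
    · simp [BIMALL.vlam, h]
  | _ => rfl

theorem Supp.vapp (hv : Supp (.lolli S T) v) (w : Vec) : Supp T (vapp S v w) := by
  intro j hj
  refine Finset.sum_eq_zero fun i _ => ?_
  rw [hv _ fun h => hj (mem_idx_lolli.1 h).2, zero_mul]

theorem Supp.vapp₂ {P Q : Ty .pure} (hv : Supp (.bang (.lolli P Q)) v) (w : Vec) :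
    Supp (.bang Q) (vapp₂ P v w) := by
  intro j hj
  cases j with
  | pr j j' =>
    refine Finset.sum_eq_zero fun i _ => ?_
    rw [hv _ fun h => hj (mem_idx_bang.2 ?_), zero_mul]
    exact ⟨(mem_idx_lolli.1 (mem_idx_bang.1 h).1).2, (mem_idx_lolli.1 (mem_idx_bang.1 h).2).2⟩
  | _ => rfl

theorem Supp.velim {S' : Ty f} {g : Vec → Vec → Vec}
    (hg : ∀ i ∈ idx S, ∀ j ∈ idx S', Supp T (g (bas i) (bas j))) :
    Supp T (velim S S' v g) := by
  intro k hk
  simp only [BIMALL.velim, Finset.sum_apply]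
  refine Finset.sum_eq_zero fun p hp => ?_
  rw [Finset.mem_product] at hp
  simp [hg _ hp.1 _ hp.2 k hk]

theorem Supp.vtau {P Q : Ty .pure} (hv : Supp (.tensor (.bang P) (.bang Q)) v) :
    Supp (.bang (.tensor P Q)) (vtau v) := by
  intro i hi
  unfold BIMALL.vtau
  split
  · refine hv _ fun h => hi ?_
    simp only [mem_idx_tensor, mem_idx_bang] at h ⊢
    tauto
  · rfl

theorem supp_vpair_conj {P Q : Ty .pure} (hv : Supp P v) (hw : Supp Q w) :
    Supp (.conj P Q) (vpair v w) := by
  intro i hi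
  cases i with
  | inl i => exact hv i fun h => hi (by simp [idx, h])
  | inr i => exact hw i fun h => hi (by simp [idx, h])
  | _ => rfl

theorem supp_vpair_plus {A B : Ty .mixed} (hv : Supp A v) (hw : Supp B w) :
    Supp (.plus A B) (vpair v w) := by
  intro i hi
  cases i with
  | inl i => exact hv i fun h => hi (by simp [idx, h])
  | inr i => exact hw i fun h => hi (by simp [idx, h])
  | _ => rfl

theorem Supp.vfst_conj {P Q : Ty .pure} (hv : Supp (.conj P Q) v) : Supp P (vfst v) :=
  fun i hi => hv _ fun h => hi (by simpa [idx] using h)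
theorem Supp.vsnd_conj {P Q : Ty .pure} (hv : Supp (.conj P Q) v) : Supp Q (vsnd v) :=
  fun i hi => hv _ fun h => hi (by simpa [idx] using h)
theorem Supp.vfst_plus {A B : Ty .mixed} (hv : Supp (.plus A B) v) : Supp A (vfst v) :=
  fun i hi => hv _ fun h => hi (by simpa [idx] using h)
theorem Supp.vsnd_plus {A B : Ty .mixed} (hv : Supp (.plus A B) v) : Supp B (vsnd v) :=
  fun i hi => hv _ fun h => hi (by simpa [idx] using h)

end Supp

/-- The environment assigns to the declared variables vectors of the right spaces. -/
def SuppEnv {f : Frag} (Γ : Ctx f) (ρ : ℕ → Vec) : Prop := ∀ i S, Γ.Has i S → Supp S (ρ i)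

theorem SuppEnv.econs {f : Frag} {Γ : Ctx f} {ρ : ℕ → Vec} (h : SuppEnv Γ ρ) {v : Vec} {S : Ty f}
    (hv : Supp S v) : SuppEnv (some S :: Γ) (econs v ρ) := by
  intro i S' hi
  cases i with
  | zero => obtain rfl := Option.some.inj (Ctx.has_zero.1 hi); exact hv
  | succ i => exact h i S' (Ctx.has_succ.1 hi)

theorem SuppEnv.left {f : Frag} {Γ Γ₁ Γ₂ : Ctx f} {ρ : ℕ → Vec} (h : SuppEnv Γ ρ)
    (hs : Γ.Split Γ₁ Γ₂) : SuppEnv Γ₁ ρ := fun i S hi => h i S (hs.has_iff.2 (.inl hi))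

theorem SuppEnv.right {f : Frag} {Γ Γ₁ Γ₂ : Ctx f} {ρ : ℕ → Vec} (h : SuppEnv Γ ρ)
    (hs : Γ.Split Γ₁ Γ₂) : SuppEnv Γ₂ ρ := fun i S hi => h i S (hs.has_iff.2 (.inr hi))

theorem suppEnv_nil {f : Frag} (ρ : ℕ → Vec) : SuppEnv ([] : Ctx f) ρ :=
  fun i S hi => by simp at hi

theorem Den.supp {f : Frag} {Γ : Ctx f} {M : Tm f} {T : Ty f} {d} (h : Den Γ M T d) :
    ∀ {ρ : ℕ → Vec}, SuppEnv Γ ρ → Supp T (d ρ) := by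
  induction h with
  | ax h => exact fun H => H _ _ h.has
  | sum _ _ ih ih' => exact fun H => (ih H).add (ih' H)
  | prod a _ ih => exact fun H => (ih H).smul _
  | topI Γ => exact fun _ => .zero
  | zeroE A hs _ ih => exact fun _ => .zero
  | oneI h => exact fun _ => supp_bas (by simp [idx])
  | oneE hs _ _ ih ih' => exact fun H => (ih' (H.right hs)).smul _
  | lolliI _ ih => exact fun H => .vlam fun i hi => ih (H.econs (supp_bas hi))
  | lolliE hs _ _ ih ih' => exact fun H => (ih (H.left hs)).vapp _
  | conjI _ _ ih ih' => exact fun H => supp_vpair_conj (ih H) (ih' H)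
  | conjE₁ hs _ _ ih ih' => exact fun H => ih' ((H.right hs).econs (ih (H.left hs)).vfst_conj)
  | conjE₂ hs _ _ ih ih' => exact fun H => ih' ((H.right hs).econs (ih (H.left hs)).vsnd_conj)
  | plusI₁ B _ ih => exact fun H => supp_vpair_plus (ih H) .zero
  | plusI₂ A _ ih => exact fun H => supp_vpair_plus .zero (ih H)
  | plusE hs _ _ _ ih ih' ih'' =>
    exact fun H => (ih' ((H.right hs).econs (ih (H.left hs)).vfst_plus)).add
      (ih'' ((H.right hs).econs (ih (H.left hs)).vsnd_plus))
  | tensorI hs _ _ ih ih' => exact fun H => (ih (H.left hs)).vtens (ih' (H.right hs))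
  | tensorE hs _ _ ih ih' =>
    exact fun H => .velim fun i hi j hj =>
      ih' (((H.right hs).econs (supp_bas hi)).econs (supp_bas hj))
  | bangI h _ ih => exact fun _ => (ih (suppEnv_nil _)).vbang (ih (suppEnv_nil _)).vconj
  | bangE hs _ _ ih ih' => exact fun H => (ih (H.left hs)).vapp₂ _
  | tau _ ih => exact fun H => (ih H).vtau

/-! ### Cuts -/

/-- The denotation of a body as a linear map of the vector for its bound variable. -/
noncomputable def Den.lin₀ {f : Frag} {Γ : Ctx f} {S : Ty f} {M : Tm f} {T : Ty f} {d}
    (h : Den (some S :: Γ) M T d) (ρ : ℕ → Vec) : Vec →ₗ[ℂ] Vec :=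
  IsLinearMap.mk' (fun v => d (econs v ρ))
    { map_add := fun v w => by
        simpa using h.linear (Ctx.has_zero.2 rfl) (Mix.head _ 1 1 v w ρ)
      map_smul := fun a v => by
        simpa using h.linear (Ctx.has_zero.2 rfl) (Mix.head _ a 0 v v ρ) }

/-- Linearity in the outer one of two bound variables. -/
noncomputable def Den.lin₁ {f : Frag} {Γ : Ctx f} {S : Ty f} {o : Option (Ty f)} {M : Tm f}
    {T : Ty f} {d} (h : Den (o :: some S :: Γ) M T d) (w : Vec) (ρ : ℕ → Vec) : Vec →ₗ[ℂ] Vec :=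
  IsLinearMap.mk' (fun v => d (econs w (econs v ρ)))
    { map_add := fun v v' => by
        simpa using h.linear (Ctx.has_succ.2 (Ctx.has_zero.2 rfl))
          ((Mix.head (some S :: Γ) 1 1 v v' ρ).econs w o)
      map_smul := fun a v => by
        simpa using h.linear (Ctx.has_succ.2 (Ctx.has_zero.2 rfl))
          ((Mix.head (some S :: Γ) a 0 v v ρ).econs w o) }

/-- The abstraction records the body at basis vectors only. Expanding `v` in the basis and using
linearity of the body in its bound variable gives the value at `v`; the support hypothesis makes the
expansion legitimate. -/
theorem Den.vapp_vlam {f : Frag} {Γ : Ctx f} {S : Ty f} {M : Tm f} {T : Ty f} {d}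
    (h : Den (some S :: Γ) M T d) (ρ : ℕ → Vec) {v : Vec} (hv : Supp S v) :
    vapp S (vlam S fun v => d (econs v ρ)) v = d (econs v ρ) := by
  have h1 : h.lin₀ ρ v = ∑ i ∈ idx S, v i • h.lin₀ ρ (bas i) := by
    conv_lhs => rw [hv.eq_sum]
    simp
  change _ = h.lin₀ ρ v
  rw [h1]
  funext j
  simp only [vapp, Finset.sum_apply, Pi.smul_apply, smul_eq_mul]
  refine Finset.sum_congr rfl fun i hi => ?_
  simp only [vlam, hi, if_true]
  rw [mul_comm]; rfl

/-- The analogue for a pair: the body is linear in each of the two bound variables, so both vectors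
can be expanded in their bases in turn. -/
theorem Den.velim_vtens {f : Frag} {Γ : Ctx f} {S₁ S₂ : Ty f} {M : Tm f} {T : Ty f} {d}
    (h : Den (some S₂ :: some S₁ :: Γ) M T d) (ρ : ℕ → Vec) {v w : Vec} (hv : Supp S₁ v)
    (hw : Supp S₂ w) :
    velim S₁ S₂ (vtens v w) (fun v w => d (econs w (econs v ρ))) = d (econs w (econs v ρ)) := by
  have h1 : h.lin₁ w ρ v = ∑ i ∈ idx S₁, v i • h.lin₁ w ρ (bas i) := by
    conv_lhs => rw [hv.eq_sum]
    simp
  have h2 : ∀ u, h.lin₀ (econs u ρ) w = ∑ j ∈ idx S₂, w j • h.lin₀ (econs u ρ) (bas j) := by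
    intro u
    conv_lhs => rw [hw.eq_sum]
    simp
  change _ = h.lin₁ w ρ v
  rw [h1, velim, Finset.sum_product]
  refine Finset.sum_congr rfl fun i _ => ?_
  change _ = v i • h.lin₀ (econs (bas i) ρ) w
  rw [h2, Finset.smul_sum]
  refine Finset.sum_congr rfl fun j _ => ?_
  rw [smul_smul]; rfl

/-- On pure tensors the double sum factors into one application and the conjugate of another. By
bilinearity this determines `vapp₂` on the spans that occur in `Rel`. -/
theorem vapp₂_vtens {P : Ty .pure} (a b v w : Vec) :
    vapp₂ P (vtens a (vconj b)) (vtens v (vconj w)) =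
      vtens (vapp P a v) (vconj (vapp P b w)) := by
  funext j
  cases j with
  | pr j j' =>
    simp only [vapp₂, vtens, vconj, vapp, map_sum, map_mul, Finset.sum_mul_sum,
      Finset.sum_product]
    exact Finset.sum_congr rfl fun i _ => Finset.sum_congr rfl fun i' _ => by ring
  | _ => rfl

theorem vtau_vtens (a b v w : Vec) :
    vtau (vtens (vtens a (vconj b)) (vtens v (vconj w))) = vtens (vtens a v) (vconj (vtens b w)) := by
  funext j
  rcases j with _ | ⟨_ | _ | _ | _, _ | _ | _ | _⟩ | _ | _ <;>
    simp only [vtau, vtens, vconj, map_mul, map_zero, zero_mul, mul_zero]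
  ring

/-! ### Coherence -/

/-- The relation between the denotations of two derivations for the same term. -/
def Rel : {f : Frag} → Ty f → Ty f → Vec → Vec → Prop
  | _, .one, .one, v, v' => v = v' ∧ Supp (.one : Ty .pure) v
  -- Related arguments go to related results. The support conditions are kept because the action on
  -- arguments says nothing about coordinates outside the space.
  | _, .lolli S T, .lolli S' T', v, v' =>
    Supp (.lolli S T) v ∧ Supp (.lolli S' T') v' ∧
      ∀ a a', Rel S S' a a' → Rel T T' (vapp S v a) (vapp S' v' a')
  -- Pure tensors alone are not closed under sums, whereas `add` is typable at every proposition;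
  -- hence the span.
  | _, .tensor S T, .tensor S' T', v, v' =>
    (v, v') ∈ Submodule.span ℂ {q : Vec × Vec | ∃ a a' b b', Rel S S' a a' ∧ Rel T T' b b' ∧
      q = (vtens a b, vtens a' b')}
  | _, .conj P Q, .conj P' Q', v, v' =>
    Supp (.conj P Q) v ∧ Supp (.conj P' Q') v' ∧
      Rel P P' (vfst v) (vfst v') ∧ Rel Q Q' (vsnd v) (vsnd v')
  | _, .plus A B, .plus A' B', v, v' =>
    Supp (.plus A B) v ∧ Supp (.plus A' B') v' ∧
      Rel A A' (vfst v) (vfst v') ∧ Rel B B' (vsnd v) (vsnd v')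
  | _, .bang P, .bang P', v, v' =>
    (v, v') ∈ Submodule.span ℂ {q : Vec × Vec | ∃ a a' b b', Rel P P' a a' ∧ Rel P P' b b' ∧
      q = (vtens a (vconj b), vtens a' (vconj b'))}
  -- This covers `top` and `zero`, whose spaces are trivial, and all pairs of propositions with
  -- different heads. A term can have two such propositions, as `elimZero` shows, but its
  -- denotations are then zero.
  | _, _, _, v, v' => v = 0 ∧ v' = 0

theorem span_lin_induction {s : Set (Vec × Vec)} {p : Vec → Vec → Prop}
    (hs : ∀ v v', (v, v') ∈ s → p v v') (h0 : p 0 0)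
    (hl : ∀ (a b : ℂ) v v' w w', p v v' → p w w' → p (a • v + b • w) (a • v' + b • w'))
    {v v' : Vec} (h : (v, v') ∈ Submodule.span ℂ s) : p v v' := by
  have : p (v, v').1 (v, v').2 := by
    refine Submodule.span_induction (p := fun q _ => p q.1 q.2) (fun q hq => hs _ _ hq) h0
      (fun x y _ _ hx hy => ?_) (fun a x _ hx => ?_) h
    · simpa using hl 1 1 _ _ _ _ hx hy
    · simpa using hl a 0 _ _ _ _ hx h0
  exact this

/-- The relation must be a linear subspace of pairs, since combinations are formed at every
proposition. At an implication this is inherited from the target because application is linear in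
the function. -/
theorem Rel.lin {f : Frag} {T T' : Ty f} {v v' w w' : Vec} (h : Rel T T' v v')
    (k : Rel T T' w w') (a b : ℂ) : Rel T T' (a • v + b • w) (a • v' + b • w') := by
  induction T generalizing v v' w w' with
  | lolli S T _ ih =>
    cases T' with
    | lolli S' T' =>
      refine ⟨h.1.lin k.1 _ _, h.2.1.lin k.2.1 _ _, fun c c' hc => ?_⟩
      rw [vapp_lin_left, vapp_lin_left]
      exact ih (h.2.2 c c' hc) (k.2.2 c c' hc)
    | _ => simp_all [Rel]
  | tensor S T =>
    cases T' with
    | tensor S' T' => exact Submodule.add_mem _ (Submodule.smul_mem _ a h) (Submodule.smul_mem _ b k)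
    | _ => simp_all [Rel]
  | conj P Q ih ih' =>
    cases T' with
    | conj S' T' =>
      exact ⟨h.1.lin k.1 _ _, h.2.1.lin k.2.1 _ _, ih h.2.2.1 k.2.2.1, ih' h.2.2.2 k.2.2.2⟩
    | _ => simp_all [Rel]
  | plus P Q ih ih' =>
    cases T' with
    | plus S' T' =>
      exact ⟨h.1.lin k.1 _ _, h.2.1.lin k.2.1 _ _, ih h.2.2.1 k.2.2.1, ih' h.2.2.2 k.2.2.2⟩
    | _ => simp_all [Rel]
  | bang P =>
    cases T' with
    | bang P' => exact Submodule.add_mem _ (Submodule.smul_mem _ a h) (Submodule.smul_mem _ b k)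
    | _ => simp_all [Rel]
  | one =>
    cases T' with
    | one => exact ⟨by rw [h.1, k.1], h.2.lin k.2 _ _⟩
    | _ => simp_all [Rel]
  | _ => cases T' <;> simp_all [Rel]

theorem vapp_zero_left {f : Frag} (S : Ty f) (v : Vec) : vapp S 0 v = 0 := by
  funext j; simp [vapp]
theorem vapp₂_zero_left {f : Frag} (S : Ty f) (v : Vec) : vapp₂ S 0 v = 0 := by
  funext j; cases j <;> simp [vapp₂]
theorem vapp₂_zero_right {f : Frag} (S : Ty f) (v : Vec) : vapp₂ S v 0 = 0 := by
  funext j; cases j <;> simp [vapp₂]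
theorem velim_zero {f : Frag} (S T : Ty f) (g : Vec → Vec → Vec) : velim S T 0 g = 0 := by
  simp [velim]
theorem vtau_zero : vtau 0 = 0 := by
  funext j; unfold vtau; split <;> simp
theorem vtens_zero_left (v : Vec) : vtens 0 v = 0 := by
  funext j; cases j <;> simp [vtens]
theorem vtens_zero_right (v : Vec) : vtens v 0 = 0 := by
  funext j; cases j <;> simp [vtens]

theorem Rel.zero {f : Frag} {T T' : Ty f} : Rel T T' 0 0 := by
  induction T with
  | lolli S T _ ih =>
    cases T' with
    | lolli S' T' =>
      refine ⟨.zero, .zero, fun c c' hc => ?_⟩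
      rw [vapp_zero_left, vapp_zero_left]
      exact ih
    | _ => simp_all [Rel]
  | tensor S T =>
    cases T' with
    | tensor S' T' => exact Submodule.zero_mem _
    | _ => simp_all [Rel]
  | conj P Q ih ih' =>
    cases T' with
    | conj S' T' => exact ⟨.zero, .zero, ih, ih'⟩
    | _ => simp_all [Rel]
  | plus P Q ih ih' =>
    cases T' with
    | plus S' T' => exact ⟨.zero, .zero, ih, ih'⟩
    | _ => simp_all [Rel]
  | bang P =>
    cases T' with
    | bang P' => exact Submodule.zero_mem _
    | _ => simp_all [Rel]
  | one =>
    cases T' with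
    | one => exact ⟨rfl, .zero⟩
    | _ => simp_all [Rel]
  | _ => cases T' <;> simp_all [Rel]

theorem Rel.supp {f : Frag} {T T' : Ty f} {v v' : Vec} (h : Rel T T' v v') :
    Supp T v ∧ Supp T' v' := by
  have hz : v = 0 ∧ v' = 0 → Supp T v ∧ Supp T' v' := by
    rintro ⟨rfl, rfl⟩; exact ⟨.zero, .zero⟩
  induction T generalizing v v' with
  | lolli S T _ ih =>
    cases T' with
    | lolli S' T' => exact ⟨h.1, h.2.1⟩
    | _ => exact hz h
  | tensor S T ih ih' =>
    cases T' with
    | tensor S' T' =>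
      refine span_lin_induction (p := fun v v' => Supp _ v ∧ Supp _ v') ?_ ⟨.zero, .zero⟩
        (fun a b v v' w w' hv hw => ⟨hv.1.lin hw.1 _ _, hv.2.lin hw.2 _ _⟩) h
      rintro v v' ⟨a, a', b, b', ha, hb, hq⟩
      obtain ⟨rfl, rfl⟩ := Prod.ext_iff.1 hq
      have Ha := ih ha (by rintro ⟨rfl, rfl⟩; exact ⟨.zero, .zero⟩)
      have Hb := ih' hb (by rintro ⟨rfl, rfl⟩; exact ⟨.zero, .zero⟩)
      exact ⟨Ha.1.vtens Hb.1, Ha.2.vtens Hb.2⟩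
    | _ => exact hz h
  | conj P Q ih ih' =>
    cases T' with
    | conj S' T' => exact ⟨h.1, h.2.1⟩
    | _ => exact hz h
  | plus P Q ih ih' =>
    cases T' with
    | plus S' T' => exact ⟨h.1, h.2.1⟩
    | _ => exact hz h
  | bang P ih =>
    cases T' with
    | bang P' =>
      refine span_lin_induction (p := fun v v' => Supp _ v ∧ Supp _ v') ?_ ⟨.zero, .zero⟩
        (fun a b v v' w w' hv hw => ⟨hv.1.lin hw.1 _ _, hv.2.lin hw.2 _ _⟩) h
      rintro v v' ⟨a, a', b, b', ha, hb, hq⟩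
      obtain ⟨rfl, rfl⟩ := Prod.ext_iff.1 hq
      have Ha := ih ha (by rintro ⟨rfl, rfl⟩; exact ⟨.zero, .zero⟩)
      have Hb := ih hb (by rintro ⟨rfl, rfl⟩; exact ⟨.zero, .zero⟩)
      exact ⟨Ha.1.vbang Hb.1.vconj, Ha.2.vbang Hb.2.vconj⟩
    | _ => exact hz h
  | one =>
    cases T' with
    | one =>
      have : v' = v := h.1.symm
      subst this
      exact ⟨h.2, h.2⟩
    | _ => exact hz h
  | _ => cases T' <;> exact hz h

theorem vconj_bas (i : Ix) : vconj (bas i) = bas i := by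
  funext j; simp only [vconj, bas, Pi.single_apply]; split <;> simp

theorem vapp_bas {f : Frag} {S : Ty f} {i : Ix} (hi : i ∈ idx S) (v : Vec) (j : Ix) :
    vapp S v (bas i) j = v (.pr i j) := by
  simp [vapp, bas, Pi.single_apply, hi]

theorem vtens_bas (i j : Ix) : vtens (bas i) (bas j) = bas (.pr i j) := by
  funext k
  rcases k with _ | ⟨k, l⟩ | _ | _ <;> simp [vtens, bas, Pi.single_apply]
  by_cases h : k = i <;> simp [h]

/-- Functions are compared on basis vectors, which are related to themselves. For `tensor` and
`bang`, each basis vector of the product is a pure tensor of basis vectors, and these are fixed by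
conjugation, so the diagonal of the whole space lies in the span. -/
theorem rel_self {f : Frag} {T : Ty f} {v v' : Vec} : Rel T T v v' ↔ v = v' ∧ Supp T v := by
  induction T generalizing v v' with
  | top =>
    change (v = 0 ∧ v' = 0) ↔ _
    refine ⟨?_, ?_⟩
    · rintro ⟨rfl, rfl⟩; exact ⟨rfl, .zero⟩
    · rintro ⟨rfl, h⟩
      have : v = 0 := funext fun i => h i (by simp [idx])
      exact ⟨this, this⟩
  | zero =>
    change (v = 0 ∧ v' = 0) ↔ _
    refine ⟨?_, ?_⟩
    · rintro ⟨rfl, rfl⟩; exact ⟨rfl, .zero⟩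
    · rintro ⟨rfl, h⟩
      have : v = 0 := funext fun i => h i (by simp [idx])
      exact ⟨this, this⟩
  | one => exact Iff.rfl
  | lolli S T ih ih' =>
    constructor
    · rintro ⟨h1, h2, h3⟩
      refine ⟨funext fun i => ?_, h1⟩
      by_cases hi : i ∈ idx (.lolli S T)
      · obtain ⟨⟨i, j⟩, hp, rfl⟩ := Finset.mem_image.1 hi
        rw [Finset.mem_product] at hp
        rw [← vapp_bas hp.1 v j, (ih'.1 (h3 _ _ (ih.2 ⟨rfl, supp_bas hp.1⟩))).1, vapp_bas hp.1]
      · rw [h1 i hi, h2 i hi]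
    · rintro ⟨rfl, h⟩
      refine ⟨h, h, fun a a' ha => ih'.2 ⟨?_, h.vapp _⟩⟩
      rw [(ih.1 ha).1]
  | tensor S T ih ih' =>
    constructor
    · refine span_lin_induction (p := fun v v' => v = v' ∧ Supp _ v) ?_ ⟨rfl, .zero⟩
        (fun a b v v' w w' hv hw => ⟨by rw [hv.1, hw.1], hv.2.lin hw.2 _ _⟩)
      rintro v v' ⟨a, a', b, b', ha, hb, hq⟩
      obtain ⟨rfl, rfl⟩ := Prod.ext_iff.1 hq
      obtain ⟨rfl, sa⟩ := ih.1 ha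
      obtain ⟨rfl, sb⟩ := ih'.1 hb
      exact ⟨rfl, sa.vtens sb⟩
    · rintro ⟨rfl, h⟩
      have : (v, v) = ∑ i ∈ idx (.tensor S T), v i • (bas i, bas i) := by
        conv_lhs => rw [h.eq_sum]
        simp [Prod.ext_iff, Prod.fst_sum, Prod.snd_sum]
      change (v, v) ∈ Submodule.span _ _
      rw [this]
      refine Submodule.sum_mem _ fun i hi => Submodule.smul_mem _ _ (Submodule.subset_span ?_)
      obtain ⟨⟨i, j⟩, hp, rfl⟩ := Finset.mem_image.1 hi
      rw [Finset.mem_product] at hp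
      exact ⟨bas i, bas i, bas j, bas j, ih.2 ⟨rfl, supp_bas hp.1⟩, ih'.2 ⟨rfl, supp_bas hp.2⟩,
        by rw [vtens_bas]⟩
  | conj P Q ih ih' =>
    constructor
    · rintro ⟨h1, h2, h3, h4⟩
      refine ⟨funext fun i => ?_, h1⟩
      cases i with
      | inl i => exact congrFun (ih.1 h3).1 i
      | inr i => exact congrFun (ih'.1 h4).1 i
      | _ => rw [h1 _ (by simp [idx]), h2 _ (by simp [idx])]
    · rintro ⟨rfl, h⟩
      exact ⟨h, h, ih.2 ⟨rfl, h.vfst_conj⟩, ih'.2 ⟨rfl, h.vsnd_conj⟩⟩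
  | plus P Q ih ih' =>
    constructor
    · rintro ⟨h1, h2, h3, h4⟩
      refine ⟨funext fun i => ?_, h1⟩
      cases i with
      | inl i => exact congrFun (ih.1 h3).1 i
      | inr i => exact congrFun (ih'.1 h4).1 i
      | _ => rw [h1 _ (by simp [idx]), h2 _ (by simp [idx])]
    · rintro ⟨rfl, h⟩
      exact ⟨h, h, ih.2 ⟨rfl, h.vfst_plus⟩, ih'.2 ⟨rfl, h.vsnd_plus⟩⟩
  | bang P ih =>
    constructor
    · refine span_lin_induction (p := fun v v' => v = v' ∧ Supp _ v) ?_ ⟨rfl, .zero⟩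
        (fun a b v v' w w' hv hw => ⟨by rw [hv.1, hw.1], hv.2.lin hw.2 _ _⟩)
      rintro v v' ⟨a, a', b, b', ha, hb, hq⟩
      obtain ⟨rfl, rfl⟩ := Prod.ext_iff.1 hq
      obtain ⟨rfl, sa⟩ := ih.1 ha
      obtain ⟨rfl, sb⟩ := ih.1 hb
      exact ⟨rfl, sa.vbang sb.vconj⟩
    · rintro ⟨rfl, h⟩
      have : (v, v) = ∑ i ∈ idx (.bang P), v i • (bas i, bas i) := by
        conv_lhs => rw [h.eq_sum]
        simp [Prod.ext_iff, Prod.fst_sum, Prod.snd_sum]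
      change (v, v) ∈ Submodule.span _ _
      rw [this]
      refine Submodule.sum_mem _ fun i hi => Submodule.smul_mem _ _ (Submodule.subset_span ?_)
      obtain ⟨⟨i, j⟩, hp, rfl⟩ := Finset.mem_image.1 hi
      rw [Finset.mem_product] at hp
      exact ⟨bas i, bas i, bas j, bas j, ih.2 ⟨rfl, supp_bas hp.1⟩, ih.2 ⟨rfl, supp_bas hp.2⟩,
        by rw [vconj_bas, vtens_bas]⟩

/-- The environments are related at the variables that both contexts declare. -/
def EnvRel {f : Frag} (Γ Γ' : Ctx f) (ρ ρ' : ℕ → Vec) : Prop :=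
  ∀ i S S', Γ.Has i S → Γ'.Has i S' → Rel S S' (ρ i) (ρ' i)

section EnvRel
variable {f : Frag} {Γ Γ' Γ₁ Γ₂ Γ₁' Γ₂' : Ctx f} {ρ ρ' : ℕ → Vec}

theorem EnvRel.econs (h : EnvRel Γ Γ' ρ ρ') {v v' : Vec} {S S' : Ty f} (hv : Rel S S' v v') :
    EnvRel (some S :: Γ) (some S' :: Γ') (econs v ρ) (econs v' ρ') := by
  intro i U U' hi hi'
  cases i with
  | zero =>
    obtain rfl := Option.some.inj (Ctx.has_zero.1 hi)
    obtain rfl := Option.some.inj (Ctx.has_zero.1 hi')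
    exact hv
  | succ i => exact h i U U' (Ctx.has_succ.1 hi) (Ctx.has_succ.1 hi')

theorem EnvRel.left (h : EnvRel Γ Γ' ρ ρ') (hs : Γ.Split Γ₁ Γ₂) (hs' : Γ'.Split Γ₁' Γ₂') :
    EnvRel Γ₁ Γ₁' ρ ρ' :=
  fun i S S' hi hi' => h i S S' (hs.has_iff.2 (.inl hi)) (hs'.has_iff.2 (.inl hi'))

theorem EnvRel.right (h : EnvRel Γ Γ' ρ ρ') (hs : Γ.Split Γ₁ Γ₂) (hs' : Γ'.Split Γ₁' Γ₂') :
    EnvRel Γ₂ Γ₂' ρ ρ' :=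
  fun i S S' hi hi' => h i S S' (hs.has_iff.2 (.inr hi)) (hs'.has_iff.2 (.inr hi'))

end EnvRel

theorem Rel.add {f : Frag} {T T' : Ty f} {v v' w w' : Vec} (h : Rel T T' v v')
    (k : Rel T T' w w') : Rel T T' (v + w) (v' + w') := by
  simpa using h.lin k 1 1

theorem Rel.smul {f : Frag} {T T' : Ty f} {v v' : Vec} (h : Rel T T' v v') (a : ℂ) :
    Rel T T' (a • v) (a • v') := by
  simpa using h.lin h a 0

theorem Rel.vtens {f : Frag} {S S' T T' : Ty f} {v v' w w' : Vec} (h : Rel S S' v v')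
    (k : Rel T T' w w') : Rel (.tensor S T) (.tensor S' T') (vtens v w) (vtens v' w') :=
  Submodule.subset_span ⟨_, _, _, _, h, k, rfl⟩

theorem Rel.vbang {P P' : Ty .pure} {v v' w w' : Vec} (h : Rel P P' v v')
    (k : Rel P P' w w') :
    Rel (.bang P) (.bang P') (BIMALL.vtens v (vconj w)) (BIMALL.vtens v' (vconj w')) :=
  Submodule.subset_span ⟨_, _, _, _, h, k, rfl⟩

/-- Both sides are bilinear, so generators suffice. There `vapp₂_vtens` splits the action into two
ordinary applications, each covered by the implication clause of `Rel`. -/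
theorem Rel.vapp₂ {P P' Q Q' : Ty .pure} {v v' w w' : Vec}
    (h : Rel (.bang (.lolli P Q)) (.bang (.lolli P' Q')) v v')
    (k : Rel (.bang P) (.bang P') w w') :
    Rel (.bang Q) (.bang Q') (vapp₂ P v w) (vapp₂ P' v' w') := by
  refine span_lin_induction
    (p := fun v v' => Rel (.bang Q) (.bang Q') (BIMALL.vapp₂ P v w) (BIMALL.vapp₂ P' v' w'))
    ?_ ?_ ?_ h
  · rintro v v' ⟨a, a', b, b', ha, hb, hq⟩
    obtain ⟨rfl, rfl⟩ := Prod.ext_iff.1 hq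
    refine span_lin_induction (p := fun w w' => Rel (.bang Q) (.bang Q')
      (BIMALL.vapp₂ P (BIMALL.vtens a (vconj b)) w)
      (BIMALL.vapp₂ P' (BIMALL.vtens a' (vconj b')) w')) ?_ ?_ ?_ k
    · rintro w w' ⟨c, c', e, e', hc, he, hq⟩
      obtain ⟨rfl, rfl⟩ := Prod.ext_iff.1 hq
      simp only [vapp₂_vtens]
      exact .vbang (ha.2.2 _ _ hc) (hb.2.2 _ _ he)
    · rw [vapp₂_zero_right, vapp₂_zero_right]; exact .zero
    · intro a b v v' w w' hv hw
      rw [vapp₂_lin_right, vapp₂_lin_right]; exact hv.lin hw _ _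
  · rw [vapp₂_zero_left, vapp₂_zero_left]; exact .zero
  · intro a b v v' w w' hv hw
    rw [vapp₂_lin_left, vapp₂_lin_left]; exact hv.lin hw _ _

theorem Rel.vtau {P P' Q Q' : Ty .pure} {v v' : Vec}
    (h : Rel (.tensor (.bang P) (.bang Q)) (.tensor (.bang P') (.bang Q')) v v') :
    Rel (.bang (.tensor P Q)) (.bang (.tensor P' Q')) (vtau v) (vtau v') := by
  refine span_lin_induction (p := fun v v' => Rel (.bang (.tensor P Q)) (.bang (.tensor P' Q'))
    (BIMALL.vtau v) (BIMALL.vtau v')) ?_ ?_ ?_ h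
  · rintro v v' ⟨x, x', y, y', hx, hy, hq⟩
    obtain ⟨rfl, rfl⟩ := Prod.ext_iff.1 hq
    refine span_lin_induction (p := fun x x' => Rel (.bang (.tensor P Q)) (.bang (.tensor P' Q'))
      (BIMALL.vtau (BIMALL.vtens x y)) (BIMALL.vtau (BIMALL.vtens x' y'))) ?_ ?_ ?_ hx
    · rintro x x' ⟨a, a', b, b', ha, hb, hq⟩
      obtain ⟨rfl, rfl⟩ := Prod.ext_iff.1 hq
      refine span_lin_induction (p := fun y y' =>
        Rel (.bang (.tensor P Q)) (.bang (.tensor P' Q'))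
        (BIMALL.vtau (BIMALL.vtens (BIMALL.vtens a (vconj b)) y))
        (BIMALL.vtau (BIMALL.vtens (BIMALL.vtens a' (vconj b')) y'))) ?_ ?_ ?_ hy
      · rintro y y' ⟨c, c', e, e', hc, he, hq⟩
        obtain ⟨rfl, rfl⟩ := Prod.ext_iff.1 hq
        simp only [vtau_vtens]
        exact .vbang (ha.vtens hc) (hb.vtens he)
      · rw [vtens_zero_right, vtens_zero_right, vtau_zero]; exact .zero
      · intro a b v v' w w' hv hw
        rw [vtens_lin_right, vtens_lin_right, vtau_lin, vtau_lin]; exact hv.lin hw _ _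
    · rw [vtens_zero_left, vtens_zero_left, vtau_zero]; exact .zero
    · intro a b v v' w w' hv hw
      rw [vtens_lin_left, vtens_lin_left, vtau_lin, vtau_lin]; exact hv.lin hw _ _
  · rw [vtau_zero]; exact .zero
  · intro a b v v' w w' hv hw
    rw [vtau_lin, vtau_lin]; exact hv.lin hw _ _

/-- The fundamental lemma of the logical relation. Even for one judgement the two derivations may
disagree on cut propositions and on how variables are split, so the induction has to allow different
contexts and different propositions throughout. -/
theorem Den.rel {f : Frag} {Γ : Ctx f} {M : Tm f} {T : Ty f} {d} (h : Den Γ M T d) :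
    ∀ {Γ' : Ctx f} {T' : Ty f} {d'}, Den Γ' M T' d' → ∀ {ρ ρ' : ℕ → Vec}, SuppEnv Γ ρ →
      SuppEnv Γ' ρ' → EnvRel Γ Γ' ρ ρ' → Rel T T' (d ρ) (d' ρ') := by
  induction h with
  | ax h =>
    intro Γ' T' d' h' ρ ρ' H H' E
    cases h' with
    | ax h' => exact E _ _ _ h.has h'.has
  | sum _ _ ih ih' =>
    intro Γ' T' d' h' ρ ρ' H H' E
    cases h' with
    | sum h1 h2 => exact (ih h1 H H' E).add (ih' h2 H H' E)
  | prod a _ ih =>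
    intro Γ' T' d' h' ρ ρ' H H' E
    cases h' with
    | prod _ h1 => exact (ih h1 H H' E).smul _
  | topI Γ =>
    intro Γ' T' d' h' ρ ρ' H H' E
    cases h' with
    | topI => exact .zero
  | zeroE A hs _ ih =>
    intro Γ' T' d' h' ρ ρ' H H' E
    cases h' with
    | zeroE => exact .zero
  | oneI h =>
    intro Γ' T' d' h' ρ ρ' H H' E
    cases h' with
    | oneI => exact ⟨rfl, supp_bas (by simp [idx])⟩
  | oneE hs _ _ ih ih' =>
    intro Γ' T' d' h' ρ ρ' H H' E
    cases h' with
    | oneE hs' h1 h2 =>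
      have := (ih h1 (H.left hs) (H'.left hs') (E.left hs hs')).1
      simp only [this]
      exact (ih' h2 (H.right hs) (H'.right hs') (E.right hs hs')).smul _
  | lolliI hM ih =>
    intro Γ' T' d' h' ρ ρ' H H' E
    have s1 := (Den.lolliI hM).supp H
    have s2 := h'.supp H'
    cases h' with
    | lolliI h1 =>
      refine ⟨s1, s2, fun a a' ha => ?_⟩
      rw [hM.vapp_vlam ρ ha.supp.1, h1.vapp_vlam ρ' ha.supp.2]
      exact ih h1 (H.econs ha.supp.1) (H'.econs ha.supp.2) (E.econs ha)
  | lolliE hs _ _ ih ih' =>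
    intro Γ' T' d' h' ρ ρ' H H' E
    cases h' with
    | lolliE hs' h1 h2 =>
      exact (ih h1 (H.left hs) (H'.left hs') (E.left hs hs')).2.2 _ _
        (ih' h2 (H.right hs) (H'.right hs') (E.right hs hs'))
    | bangE hs' h1 h2 =>
      -- One derivation types the function by an implication and the other by the modality. At
      -- propositions with different heads `Rel` forces both denotations of the function to vanish,
      -- hence also both results.
      obtain ⟨e1, e2⟩ := ih h1 (H.left hs) (H'.left hs') (E.left hs hs')
      simp only [e1, e2, vapp_zero_left, vapp₂_zero_left]
      exact .zero
  | conjI hM hN ih ih' =>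
    intro Γ' T' d' h' ρ ρ' H H' E
    have s1 := (Den.conjI hM hN).supp H
    have s2 := h'.supp H'
    cases h' with
    | conjI h1 h2 => exact ⟨s1, s2, ih h1 H H' E, ih' h2 H H' E⟩
  | conjE₁ hs _ _ ih ih' =>
    intro Γ' T' d' h' ρ ρ' H H' E
    cases h' with
    | conjE₁ hs' h1 h2 =>
      have := ih h1 (H.left hs) (H'.left hs') (E.left hs hs')
      exact ih' h2 ((H.right hs).econs this.1.vfst_conj) ((H'.right hs').econs this.2.1.vfst_conj)
        ((E.right hs hs').econs this.2.2.1)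
  | conjE₂ hs _ _ ih ih' =>
    intro Γ' T' d' h' ρ ρ' H H' E
    cases h' with
    | conjE₂ hs' h1 h2 =>
      have := ih h1 (H.left hs) (H'.left hs') (E.left hs hs')
      exact ih' h2 ((H.right hs).econs this.1.vsnd_conj) ((H'.right hs').econs this.2.1.vsnd_conj)
        ((E.right hs hs').econs this.2.2.2)
  | plusI₁ B hM ih =>
    intro Γ' T' d' h' ρ ρ' H H' E
    have s1 := (Den.plusI₁ B hM).supp H
    have s2 := h'.supp H'
    cases h' with
    | plusI₁ _ h1 => exact ⟨s1, s2, ih h1 H H' E, .zero⟩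
  | plusI₂ A hM ih =>
    intro Γ' T' d' h' ρ ρ' H H' E
    have s1 := (Den.plusI₂ A hM).supp H
    have s2 := h'.supp H'
    cases h' with
    | plusI₂ _ h1 => exact ⟨s1, s2, .zero, ih h1 H H' E⟩
  | plusE hs _ _ _ ih ih' ih'' =>
    intro Γ' T' d' h' ρ ρ' H H' E
    cases h' with
    | plusE hs' h1 h2 h3 =>
      have := ih h1 (H.left hs) (H'.left hs') (E.left hs hs')
      exact (ih' h2 ((H.right hs).econs this.1.vfst_plus)
        ((H'.right hs').econs this.2.1.vfst_plus) ((E.right hs hs').econs this.2.2.1)).add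
        (ih'' h3 ((H.right hs).econs this.1.vsnd_plus)
        ((H'.right hs').econs this.2.1.vsnd_plus) ((E.right hs hs').econs this.2.2.2))
  | tensorI hs _ _ ih ih' =>
    intro Γ' T' d' h' ρ ρ' H H' E
    cases h' with
    | tensorI hs' h1 h2 =>
      exact (ih h1 (H.left hs) (H'.left hs') (E.left hs hs')).vtens
        (ih' h2 (H.right hs) (H'.right hs') (E.right hs hs'))
  | @tensorE _ _ _ _ _ _ U₁ U₂ U d₀ e₀ hs hM hN ih ih' =>
    intro Γ' T' d' h' ρ ρ' H H' E
    cases h' with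
    | @tensorE _ _ _ _ _ _ S₁ S₂ T' d₁ e₁ hs' h1 h2 =>
      -- The scrutinees are related by a span of pure tensors, and the elimination is linear in the
      -- scrutinee. On a pure tensor it is evaluation of the body.
      refine span_lin_induction (p := fun v v' => Rel U T'
        (velim U₁ U₂ v fun v w => e₀ (econs w (econs v ρ))) (velim S₁ S₂ v' fun v w => e₁ (econs w (econs v ρ'))))
        ?_ ?_ ?_ (ih h1 (H.left hs) (H'.left hs') (E.left hs hs'))
      · rintro v v' ⟨a, a', b, b', ha, hb, hq⟩
        obtain ⟨rfl, rfl⟩ := Prod.ext_iff.1 hq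
        rw [hN.velim_vtens ρ ha.supp.1 hb.supp.1, h2.velim_vtens ρ' ha.supp.2 hb.supp.2]
        exact ih' h2 (((H.right hs).econs ha.supp.1).econs hb.supp.1)
          (((H'.right hs').econs ha.supp.2).econs hb.supp.2)
          (((E.right hs hs').econs ha).econs hb)
      · rw [velim_zero, velim_zero]; exact .zero
      · intro a b v v' w w' hv hw
        rw [velim_lin_left, velim_lin_left]; exact hv.lin hw _ _
  | bangI h _ ih =>
    intro Γ' T' d' h' ρ ρ' H H' E
    cases h' with
    | bangI h' h1 =>
      have := ih h1 (suppEnv_nil 0) (suppEnv_nil 0) fun i S S' hi => by simp at hi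
      exact this.vbang this
  | bangE hs _ _ ih ih' =>
    intro Γ' T' d' h' ρ ρ' H H' E
    cases h' with
    | lolliE hs' h1 h2 =>
      obtain ⟨e1, e2⟩ := ih h1 (H.left hs) (H'.left hs') (E.left hs hs')
      simp only [e1, e2, vapp_zero_left, vapp₂_zero_left]
      exact .zero
    | bangE hs' h1 h2 =>
      exact (ih h1 (H.left hs) (H'.left hs') (E.left hs hs')).vapp₂
        (ih' h2 (H.right hs) (H'.right hs') (E.right hs hs'))
  | tau _ ih =>
    intro Γ' T' d' h' ρ ρ' H H' E
    cases h' with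
    | tau h1 => exact (ih h1 H H' E).vtau

/-- Two derivations of the same judgement denote the same map. -/
theorem Den.coherent {f : Frag} {Γ : Ctx f} {M : Tm f} {T : Ty f} {d d'} (h : Den Γ M T d)
    (h' : Den Γ M T d') {ρ : ℕ → Vec} (H : SuppEnv Γ ρ) : d ρ = d' ρ := by
  refine (rel_self.1 (h.rel h' H H fun i S S' hi hi' => ?_)).1
  obtain rfl := hi.unique hi'
  exact rel_self.2 ⟨rfl, H i S hi⟩

/-! ### Substitution -/

theorem Den.append_isEmpty {f : Frag} {Γ : Ctx f} {M : Tm f} {T : Ty f} {d} (h : Den Γ M T d)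
    {Θ : Ctx f} (hΘ : Θ.IsEmpty) : Den (Γ ++ Θ) M T d := by
  induction h with
  | ax h => exact .ax (h.append_isEmpty hΘ)
  | sum _ _ ih ih' => exact .sum (ih hΘ) (ih' hΘ)
  | prod a _ ih => exact .prod a (ih hΘ)
  | topI Γ => exact .topI _
  | zeroE A hs _ ih => exact .zeroE A (hs.append_isEmpty hΘ) (ih hΘ)
  | oneI h => exact .oneI (h.append hΘ)
  | oneE hs _ _ ih ih' => exact .oneE (hs.append_isEmpty hΘ) (ih hΘ) (ih' hΘ)
  | lolliI _ ih => exact .lolliI (ih hΘ)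
  | lolliE hs _ _ ih ih' => exact .lolliE (hs.append_isEmpty hΘ) (ih hΘ) (ih' hΘ)
  | conjI _ _ ih ih' => exact .conjI (ih hΘ) (ih' hΘ)
  | conjE₁ hs _ _ ih ih' => exact .conjE₁ (hs.append_isEmpty hΘ) (ih hΘ) (ih' hΘ)
  | conjE₂ hs _ _ ih ih' => exact .conjE₂ (hs.append_isEmpty hΘ) (ih hΘ) (ih' hΘ)
  | plusI₁ B _ ih => exact .plusI₁ B (ih hΘ)
  | plusI₂ A _ ih => exact .plusI₂ A (ih hΘ)
  | plusE hs _ _ _ ih ih' ih'' => exact .plusE (hs.append_isEmpty hΘ) (ih hΘ) (ih' hΘ) (ih'' hΘ)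
  | tensorI hs _ _ ih ih' => exact .tensorI (hs.append_isEmpty hΘ) (ih hΘ) (ih' hΘ)
  | tensorE hs _ _ ih ih' => exact .tensorE (hs.append_isEmpty hΘ) (ih hΘ) (ih' hΘ)
  | bangI h hm ih => exact .bangI (h.append hΘ) hm
  | bangE hs _ _ ih ih' => exact .bangE (hs.append_isEmpty hΘ) (ih hΘ) (ih' hΘ)
  | tau _ ih => exact .tau (ih hΘ)

/-- The environment that takes `k` vectors from `ρ` and the remaining ones from `σ`. -/
def eapp : ℕ → (ℕ → Vec) → (ℕ → Vec) → ℕ → Vec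
  | 0, _, σ => σ
  | k + 1, ρ, σ => econs (ρ 0) (eapp k (fun i => ρ (i + 1)) σ)

theorem eapp_lt {k n : ℕ} (h : n < k) (ρ σ : ℕ → Vec) : eapp k ρ σ n = ρ n := by
  induction k generalizing n ρ with
  | zero => omega
  | succ k ih =>
    cases n with
    | zero => rfl
    | succ n => exact ih (by omega) _

theorem eapp_add (k j : ℕ) (ρ σ : ℕ → Vec) : eapp k ρ σ (k + j) = σ j := by
  induction k generalizing ρ with
  | zero => simp [eapp]
  | succ k ih => rw [show k + 1 + j = (k + j) + 1 by omega]; exact ih _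

theorem Ctx.Split.wprod_left {f : Frag} {Θ Θ₁ Θ₂ : Ctx f} (h : Θ.Split Θ₁ Θ₂) (s : ℕ → Tm f) :
    Θ₁.wprod s ≤ Θ.wprod s := by
  rw [h.wprod]; exact Nat.le_mul_of_pos_right _ (Ctx.wprod_pos _ _)

/-- The variables of `Γ` are those bound above the current position and stay; those of `Θ` are
replaced by closed terms. A multiplicative rule divides `Θ`, hence also the product of weights,
between its premises, and an additive rule gives all of it to both, where it distributes over the
sum. The bound is not an equality: `topI` and `elimZero` discard variables, and the extra 1 in some
weights does not scale. -/
theorem Den.subst {f : Frag} {Ξ : Ctx f} {M : Tm f} {T : Ty f} {d} (h : Den Ξ M T d) :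
    ∀ {Γ Θ : Ctx f}, Ξ = Γ ++ Θ → ∀ {s : ℕ → Tm f} {σ : ℕ → Vec},
      (∀ j S, Θ.Has j S → Den [] (s j) S (fun _ => σ j)) →
      Den Γ (subst (upn Γ.length s) M) T (fun ρ => d (eapp Γ.length ρ σ)) ∧
        wt (subst (upn Γ.length s) M) ≤ wt M * Θ.wprod s := by
  induction h with
  | @ax f Ξ n S h =>
    rintro Γ Θ rfl s σ H
    rcases h.append_cases with ⟨h1, h2, h3⟩ | ⟨j, rfl, h2, h3⟩
    · simp only [Tm.subst, upn_var_lt h1, eapp_lt h1, wt, one_mul]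
      exact ⟨.ax h2, Ctx.wprod_pos _ _⟩
    · have := H j S h3.has
      simp only [Tm.subst, upn_add_of_closed this.hasType, eapp_add, wt, one_mul]
      exact ⟨by simpa using this.append_isEmpty h2, h3.le_wprod s⟩
  | sum _ _ ih ih' =>
    rintro Γ Θ rfl s σ H
    obtain ⟨⟨a1, b1⟩, ⟨a2, b2⟩⟩ := And.intro (ih rfl H) (ih' rfl H)
    exact ⟨.sum a1 a2, by simp only [Tm.subst, wt, add_mul]; omega⟩
  | prod a _ ih =>
    rintro Γ Θ rfl s σ H
    obtain ⟨a1, b1⟩ := ih rfl H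
    exact ⟨.prod a a1, b1⟩
  | topI Ξ =>
    rintro Γ Θ rfl s σ H
    exact ⟨.topI _, Nat.le_mul_of_pos_right _ (Ctx.wprod_pos Θ s)⟩
  | zeroE A hs _ ih =>
    rintro Γ Θ rfl s σ H
    obtain ⟨Γ₁, Γ₂, Θ₁, Θ₂, rfl, rfl, l1, l2, s1, s2⟩ := hs.exists_append
    obtain ⟨a1, b1⟩ := ih rfl fun j S hj => H j S (s2.has_iff.2 (.inl hj))
    rw [l1] at a1 b1
    exact ⟨.zeroE A s1 a1, b1.trans (Nat.mul_le_mul_left _ (s2.wprod_left s))⟩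
  | oneI h =>
    rintro Γ Θ rfl s σ H
    exact ⟨.oneI (Ctx.isEmpty_append.1 h).1, Nat.le_mul_of_pos_right _ (Ctx.wprod_pos Θ s)⟩
  | oneE hs _ _ ih ih' =>
    rintro Γ Θ rfl s σ H
    obtain ⟨Γ₁, Γ₂, Θ₁, Θ₂, rfl, rfl, l1, l2, s1, s2⟩ := hs.exists_append
    obtain ⟨a1, b1⟩ := ih rfl fun j S hj => H j S (s2.has_iff.2 (.inl hj))
    obtain ⟨a2, b2⟩ := ih' rfl fun j S hj => H j S (s2.has_iff.2 (.inr hj))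
    rw [l1] at a1 b1; rw [l2] at a2 b2
    refine ⟨.oneE s1 a1 a2, ?_⟩
    have := Nat.mul_le_mul b1 b2
    simp only [Tm.subst, wt, s2.wprod]; nlinarith
  | lolliI _ ih =>
    rintro Γ Θ rfl s σ H
    obtain ⟨a1, b1⟩ := ih (Γ := some _ :: Γ) rfl H
    refine ⟨.lolliI a1, ?_⟩
    have := Ctx.wprod_pos Θ s
    simp only [Tm.subst, wt, add_mul, one_mul]
    exact Nat.add_le_add b1 this
  | lolliE hs _ _ ih ih' =>
    rintro Γ Θ rfl s σ H
    obtain ⟨Γ₁, Γ₂, Θ₁, Θ₂, rfl, rfl, l1, l2, s1, s2⟩ := hs.exists_append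
    obtain ⟨a1, b1⟩ := ih rfl fun j S hj => H j S (s2.has_iff.2 (.inl hj))
    obtain ⟨a2, b2⟩ := ih' rfl fun j S hj => H j S (s2.has_iff.2 (.inr hj))
    rw [l1] at a1 b1; rw [l2] at a2 b2
    refine ⟨.lolliE s1 a1 a2, ?_⟩
    have := Nat.mul_le_mul b1 b2
    simp only [Tm.subst, wt, s2.wprod]; nlinarith
  | conjI _ _ ih ih' =>
    rintro Γ Θ rfl s σ H
    obtain ⟨⟨a1, b1⟩, ⟨a2, b2⟩⟩ := And.intro (ih rfl H) (ih' rfl H)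
    have := Ctx.wprod_pos Θ s
    exact ⟨.conjI a1 a2, by simp only [Tm.subst, wt, add_mul]; omega⟩
  | @conjE₁ _ _ _ _ _ P _ _ _ _ hs _ _ ih ih' =>
    rintro Γ Θ rfl s σ H
    obtain ⟨Γ₁, Γ₂, Θ₁, Θ₂, rfl, rfl, l1, l2, s1, s2⟩ := hs.exists_append
    obtain ⟨a1, b1⟩ := ih rfl fun j S hj => H j S (s2.has_iff.2 (.inl hj))
    obtain ⟨a2, b2⟩ := ih' (Γ := some P :: Γ₂) rfl fun j S hj => H j S (s2.has_iff.2 (.inr hj))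
    rw [l1] at a1 b1; rw [List.length_cons, l2] at a2 b2
    refine ⟨.conjE₁ s1 a1 a2, ?_⟩
    have := Nat.mul_le_mul b1 b2
    simp only [upn] at this
    simp only [Tm.subst, wt, s2.wprod]; nlinarith
  | @conjE₂ _ _ _ _ _ _ Q _ _ _ hs _ _ ih ih' =>
    rintro Γ Θ rfl s σ H
    obtain ⟨Γ₁, Γ₂, Θ₁, Θ₂, rfl, rfl, l1, l2, s1, s2⟩ := hs.exists_append
    obtain ⟨a1, b1⟩ := ih rfl fun j S hj => H j S (s2.has_iff.2 (.inl hj))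
    obtain ⟨a2, b2⟩ := ih' (Γ := some Q :: Γ₂) rfl fun j S hj => H j S (s2.has_iff.2 (.inr hj))
    rw [l1] at a1 b1; rw [List.length_cons, l2] at a2 b2
    refine ⟨.conjE₂ s1 a1 a2, ?_⟩
    have := Nat.mul_le_mul b1 b2
    simp only [upn] at this
    simp only [Tm.subst, wt, s2.wprod]; nlinarith
  | plusI₁ B _ ih =>
    rintro Γ Θ rfl s σ H
    obtain ⟨a1, b1⟩ := ih rfl H
    exact ⟨.plusI₁ B a1, b1⟩
  | plusI₂ A _ ih =>
    rintro Γ Θ rfl s σ H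
    obtain ⟨a1, b1⟩ := ih rfl H
    exact ⟨.plusI₂ A a1, b1⟩
  | @plusE _ _ _ _ _ _ A B _ _ _ _ hs _ _ _ ih ih' ih'' =>
    rintro Γ Θ rfl s σ H
    obtain ⟨Γ₁, Γ₂, Θ₁, Θ₂, rfl, rfl, l1, l2, s1, s2⟩ := hs.exists_append
    obtain ⟨a1, b1⟩ := ih rfl fun j S hj => H j S (s2.has_iff.2 (.inl hj))
    obtain ⟨a2, b2⟩ := ih' (Γ := some A :: Γ₂) rfl fun j S hj => H j S (s2.has_iff.2 (.inr hj))
    obtain ⟨a3, b3⟩ := ih'' (Γ := some B :: Γ₂) rfl fun j S hj => H j S (s2.has_iff.2 (.inr hj))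
    rw [l1] at a1 b1; rw [List.length_cons, l2] at a2 b2; rw [List.length_cons, l2] at a3 b3
    refine ⟨.plusE s1 a1 a2 a3, ?_⟩
    have := Nat.mul_le_mul b1 (Nat.add_le_add b2 b3)
    simp only [upn] at this
    simp only [Tm.subst, wt, s2.wprod]; nlinarith
  | tensorI hs _ _ ih ih' =>
    rintro Γ Θ rfl s σ H
    obtain ⟨Γ₁, Γ₂, Θ₁, Θ₂, rfl, rfl, l1, l2, s1, s2⟩ := hs.exists_append
    obtain ⟨a1, b1⟩ := ih rfl fun j S hj => H j S (s2.has_iff.2 (.inl hj))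
    obtain ⟨a2, b2⟩ := ih' rfl fun j S hj => H j S (s2.has_iff.2 (.inr hj))
    rw [l1] at a1 b1; rw [l2] at a2 b2
    refine ⟨.tensorI s1 a1 a2, ?_⟩
    have := Nat.mul_le_mul b1 b2
    simp only [Tm.subst, wt, s2.wprod]; nlinarith
  | @tensorE _ _ _ _ _ _ S₁ S₂ _ _ _ hs _ _ ih ih' =>
    rintro Γ Θ rfl s σ H
    obtain ⟨Γ₁, Γ₂, Θ₁, Θ₂, rfl, rfl, l1, l2, s1, s2⟩ := hs.exists_append
    obtain ⟨a1, b1⟩ := ih rfl fun j S hj => H j S (s2.has_iff.2 (.inl hj))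
    obtain ⟨a2, b2⟩ := ih' (Γ := some S₂ :: some S₁ :: Γ₂) rfl
      fun j S hj => H j S (s2.has_iff.2 (.inr hj))
    rw [l1] at a1 b1; rw [List.length_cons, List.length_cons, l2] at a2 b2
    refine ⟨.tensorE s1 a1 a2, ?_⟩
    have := Nat.mul_le_mul b1 b2
    simp only [upn] at this
    simp only [Tm.subst, wt, s2.wprod]; nlinarith
  | @bangI _ m _ _ h hm ih =>
    rintro Γ Θ rfl s σ H
    exact ⟨.bangI (Ctx.isEmpty_append.1 h).1 hm, Nat.le_mul_of_pos_right _ (Ctx.wprod_pos _ _)⟩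
  | bangE hs _ _ ih ih' =>
    rintro Γ Θ rfl s σ H
    obtain ⟨Γ₁, Γ₂, Θ₁, Θ₂, rfl, rfl, l1, l2, s1, s2⟩ := hs.exists_append
    obtain ⟨a1, b1⟩ := ih rfl fun j S hj => H j S (s2.has_iff.2 (.inl hj))
    obtain ⟨a2, b2⟩ := ih' rfl fun j S hj => H j S (s2.has_iff.2 (.inr hj))
    rw [l1] at a1 b1; rw [l2] at a2 b2
    refine ⟨.bangE s1 a1 a2, ?_⟩
    have := Nat.mul_le_mul b1 b2
    simp only [Tm.subst, wt, s2.wprod]; nlinarith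
  | tau _ ih =>
    rintro Γ Θ rfl s σ H
    obtain ⟨a1, b1⟩ := ih rfl H
    exact ⟨.tau a1, by simp only [Tm.subst, wt]; nlinarith⟩

theorem scal_one_ne_zero {f : Frag} : (1 : Scal f) ≠ 0 := fun h => by
  have := congrArg sc h; simp at this

/-! ### Improvement of terms along the algebraic equivalence -/

/-- Every derivation for `M` can be turned into one for `M'` with the same denotation. -/
def SemLe {f : Frag} (M M' : Tm f) : Prop :=
  ∀ ⦃Γ : Ctx f⦄ ⦃T : Ty f⦄ ⦃d⦄, Den Γ M T d →
    ∃ d', Den Γ M' T d' ∧ ∀ ρ, SuppEnv Γ ρ → d' ρ = d ρ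

/-- `M'` is algebraically equivalent to `M`, has the same denotation, and no larger measure. -/
structure Better {f : Frag} (M M' : Tm f) : Prop where
  alg : AlgEq M M'
  -- One direction only: read backwards, `AlgEq.add_null` adds an arbitrary summand, which need not
  -- be typable.
  sem : SemLe M M'
  wt : wt M' ≤ wt M
  outw : outw M' ≤ outw M
  comb : comb M' = true → comb M = true
  -- Merging `b + b` into `2 · b` creates a scalar and may raise the inward potential, but by no
  -- more than the weight it removes. At equal weight the inequality says that the inward potential
  -- does not grow, which is what the lexicographic order requires.
  inw : inw M' + Tm.wt M' ≤ inw M + Tm.wt M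

theorem Better.refl {f : Frag} (M : Tm f) : Better M M :=
  ⟨.refl M, fun _ _ d h => ⟨d, h, fun _ _ => rfl⟩, le_rfl, le_rfl, id, le_rfl⟩

theorem Better.trans {f : Frag} {M N O : Tm f} (h : Better M N) (k : Better N O) : Better M O := by
  refine ⟨h.alg.trans k.alg, fun Γ T d hd => ?_, k.wt.trans h.wt, k.outw.trans h.outw,
    fun hc => h.comb (k.comb hc), k.inw.trans h.inw⟩
  obtain ⟨d', h1, h2⟩ := h.sem hd
  obtain ⟨d'', h3, h4⟩ := k.sem h1
  exact ⟨d'', h3, fun ρ hρ => (h4 ρ hρ).trans (h2 ρ hρ)⟩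

theorem vlam_congr {f : Frag} {S : Ty f} {g g' : Vec → Vec}
    (h : ∀ i ∈ idx S, g (bas i) = g' (bas i)) : vlam S g = vlam S g' := by
  funext i
  cases i with
  | pr i j => by_cases hi : i ∈ idx S <;> simp [vlam, hi, h]
  | _ => rfl

theorem velim_congr {f : Frag} {S T : Ty f} {v : Vec} {g g' : Vec → Vec → Vec}
    (h : ∀ i ∈ idx S, ∀ j ∈ idx T, g (bas i) (bas j) = g' (bas i) (bas j)) :
    velim S T v g = velim S T v g' :=
  Finset.sum_congr rfl fun p hp => by
    rw [Finset.mem_product] at hp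
    rw [h _ hp.1 _ hp.2]

theorem outc_le {c c' e e' w w' : ℕ} {b b' : Bool} (hc : c' ≤ c) (he : e' ≤ e) (hw : w' ≤ w)
    (hb : b' = true → b = true) : outc c' e' w' b' ≤ outc c e w b := by
  unfold outc
  refine Nat.mul_le_mul hc ?_
  cases b' <;> cases b <;> simp_all <;> omega

-- Compatibility of improvement with the constructors

section Congr
variable {f : Frag} {M M' N N' O O' : Tm f}

theorem Better.add (h : Better M M') (k : Better N N') : Better (add M N) (add M' N') := by
  refine ⟨.congr_add h.alg k.alg, fun Γ T d hd => ?_, Nat.add_le_add h.wt k.wt,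
    Nat.add_le_add h.outw k.outw, fun _ => rfl, ?_⟩
  · cases hd with
    | sum h1 h2 =>
      obtain ⟨d', a1, b1⟩ := h.sem h1
      obtain ⟨e', a2, b2⟩ := k.sem h2
      exact ⟨_, .sum a1 a2, fun ρ hρ => by simp only [b1 ρ hρ, b2 ρ hρ]⟩
  · have := h.inw; have := k.inw; simp only [Tm.inw, Tm.wt]; omega

theorem Better.smul (a : Scal f) (h : Better M M') : Better (smul a M) (smul a M') := by
  refine ⟨.congr_smul a h.alg, fun Γ T d hd => ?_, h.wt, h.outw, fun _ => rfl, ?_⟩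
  · cases hd with
    | prod _ h1 =>
      obtain ⟨d', a1, b1⟩ := h.sem h1
      exact ⟨_, .prod a a1, fun ρ hρ => by simp only [b1 ρ hρ]⟩
  · have := h.inw; have := h.wt; simp only [Tm.inw, Tm.wt]; omega

/-- A head that loses weight may gain as much inward potential. The eliminator multiplies the loss
by at least 2, which covers the gain. -/
theorem head_inw_le {i i' w w' u u' : ℕ} (hi : i' + w' ≤ i + w) (hw : w' ≤ w) (hu : u' ≤ u)
    (hu' : 0 < u') : i' + 2 * w' * u' ≤ i + 2 * w * u := by
  have h1 : 2 * w * u' ≤ 2 * w * u := Nat.mul_le_mul_left _ hu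
  obtain ⟨s, rfl⟩ := Nat.exists_eq_add_of_le hw
  nlinarith

theorem Better.elimOne (h : Better M M') (k : Better N N') :
    Better (elimOne M N) (elimOne M' N') := by
  refine ⟨.congr_elimOne h.alg k.alg, fun Γ T d hd => ?_,
    Nat.mul_le_mul (Nat.mul_le_mul_left _ h.wt) k.wt, h.outw, fun h => h,
    head_inw_le h.inw h.wt k.wt (wt_pos _)⟩
  cases hd with
  | oneE hs h1 h2 =>
    obtain ⟨d', a1, b1⟩ := h.sem h1
    obtain ⟨e', a2, b2⟩ := k.sem h2
    exact ⟨_, .oneE hs a1 a2, fun ρ hρ => by simp only [b1 ρ (hρ.left hs), b2 ρ (hρ.right hs)]⟩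

theorem Better.lam (h : Better M M') : Better (lam M) (lam M') := by
  refine ⟨.congr_lam h.alg, fun Γ T d hd => ?_, Nat.succ_le_succ h.wt, le_rfl, fun h => h, ?_⟩
  · cases hd with
    | lolliI h1 =>
      obtain ⟨d', a1, b1⟩ := h.sem h1
      exact ⟨_, .lolliI a1, fun ρ hρ => vlam_congr fun i hi => b1 _ (hρ.econs (supp_bas hi))⟩
  · have := h.wt; simp only [Tm.inw, Tm.wt]; omega

theorem Better.app (h : Better M M') (k : Better N N') : Better (app M N) (app M' N') := by
  refine ⟨.congr_app h.alg k.alg, fun Γ T d hd => ?_,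
    Nat.mul_le_mul (Nat.mul_le_mul_left _ h.wt) k.wt, Nat.add_le_add h.outw k.outw, fun h => h,
    ?_⟩
  · cases hd with
    | lolliE hs h1 h2 =>
      obtain ⟨d', a1, b1⟩ := h.sem h1
      obtain ⟨e', a2, b2⟩ := k.sem h2
      exact ⟨_, .lolliE hs a1 a2,
        fun ρ hρ => by simp only [b1 ρ (hρ.left hs), b2 ρ (hρ.right hs)]⟩
    | bangE hs h1 h2 =>
      obtain ⟨d', a1, b1⟩ := h.sem h1
      obtain ⟨e', a2, b2⟩ := k.sem h2
      exact ⟨_, .bangE hs a1 a2,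
        fun ρ hρ => by simp only [b1 ρ (hρ.left hs), b2 ρ (hρ.right hs)]⟩
  · have h1 := h.inw; have h2 := k.inw; have h3 := h.wt; have h4 := k.wt
    have h5 := wt_pos M'; have h6 := wt_pos N'
    simp only [Tm.inw, Tm.wt]
    obtain ⟨s, hs⟩ := Nat.exists_eq_add_of_le h3
    obtain ⟨t, ht⟩ := Nat.exists_eq_add_of_le h4
    rw [hs] at h1 ⊢; rw [ht] at h2 ⊢
    nlinarith [Nat.zero_le (s * t), Nat.mul_le_mul_left s h6, Nat.mul_le_mul_left t h5]

theorem Better.tens (h : Better M M') (k : Better N N') : Better (tens M N) (tens M' N') := by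
  refine ⟨.congr_tens h.alg k.alg, fun Γ T d hd => ?_, Nat.mul_le_mul h.wt k.wt,
    Nat.add_le_add (Nat.mul_le_mul h.outw k.wt) (Nat.mul_le_mul h.wt k.outw), fun hc => ?_, ?_⟩
  · cases hd with
    | tensorI hs h1 h2 =>
      obtain ⟨d', a1, b1⟩ := h.sem h1
      obtain ⟨e', a2, b2⟩ := k.sem h2
      exact ⟨_, .tensorI hs a1 a2,
        fun ρ hρ => by simp only [b1 ρ (hρ.left hs), b2 ρ (hρ.right hs)]⟩
  · simp only [Tm.comb, Bool.or_eq_true] at hc ⊢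
    exact hc.imp h.comb k.comb
  · have h1 := h.inw; have h2 := k.inw; have h3 := h.wt; have h4 := k.wt
    simp only [Tm.inw, Tm.wt]
    obtain ⟨s, hs⟩ := Nat.exists_eq_add_of_le h3
    obtain ⟨t, ht⟩ := Nat.exists_eq_add_of_le h4
    have h5 : Tm.inw M' ≤ Tm.inw M + s := by omega
    have h6 : Tm.inw N' ≤ Tm.inw N + t := by omega
    rw [hs, ht]
    nlinarith [Nat.mul_le_mul_right (Tm.wt N') h5, Nat.mul_le_mul_left (Tm.wt M') h6,
      Nat.zero_le (Tm.inw M * t), Nat.zero_le (s * Tm.inw N), Nat.zero_le (s * t)]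

theorem Better.elimTens (h : Better M M') (k : Better N N') :
    Better (elimTens M N) (elimTens M' N') := by
  refine ⟨.congr_elimTens h.alg k.alg, fun Γ T d hd => ?_,
    Nat.mul_le_mul (Nat.mul_le_mul_left _ h.wt) k.wt,
    outc_le (Nat.mul_le_mul_left _ k.wt) h.outw h.wt h.comb, fun h => h,
    head_inw_le h.inw h.wt k.wt (wt_pos _)⟩
  cases hd with
  | tensorE hs h1 h2 =>
    obtain ⟨d', a1, b1⟩ := h.sem h1
    obtain ⟨e', a2, b2⟩ := k.sem h2
    refine ⟨_, .tensorE hs a1 a2, fun ρ hρ => ?_⟩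
    simp only [b1 ρ (hρ.left hs)]
    exact velim_congr fun i hi j hj =>
      b2 _ (((hρ.right hs).econs (supp_bas hi)).econs (supp_bas hj))

end Congr

section CongrPure
variable {M M' N N' : Tm .pure}

theorem Better.pair (h : Better M M') (k : Better N N') : Better (pair M N) (pair M' N') := by
  refine ⟨.congr_pair h.alg k.alg, fun Γ T d hd => ?_,
    Nat.succ_le_succ (Nat.add_le_add h.wt k.wt), Nat.add_le_add h.outw k.outw, fun h => h, ?_⟩
  · cases hd with
    | conjI h1 h2 =>
      obtain ⟨d', a1, b1⟩ := h.sem h1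
      obtain ⟨e', a2, b2⟩ := k.sem h2
      exact ⟨_, .conjI a1 a2, fun ρ hρ => by simp only [b1 ρ hρ, b2 ρ hρ]⟩
  · have := h.inw; have := k.inw; simp only [Tm.inw, Tm.wt]; omega

theorem Better.elimFst (h : Better M M') (k : Better N N') :
    Better (elimFst M N) (elimFst M' N') := by
  refine ⟨.congr_elimFst h.alg k.alg, fun Γ T d hd => ?_,
    Nat.mul_le_mul (Nat.mul_le_mul_left _ h.wt) k.wt, h.outw, fun h => h,
    head_inw_le h.inw h.wt k.wt (wt_pos _)⟩
  cases hd with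
  | conjE₁ hs h1 h2 =>
    obtain ⟨d', a1, b1⟩ := h.sem h1
    obtain ⟨e', a2, b2⟩ := k.sem h2
    refine ⟨_, .conjE₁ hs a1 a2, fun ρ hρ => ?_⟩
    simp only [b1 ρ (hρ.left hs)]
    exact b2 _ ((hρ.right hs).econs (h1.supp (hρ.left hs)).vfst_conj)

theorem Better.elimSnd (h : Better M M') (k : Better N N') :
    Better (elimSnd M N) (elimSnd M' N') := by
  refine ⟨.congr_elimSnd h.alg k.alg, fun Γ T d hd => ?_,
    Nat.mul_le_mul (Nat.mul_le_mul_left _ h.wt) k.wt, h.outw, fun h => h,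
    head_inw_le h.inw h.wt k.wt (wt_pos _)⟩
  cases hd with
  | conjE₂ hs h1 h2 =>
    obtain ⟨d', a1, b1⟩ := h.sem h1
    obtain ⟨e', a2, b2⟩ := k.sem h2
    refine ⟨_, .conjE₂ hs a1 a2, fun ρ hρ => ?_⟩
    simp only [b1 ρ (hρ.left hs)]
    exact b2 _ ((hρ.right hs).econs (h1.supp (hρ.left hs)).vsnd_conj)

theorem Better.bang (h : Better M M') : Better (bang M) (bang M') := by
  refine ⟨.congr_bang h.alg, fun Γ T d hd => ?_, Nat.mul_le_mul_left _ h.wt,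
    outc_le le_rfl h.outw h.wt h.comb, fun h => h, ?_⟩
  · cases hd with
    | bangI he h1 =>
      obtain ⟨d', a1, b1⟩ := h.sem h1
      exact ⟨_, .bangI he a1, fun ρ hρ => by simp only [b1 0 (suppEnv_nil 0)]⟩
  · have := h.inw; have := h.wt; simp only [Tm.inw, Tm.wt]; omega

end CongrPure

section CongrMixed
variable {M M' N N' O O' : Tm .mixed}

theorem Better.elimZero (h : Better M M') : Better (elimZero M) (elimZero M') := by
  refine ⟨.congr_elimZero h.alg, fun Γ T d hd => ?_, h.wt, h.outw, fun h => h, h.inw⟩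
  cases hd with
  | zeroE _ hs h1 =>
    obtain ⟨d', a1, b1⟩ := h.sem h1
    exact ⟨_, .zeroE _ hs a1, fun _ _ => rfl⟩

theorem Better.inl (h : Better M M') : Better (inl M) (inl M') := by
  refine ⟨.congr_inl h.alg, fun Γ T d hd => ?_, h.wt, outc_le le_rfl h.outw h.wt h.comb,
    fun h => h, h.inw⟩
  cases hd with
  | plusI₁ B h1 =>
    obtain ⟨d', a1, b1⟩ := h.sem h1
    exact ⟨_, .plusI₁ B a1, fun ρ hρ => by simp only [b1 ρ hρ]⟩

theorem Better.inr (h : Better M M') : Better (inr M) (inr M') := by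
  refine ⟨.congr_inr h.alg, fun Γ T d hd => ?_, h.wt, outc_le le_rfl h.outw h.wt h.comb,
    fun h => h, h.inw⟩
  cases hd with
  | plusI₂ B h1 =>
    obtain ⟨d', a1, b1⟩ := h.sem h1
    exact ⟨_, .plusI₂ B a1, fun ρ hρ => by simp only [b1 ρ hρ]⟩

theorem Better.elimPlus (h : Better M M') (k : Better N N') (l : Better O O') :
    Better (elimPlus M N O) (elimPlus M' N' O') := by
  have hw := Nat.add_le_add k.wt l.wt
  refine ⟨.congr_elimPlus h.alg k.alg l.alg, fun Γ T d hd => ?_,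
    Nat.mul_le_mul (Nat.mul_le_mul_left _ h.wt) hw,
    outc_le (Nat.mul_le_mul_left _ hw) h.outw h.wt h.comb, fun h => h,
    head_inw_le h.inw h.wt hw (Nat.add_pos_left (wt_pos _) _)⟩
  cases hd with
  | plusE hs h1 h2 h3 =>
    obtain ⟨d', a1, b1⟩ := h.sem h1
    obtain ⟨e', a2, b2⟩ := k.sem h2
    obtain ⟨e'', a3, b3⟩ := l.sem h3
    refine ⟨_, .plusE hs a1 a2 a3, fun ρ hρ => ?_⟩
    simp only [b1 ρ (hρ.left hs)]
    rw [b2 _ ((hρ.right hs).econs (h1.supp (hρ.left hs)).vfst_plus),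
      b3 _ ((hρ.right hs).econs (h1.supp (hρ.left hs)).vsnd_plus)]

theorem Better.tau (h : Better M M') : Better (tau M) (tau M') := by
  refine ⟨.congr_tau h.alg, fun Γ T d hd => ?_, Nat.mul_le_mul_left _ h.wt,
    outc_le le_rfl h.outw h.wt h.comb, fun h => h, ?_⟩
  · cases hd with
    | tau h1 =>
      obtain ⟨d', a1, b1⟩ := h.sem h1
      exact ⟨_, .tau a1, fun ρ hρ => by simp only [b1 ρ hρ]⟩
  · have := h.inw; have := h.wt; simp only [Tm.inw, Tm.wt]; omega

end CongrMixed

/-! ### Algebraic laws -/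

/-- The side condition of `AlgEq.add_null` concerns the syntactic form only. It is evaded by writing
`0 · M'` as `1 · (0 · M')`, which is not headed by the scalar 0. -/
theorem AlgEq.add_null' {f : Frag} (M N : Tm f) : AlgEq (add M (smul 0 N)) M := by
  by_cases h : ∀ M', M ≠ smul 0 M'
  · exact .add_null M N h
  · push Not at h
    obtain ⟨M', rfl⟩ := h
    have h1 : AlgEq (smul 0 M') (smul 1 (smul 0 M')) := (AlgEq.one_smul _).symm
    refine (h1.congr_add (.refl _)).trans ((AlgEq.add_null _ _ fun M'' e => ?_).trans h1.symm)
    exact scal_one_ne_zero (by injection e)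

section Laws
variable {f : Frag} (a b : Scal f) (M N O : Tm f)

theorem Better.add_comm : Better (Tm.add M N) (Tm.add N M) := by
  refine ⟨.add_comm M N, fun Γ T d hd => ?_, by simp only [Tm.wt]; omega,
    by simp only [Tm.outw]; omega, fun _ => rfl, by simp only [Tm.wt, Tm.inw]; omega⟩
  cases hd with
  | sum h1 h2 => exact ⟨_, .sum h2 h1, fun _ _ => _root_.add_comm _ _⟩

theorem Better.add_assoc :
    Better (Tm.add (Tm.add M N) O) (Tm.add M (Tm.add N O)) := by
  refine ⟨(AlgEq.add_assoc M N O).symm, fun Γ T d hd => ?_, by simp only [Tm.wt]; omega,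
    by simp only [Tm.outw]; omega, fun _ => rfl, by simp only [Tm.wt, Tm.inw]; omega⟩
  cases hd with
  | sum h1 h2 =>
    cases h1 with
    | sum h1 h3 => exact ⟨_, .sum h1 (.sum h3 h2), fun _ _ => (_root_.add_assoc _ _ _).symm⟩

theorem Better.add_assoc_symm :
    Better (Tm.add M (Tm.add N O)) (Tm.add (Tm.add M N) O) := by
  refine ⟨.add_assoc M N O, fun Γ T d hd => ?_, by simp only [Tm.wt]; omega,
    by simp only [Tm.outw]; omega, fun _ => rfl, by simp only [Tm.wt, Tm.inw]; omega⟩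
  cases hd with
  | sum h1 h2 =>
    cases h2 with
    | sum h2 h3 => exact ⟨_, .sum (.sum h1 h2) h3, fun _ _ => _root_.add_assoc _ _ _⟩

theorem Better.add_left_comm :
    Better (Tm.add M (Tm.add N O)) (Tm.add N (Tm.add M O)) := by
  refine ⟨(AlgEq.add_assoc M N O).trans (((AlgEq.add_comm M N).congr_add (.refl O)).trans
    (AlgEq.add_assoc N M O).symm), fun Γ T d hd => ?_, by simp only [Tm.wt]; omega,
    by simp only [Tm.outw]; omega, fun _ => rfl, by simp only [Tm.wt, Tm.inw]; omega⟩
  cases hd with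
  | sum h1 h2 =>
    cases h2 with
    | sum h2 h3 => exact ⟨_, .sum h2 (.sum h1 h3), fun _ _ => _root_.add_left_comm _ _ _⟩

theorem Better.smul_add :
    Better (Tm.smul a (Tm.add M N)) (Tm.add (Tm.smul a M) (Tm.smul a N)) := by
  refine ⟨.smul_add a M N, fun Γ T d hd => ?_, le_rfl, le_rfl, fun _ => rfl,
    by simp only [Tm.wt, Tm.inw]; omega⟩
  cases hd with
  | prod _ h1 =>
    cases h1 with
    | sum h1 h2 => exact ⟨_, .sum (.prod a h1) (.prod a h2), fun _ _ => (_root_.smul_add _ _ _).symm⟩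

theorem Better.add_tens :
    Better (Tm.tens (Tm.add M N) O) (Tm.add (Tm.tens M O) (Tm.tens N O)) := by
  refine ⟨.add_tens M N O, fun Γ T d hd => ?_, by simp only [Tm.wt]; linarith,
    by simp only [Tm.outw, Tm.wt]; linarith, fun _ => rfl,
    by simp only [Tm.wt, Tm.inw]; linarith⟩
  cases hd with
  | tensorI hs h1 h2 =>
    cases h1 with
    | sum h1 h3 =>
      refine ⟨_, .sum (.tensorI hs h1 h2) (.tensorI hs h3 h2), fun ρ _ => ?_⟩
      simpa using (vtens_lin_left 1 1 _ _ _).symm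

theorem Better.tens_add :
    Better (Tm.tens M (Tm.add N O)) (Tm.add (Tm.tens M N) (Tm.tens M O)) := by
  refine ⟨.tens_add M N O, fun Γ T d hd => ?_, by simp only [Tm.wt]; linarith,
    by simp only [Tm.outw, Tm.wt]; linarith, fun _ => by simp [Tm.comb],
    by simp only [Tm.wt, Tm.inw]; linarith⟩
  cases hd with
  | tensorI hs h1 h2 =>
    cases h2 with
    | sum h2 h3 =>
      refine ⟨_, .sum (.tensorI hs h1 h2) (.tensorI hs h1 h3), fun ρ _ => ?_⟩
      simpa using (vtens_lin_right 1 1 _ _ _).symm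

theorem Better.add_null : Better (Tm.add M (Tm.smul 0 N)) M := by
  refine ⟨.add_null' M N, fun Γ T d hd => ?_, by simp only [Tm.wt]; omega,
    by simp only [Tm.outw]; omega, fun _ => rfl, by simp only [Tm.wt, Tm.inw]; omega⟩
  cases hd with
  | sum h1 h2 =>
    cases h2 with
    | prod _ h2 => exact ⟨_, h1, fun ρ _ => by simp⟩

end Laws

/-! ### Linear combinations as lists -/

open Classical in
/-- The term `a · b`, where a coefficient `1` is omitted. -/
noncomputable def tm {f : Frag} (p : Scal f × Tm f) : Tm f := if p.1 = 1 then p.2 else smul p.1 p.2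

/-- The linear combination with the given summands, bracketed to the right. -/
noncomputable def lin {f : Frag} : List (Scal f × Tm f) → Tm f
  -- A junk value: linear combinations are non-empty.
  | [] => star
  | [p] => tm p
  | p :: q :: l => add (tm p) (lin (q :: l))

section tm
variable {f : Frag} (a c : Scal f) (b b' : Tm f) (p : Scal f × Tm f)

@[simp] theorem tm_one : tm (1, b) = b := by simp [tm]

theorem tm_of_ne {a : Scal f} (h : a ≠ 1) : tm (a, b) = smul a b := by simp [tm, h]

theorem lin_cons {l : List (Scal f × Tm f)} (h : l ≠ []) : lin (p :: l) = add (tm p) (lin l) := by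
  cases l with
  | nil => simp at h
  | cons q l => rfl

theorem algEq_tm : AlgEq (tm p) (smul p.1 p.2) := by
  obtain ⟨a, b⟩ := p
  by_cases h : a = 1
  · subst h; rw [tm_one]; exact (AlgEq.one_smul b).symm
  · rw [tm_of_ne b h]; exact .refl _

theorem Den.of_tm {Γ : Ctx f} {T : Ty f} {d} {p : Scal f × Tm f} (h : Den Γ (tm p) T d) :
    ∃ d', Den Γ p.2 T d' ∧ ∀ ρ, d ρ = sc p.1 • d' ρ := by
  obtain ⟨a, b⟩ := p
  by_cases e : a = 1
  · subst e; rw [tm_one] at h; exact ⟨d, h, fun ρ => by simp⟩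
  · rw [tm_of_ne b e] at h
    cases h with
    | prod _ h => exact ⟨_, h, fun _ => rfl⟩

theorem Den.tm {Γ : Ctx f} {T : Ty f} {d} {b : Tm f} (h : Den Γ b T d) (a : Scal f) :
    Den Γ (tm (a, b)) T (fun ρ => sc a • d ρ) := by
  by_cases e : a = 1
  · subst e; rw [tm_one]; simpa using h
  · rw [tm_of_ne b e]; exact .prod a h

@[simp] theorem wt_tm : wt (tm p) = wt p.2 := by
  unfold tm; split <;> simp [wt]

@[simp] theorem outw_tm : outw (tm p) = outw p.2 := by
  unfold tm; split <;> simp [outw]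

theorem inw_tm_le : inw (tm p) ≤ inw p.2 + wt p.2 := by
  unfold tm; split <;> simp [inw]

theorem le_inw_tm : inw p.2 ≤ inw (tm p) := by
  unfold tm; split <;> simp [inw]

/-- The two copies of `b` may come with different derivations. Coherence identifies their
denotations, so a single derivation can serve the merged summand. -/
theorem Better.merge : Better (Tm.add (BIMALL.tm (a, b)) (BIMALL.tm (c, b))) (BIMALL.tm (a + c, b)) := by
  refine ⟨((algEq_tm _).congr_add (algEq_tm _)).trans ((AlgEq.add_smul a c b).trans
    (algEq_tm (a + c, b)).symm), fun Γ T d hd => ?_, by simp [Tm.wt], by simp [Tm.outw], fun _ => rfl, ?_⟩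
  · cases hd with
    | sum h1 h2 =>
      obtain ⟨d1, h1, e1⟩ := h1.of_tm
      obtain ⟨d2, h2, e2⟩ := h2.of_tm
      refine ⟨_, h1.tm _, fun ρ hρ => ?_⟩
      simp only [e1, e2, h2.coherent h1 hρ, sc_add, add_smul]
  · have h1 := inw_tm_le (a + c, b); have h2 := le_inw_tm (a, b); have h3 := le_inw_tm (c, b)
    simp only [Tm.inw, Tm.wt, wt_tm] at *; omega

theorem Better.smul_tm : Better (Tm.smul a (BIMALL.tm (c, b))) (BIMALL.tm (a * c, b)) := by
  refine ⟨((algEq_tm _).congr_smul a).trans ((AlgEq.mul_smul a c b).trans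
    (algEq_tm (a * c, b)).symm), fun Γ T d hd => ?_, by simp [Tm.wt], by simp [Tm.outw], fun _ => rfl, ?_⟩
  · cases hd with
    | prod _ h1 =>
      obtain ⟨d1, h1, e1⟩ := h1.of_tm
      refine ⟨_, h1.tm _, fun ρ hρ => ?_⟩
      simp only [e1, sc_mul, mul_smul]
  · have h1 := inw_tm_le (a * c, b); have h2 := le_inw_tm (c, b)
    simp only [Tm.inw, Tm.wt, wt_tm] at *; omega

theorem Better.tens_tm : Better (Tm.tens (BIMALL.tm (a, b)) (BIMALL.tm (c, b')))
    (BIMALL.tm (a * c, Tm.tens b b')) := by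
  refine ⟨((algEq_tm _).congr_tens (algEq_tm _)).trans ((AlgEq.smul_tens a b _).trans
    (((AlgEq.tens_smul c b b').congr_smul a).trans ((AlgEq.mul_smul a c _).trans
    (algEq_tm (a * c, Tm.tens b b')).symm))), fun Γ T d hd => ?_, by simp [Tm.wt], by simp [Tm.outw], fun h => ?_, ?_⟩
  · cases hd with
    | tensorI hs h1 h2 =>
      obtain ⟨d1, h1, e1⟩ := h1.of_tm
      obtain ⟨d2, h2, e2⟩ := h2.of_tm
      refine ⟨_, (Den.tensorI hs h1 h2).tm _, fun ρ hρ => ?_⟩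
      funext i
      cases i <;> simp [e1, e2, vtens]
      ring
  · by_cases ha : a = 1
    · by_cases hc : c = 1
      · subst ha hc; simpa using h
      · simp [Tm.comb, tm_of_ne b' hc]
    · simp [Tm.comb, tm_of_ne b ha]
  · by_cases ha : a = 1
    · by_cases hc : c = 1
      · subst ha hc; simp
      · subst ha
        have := inw_tm_le (c, Tm.tens b b')
        simp only [one_mul, tm_one, tm_of_ne b' hc, wt_tm, Tm.inw, Tm.wt] at *; linarith
    · have := inw_tm_le (a * c, Tm.tens b b')
      have h2 := Nat.mul_le_mul_left (Tm.wt b) (le_inw_tm (c, b'))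
      simp only [tm_of_ne b ha, wt_tm, Tm.inw, Tm.wt] at *; linarith

end tm

section lin
variable {f : Frag}

theorem Better.lin_append {l k : List (Scal f × Tm f)} (hl : l ≠ []) (hk : k ≠ []) :
    Better (Tm.add (lin l) (lin k)) (lin (l ++ k)) := by
  induction l with
  | nil => simp at hl
  | cons p l ih =>
    by_cases h : l = []
    · subst h; rw [List.singleton_append, lin_cons _ hk]; exact .refl _
    · rw [List.cons_append, lin_cons _ h, lin_cons _ (by simp [h])]
      exact (Better.add_assoc _ _ _).trans ((Better.refl _).add (ih h))

theorem Better.lin_perm {l k : List (Scal f × Tm f)} (h : l.Perm k) : Better (lin l) (lin k) := by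
  induction h with
  | nil => exact .refl _
  | @cons p l k h ih =>
    by_cases hl : l = []
    · subst hl; rw [h.nil_eq.symm]; exact .refl _
    · have hk : k ≠ [] := fun e => hl (by subst e; exact h.eq_nil)
      rw [lin_cons _ hl, lin_cons _ hk]; exact (Better.refl _).add ih
  | swap p q l =>
    by_cases hl : l = []
    · subst hl; exact .add_comm _ _
    · rw [lin_cons _ (by simp), lin_cons _ hl, lin_cons _ (by simp), lin_cons _ hl]
      exact .add_left_comm _ _ _
  | trans _ _ ih ih' => exact ih.trans ih'

theorem Better.lin_smul (a : Scal f) {l : List (Scal f × Tm f)} (hl : l ≠ []) :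
    Better (Tm.smul a (lin l)) (lin (l.map fun p => (a * p.1, p.2))) := by
  induction l with
  | nil => simp at hl
  | cons p l ih =>
    by_cases h : l = []
    · subst h; exact .smul_tm _ _ _
    · rw [List.map_cons, lin_cons _ h, lin_cons _ (by simp [h])]
      exact (Better.smul_add _ _ _).trans ((Better.smul_tm _ _ _).add (ih h))

theorem Better.tm_tens_lin (p : Scal f × Tm f) {k : List (Scal f × Tm f)} (hk : k ≠ []) :
    Better (Tm.tens (BIMALL.tm p) (lin k)) (lin (k.map fun q => (p.1 * q.1, Tm.tens p.2 q.2))) := by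
  induction k with
  | nil => simp at hk
  | cons q k ih =>
    by_cases h : k = []
    · subst h; exact .tens_tm _ _ _ _
    · rw [List.map_cons, lin_cons _ h, lin_cons _ (by simp [h])]
      exact (Better.tens_add _ _ _).trans ((Better.tens_tm _ _ _ _).add (ih h))

theorem Better.lin_tens_lin {l k : List (Scal f × Tm f)} (hl : l ≠ []) (hk : k ≠ []) :
    Better (Tm.tens (lin l) (lin k))
      (lin (l.flatMap fun p => k.map fun q => (p.1 * q.1, Tm.tens p.2 q.2))) := by
  induction l with
  | nil => simp at hl
  | cons p l ih =>
    by_cases h : l = []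
    · subst h; simpa [lin] using Better.tm_tens_lin p hk
    · rw [List.flatMap_cons, lin_cons _ h]
      refine (Better.add_tens _ _ _).trans (((Better.tm_tens_lin p hk).add (ih h)).trans
        (Better.lin_append (by simp [hk]) fun e => ?_))
      rw [List.flatMap_eq_nil_iff] at e
      obtain ⟨q, hq⟩ := List.exists_mem_of_ne_nil l h
      exact hk (List.map_eq_nil_iff.1 (e q hq))

/-- The list consists of the summands of an algebraic form. -/
structure IsNF (l : List (Scal f × Tm f)) : Prop where
  ne_nil : l ≠ []
  nodup : (l.map Prod.snd).Nodup
  coef : (∀ p ∈ l, p.1 ≠ 0) ∨ ∀ p ∈ l, p.1 = 0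
  base : ∀ p ∈ l, IsBase p.2

theorem IsNF.perm {l k : List (Scal f × Tm f)} (h : IsNF l) (hp : l.Perm k) : IsNF k where
  ne_nil e := h.ne_nil (by subst e; exact hp.eq_nil)
  nodup := (hp.map _).nodup_iff.1 h.nodup
  coef := h.coef.imp (fun H p hk => H p (hp.mem_iff.2 hk)) fun H p hk => H p (hp.mem_iff.2 hk)
  base p hk := h.base p (hp.mem_iff.2 hk)

theorem exists_perm_of_not_nodup {l : List (Scal f × Tm f)} (h : ¬ (l.map Prod.snd).Nodup) :
    ∃ a c b k, l.Perm ((a, b) :: (c, b) :: k) := by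
  induction l with
  | nil => simp at h
  | cons p l ih =>
    rw [List.map_cons, List.nodup_cons, not_and_or, not_not] at h
    by_cases hm : p.2 ∈ l.map Prod.snd
    · obtain ⟨⟨c, b⟩, hq, rfl⟩ := List.mem_map.1 hm
      obtain ⟨s, t, rfl⟩ := List.append_of_mem hq
      exact ⟨p.1, c, p.2, s ++ t, List.perm_middle.cons p⟩
    · obtain ⟨a, c, b, k, hk⟩ := ih (h.resolve_left hm)
      exact ⟨a, c, b, p :: k, (hk.cons p).trans
        ((List.Perm.swap _ _ _).trans ((List.Perm.swap _ _ _).cons _))⟩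

/-- Equal base forms are merged, and then a summand with coefficient 0 is dropped if another
coefficient is nonzero; each operation shortens the list, which gives the recursion. The last
clause, that no new base form appears, lets properties of the summands survive normalisation. -/
theorem exists_isNF (l : List (Scal f × Tm f)) (hl : l ≠ []) (hb : ∀ p ∈ l, IsBase p.2) :
    ∃ k, Better (lin l) (lin k) ∧ IsNF k ∧ ∀ p ∈ k, p.2 ∈ l.map Prod.snd := by
  by_cases hn : (l.map Prod.snd).Nodup
  · by_cases hz : ∃ p ∈ l, p.1 = 0
    · obtain ⟨⟨a, b⟩, hp, rfl : a = 0⟩ := hz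
      by_cases hz' : ∀ p ∈ l, p.1 = 0
      · exact ⟨l, .refl _, ⟨hl, hn, .inr hz', hb⟩, fun p hp => List.mem_map_of_mem hp⟩
      · push Not at hz'
        obtain ⟨q, hq, hq0⟩ := hz'
        obtain ⟨s, t, rfl⟩ := List.append_of_mem hp
        have hst : s ++ t ≠ [] := fun e => by
          simp only [List.append_eq_nil_iff] at e
          obtain ⟨rfl, rfl⟩ := e
          simp only [List.nil_append, List.mem_singleton] at hq
          exact hq0 (by rw [hq])
        have hlen : (s ++ t).length < (s ++ (0, b) :: t).length := by simp
        obtain ⟨k, h1, h2, h3⟩ := exists_isNF (s ++ t) hst fun p hp => hb p (by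
          simp only [List.mem_append, List.mem_cons] at hp ⊢; tauto)
        refine ⟨k, ((Better.lin_perm List.perm_middle).trans ?_).trans h1, h2, fun p hp => ?_⟩
        · rw [lin_cons _ hst, tm_of_ne b scal_one_ne_zero.symm]
          exact (Better.add_comm _ _).trans (.add_null _ _)
        · have := h3 p hp
          simp only [List.map_append, List.mem_append, List.map_cons, List.mem_cons] at this ⊢
          tauto
    · push Not at hz
      exact ⟨l, .refl _, ⟨hl, hn, .inl hz, hb⟩, fun p hp => List.mem_map_of_mem hp⟩
  · obtain ⟨a, c, b, k, hk⟩ := exists_perm_of_not_nodup hn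
    have hlen : ((a + c, b) :: k).length < l.length := by rw [hk.length_eq]; simp
    obtain ⟨k', h1, h2, h3⟩ := exists_isNF ((a + c, b) :: k) (by simp) fun p hp => by
      rcases List.mem_cons.1 hp with rfl | hp
      · exact hb (a, b) (hk.mem_iff.2 (by simp))
      · exact hb p (hk.mem_iff.2 (by simp [hp]))
    refine ⟨k', ((Better.lin_perm hk).trans ?_).trans h1, h2, fun p hp => ?_⟩
    · by_cases h : k = []
      · subst h; exact .merge _ _ _
      · rw [lin_cons _ (by simp), lin_cons _ h, lin_cons _ h]
        exact ((Better.add_assoc_symm _ _ _).trans ((Better.merge a c b).add (.refl _)))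
    · have := h3 p hp
      rw [(hk.map Prod.snd).mem_iff]
      simp only [List.map_cons, List.mem_cons] at this ⊢
      tauto
termination_by l.length

end lin

/-! ### Algebraic forms -/

section
variable {f : Frag}

theorem isLin_tm (p : Scal f × Tm f) : IsLin [p] (tm p) := by
  obtain ⟨a, b⟩ := p
  by_cases h : a = 1
  · subst h; rw [tm_one]; exact .unit b
  · rw [tm_of_ne b h]; exact .smul a b

theorem isLin_lin {l : List (Scal f × Tm f)} (h : l ≠ []) : IsLin l (lin l) := by
  induction l with
  | nil => simp at h
  | cons p l ih =>
    by_cases hl : l = []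
    · subst hl; exact isLin_tm p
    · rw [lin_cons _ hl]; exact .add (isLin_tm p) (ih hl)

theorem isSum_lin_zero {l : List (Scal f × Tm f)} (h : l ≠ []) (hz : ∀ p ∈ l, p.1 = 0) :
    IsSum ((l.map Prod.snd).map fun b => smul 0 b) (lin l) := by
  induction l with
  | nil => simp at h
  | cons p l ih =>
    have hp : tm p = smul 0 p.2 := by
      obtain ⟨a, b⟩ := p
      obtain rfl : a = 0 := hz (a, b) (by simp)
      exact tm_of_ne b scal_one_ne_zero.symm
    by_cases hl : l = []
    · subst hl; simp only [List.map_cons, List.map_nil, lin, hp]; exact .single _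
    · rw [lin_cons _ hl, hp]
      exact IsSum.add (.single _) (ih hl fun q hq => hz q (by simp [hq]))

theorem IsNF.isAlg {l : List (Scal f × Tm f)} (h : IsNF l) : IsAlg (lin l) := by
  rcases h.coef with hz | hz
  · exact .comb l (isLin_lin h.ne_nil) h.nodup hz h.base
  · refine .null _ (isSum_lin_zero h.ne_nil hz) h.nodup fun b hb => ?_
    obtain ⟨p, hp, rfl⟩ := List.mem_map.1 hb
    exact h.base p hp

theorem isNF_singleton {b : Tm f} (hb : IsBase b) : IsNF [((1 : Scal f), b)] where
  ne_nil := by simp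
  nodup := by simp
  coef := .inl fun p hp => by simp only [List.mem_singleton] at hp; rw [hp]; exact scal_one_ne_zero
  base p hp := by simp only [List.mem_singleton] at hp; rw [hp]; exact hb

theorem exists_nf_of_base {M b : Tm f} (h : Better M b) (hb : IsBase b) :
    ∃ l, Better M (lin l) ∧ IsNF l :=
  ⟨[(1, b)], by simpa [lin] using h, isNF_singleton hb⟩

/-- Every term improves to an algebraic form. -/
theorem exists_nf (M : Tm f) : ∃ l, Better M (lin l) ∧ IsNF l := by
  induction M with
  | var n => exact exists_nf_of_base (.refl _) (.var n)
  | add m n ih ih' =>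
    obtain ⟨⟨l, h1, h2⟩, ⟨k, h3, h4⟩⟩ := And.intro ih ih'
    obtain ⟨j, h5, h6, -⟩ := exists_isNF (l ++ k) (by simp [h2.ne_nil]) fun p hp =>
      (List.mem_append.1 hp).elim (h2.base p) (h4.base p)
    exact ⟨j, ((h1.add h3).trans (.lin_append h2.ne_nil h4.ne_nil)).trans h5, h6⟩
  | smul a m ih =>
    obtain ⟨l, h1, h2⟩ := ih
    obtain ⟨j, h5, h6, -⟩ := exists_isNF (l.map fun p => (a * p.1, p.2)) (by simp [h2.ne_nil])
      fun p hp => by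
        obtain ⟨q, hq, rfl⟩ := List.mem_map.1 hp
        exact h2.base q hq
    exact ⟨j, ((h1.smul a).trans (.lin_smul a h2.ne_nil)).trans h5, h6⟩
  | star => exact exists_nf_of_base (.refl _) .star
  | elimOne m n ih ih' =>
    obtain ⟨⟨l, h1, h2⟩, ⟨k, h3, h4⟩⟩ := And.intro ih ih'
    exact exists_nf_of_base (h1.elimOne h3) (.elimOne h2.isAlg h4.isAlg)
  | lam m ih =>
    obtain ⟨l, h1, h2⟩ := ih
    exact exists_nf_of_base h1.lam (.lam h2.isAlg)
  | app m n ih ih' =>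
    obtain ⟨⟨l, h1, h2⟩, ⟨k, h3, h4⟩⟩ := And.intro ih ih'
    exact exists_nf_of_base (h1.app h3) (.app h2.isAlg h4.isAlg)
  | tens m n ih ih' =>
    obtain ⟨⟨l, h1, h2⟩, ⟨k, h3, h4⟩⟩ := And.intro ih ih'
    obtain ⟨j, h5, h6, -⟩ := exists_isNF
      (l.flatMap fun p => k.map fun q => (p.1 * q.1, tens p.2 q.2))
      (fun e => by
        rw [List.flatMap_eq_nil_iff] at e
        obtain ⟨q, hq⟩ := List.exists_mem_of_ne_nil l h2.ne_nil
        exact h4.ne_nil (List.map_eq_nil_iff.1 (e q hq)))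
      fun p hp => by
        obtain ⟨q, hq, hp⟩ := List.mem_flatMap.1 hp
        obtain ⟨r, hr, rfl⟩ := List.mem_map.1 hp
        exact .tens (h2.base q hq) (h4.base r hr)
    exact ⟨j, ((h1.tens h3).trans (.lin_tens_lin h2.ne_nil h4.ne_nil)).trans h5, h6⟩
  | elimTens m n ih ih' =>
    obtain ⟨⟨l, h1, h2⟩, ⟨k, h3, h4⟩⟩ := And.intro ih ih'
    exact exists_nf_of_base (h1.elimTens h3) (.elimTens h2.isAlg h4.isAlg)
  | topI => exact exists_nf_of_base (.refl _) .topI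
  | pair m n ih ih' =>
    obtain ⟨⟨l, h1, h2⟩, ⟨k, h3, h4⟩⟩ := And.intro ih ih'
    exact exists_nf_of_base (h1.pair h3) (.pair h2.isAlg h4.isAlg)
  | elimFst m n ih ih' =>
    obtain ⟨⟨l, h1, h2⟩, ⟨k, h3, h4⟩⟩ := And.intro ih ih'
    exact exists_nf_of_base (h1.elimFst h3) (.elimFst h2.isAlg h4.isAlg)
  | elimSnd m n ih ih' =>
    obtain ⟨⟨l, h1, h2⟩, ⟨k, h3, h4⟩⟩ := And.intro ih ih'
    exact exists_nf_of_base (h1.elimSnd h3) (.elimSnd h2.isAlg h4.isAlg)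
  | elimZero m ih =>
    obtain ⟨l, h1, h2⟩ := ih
    exact exists_nf_of_base h1.elimZero (.elimZero h2.isAlg)
  | inl m ih =>
    obtain ⟨l, h1, h2⟩ := ih
    exact exists_nf_of_base h1.inl (.inl h2.isAlg)
  | inr m ih =>
    obtain ⟨l, h1, h2⟩ := ih
    exact exists_nf_of_base h1.inr (.inr h2.isAlg)
  | elimPlus m n o ih ih' ih'' =>
    obtain ⟨⟨l, h1, h2⟩, ⟨k, h3, h4⟩, ⟨j, h5, h6⟩⟩ := And.intro ih (And.intro ih' ih'')
    exact exists_nf_of_base (h1.elimPlus h3 h5) (.elimPlus h2.isAlg h4.isAlg h6.isAlg)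
  | bang m ih =>
    obtain ⟨l, h1, h2⟩ := ih
    exact exists_nf_of_base h1.bang (.bang h2.isAlg)
  | tau m ih =>
    obtain ⟨l, h1, h2⟩ := ih
    exact exists_nf_of_base h1.tau (.tau h2.isAlg)

end

/-! ### Denotations of closed terms -/

/-- The closed term `M` has proposition `T` and denotes the vector `v`. -/
def CDen {f : Frag} (M : Tm f) (T : Ty f) (v : Vec) : Prop := Den [] M T fun _ => v

section CDen
variable {f : Frag} {M N : Tm f} {T : Ty f} {u v : Vec}

theorem Den.cden {d} (h : Den [] M T d) : CDen M T (d 0) := by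
  unfold CDen; convert h using 1; exact funext fun ρ => (h.eq_const ρ).symm

/-- Coherence for closed terms: the denotation is a function of the term and its proposition,
although the derivation is not unique. -/
theorem CDen.unique (h : CDen M T u) (h' : CDen M T v) : u = v :=
  Den.coherent h h' (suppEnv_nil 0)

theorem CDen.supp (h : CDen M T u) : Supp T u := Den.supp h (suppEnv_nil 0)

theorem not_cden_var {n : ℕ} : ¬ CDen (var n : Tm f) T u := fun h => by
  cases Den.hasType h with
  | ax h => cases h

theorem cden_add : CDen (add M N) T u ↔ ∃ v w, CDen M T v ∧ CDen N T w ∧ u = v + w := by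
  constructor
  · intro h
    unfold CDen at h
    generalize e : (fun _ => u) = d at h
    cases h with
    | sum h1 h2 => exact ⟨_, _, h1.cden, h2.cden, congrFun e 0⟩
  · rintro ⟨v, w, h1, h2, rfl⟩
    exact Den.sum h1 h2

theorem cden_smul {a : Scal f} : CDen (smul a M) T u ↔ ∃ v, CDen M T v ∧ u = sc a • v := by
  constructor
  · intro h
    unfold CDen at h
    generalize e : (fun _ => u) = d at h
    cases h with
    | prod _ h1 => exact ⟨_, h1.cden, congrFun e 0⟩
  · rintro ⟨v, h1, rfl⟩
    exact Den.prod a h1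

theorem cden_star : CDen (star : Tm f) T u ↔ T = .one ∧ u = vunit := by
  constructor
  · intro h
    unfold CDen at h
    generalize e : (fun _ => u) = d at h
    cases h with
    | oneI _ => exact ⟨rfl, congrFun e 0⟩
  · rintro ⟨rfl, rfl⟩
    exact Den.oneI Ctx.isEmpty_nil

theorem cden_elimOne :
    CDen (elimOne M N) T u ↔ ∃ v w, CDen M .one v ∧ CDen N T w ∧ u = v .unit • w := by
  constructor
  · intro h
    unfold CDen at h
    generalize e : (fun _ => u) = d at h
    cases h with
    | oneE hs h1 h2 =>
      obtain ⟨rfl, rfl⟩ := Ctx.split_nil hs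
      exact ⟨_, _, h1.cden, h2.cden, congrFun e 0⟩
  · rintro ⟨v, w, h1, h2, rfl⟩
    exact Den.oneE .nil h1 h2

theorem cden_lam : CDen (lam M) T u ↔ ∃ S S' d, T = .lolli S S' ∧ Den [some S] M S' d ∧
    u = vlam S fun v => d (econs v 0) := by
  constructor
  · intro h
    unfold CDen at h
    generalize e : (fun _ => u) = d at h
    cases h with
    | lolliI h1 => exact ⟨_, _, _, rfl, h1, congrFun e 0⟩
  · rintro ⟨S, S', d, rfl, h1, rfl⟩
    exact (Den.lolliI h1).cden

theorem CDen.app_lolli {S : Ty f} (h : CDen M (.lolli S T) u) (h' : CDen N S v) :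
    CDen (app M N) T (vapp S u v) := Den.lolliE .nil h h'

theorem CDen.app_bang {M N : Tm .mixed} {P Q : Ty .pure} (h : CDen M (.bang (.lolli P Q)) u)
    (h' : CDen N (.bang P) v) : CDen (app M N) (.bang Q) (vapp₂ P u v) := Den.bangE .nil h h'

/-- Application of modalities exists in the mixed fragment only, so that alternative carries an
equation of fragments along which terms and propositions are transported. -/
theorem CDen.of_app (h : CDen (app M N) T u) :
    (∃ S v w, CDen M (.lolli S T) v ∧ CDen N S w ∧ u = vapp S v w) ∨
    ∃ (e : f = .mixed) (P Q : Ty .pure) (v w : Vec), e ▸ T = Ty.bang Q ∧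
      CDen (e ▸ M) (.bang (.lolli P Q)) v ∧ CDen (e ▸ N) (.bang P) w ∧ u = vapp₂ P v w := by
  unfold CDen at h
  generalize e : (fun _ => u) = d at h
  cases h with
  | lolliE hs h1 h2 =>
    obtain ⟨rfl, rfl⟩ := Ctx.split_nil hs
    exact .inl ⟨_, _, _, h1.cden, h2.cden, congrFun e 0⟩
  | bangE hs h1 h2 =>
    obtain ⟨rfl, rfl⟩ := Ctx.split_nil hs
    exact .inr ⟨rfl, _, _, _, _, rfl, h1.cden, h2.cden, congrFun e 0⟩

theorem cden_tens : CDen (tens M N) T u ↔ ∃ S S' v w, T = .tensor S S' ∧ CDen M S v ∧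
    CDen N S' w ∧ u = vtens v w := by
  constructor
  · intro h
    unfold CDen at h
    generalize e : (fun _ => u) = d at h
    cases h with
    | tensorI hs h1 h2 =>
      obtain ⟨rfl, rfl⟩ := Ctx.split_nil hs
      exact ⟨_, _, _, _, rfl, h1.cden, h2.cden, congrFun e 0⟩
  · rintro ⟨S, S', v, w, rfl, h1, h2, rfl⟩
    exact Den.tensorI .nil h1 h2

theorem cden_elimTens : CDen (elimTens M N) T u ↔ ∃ S S' v d, CDen M (.tensor S S') v ∧
    Den [some S', some S] N T d ∧
    u = velim S S' v fun v w => d (econs w (econs v 0)) := by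
  constructor
  · intro h
    unfold CDen at h
    generalize e : (fun _ => u) = d at h
    cases h with
    | tensorE hs h1 h2 =>
      obtain ⟨rfl, rfl⟩ := Ctx.split_nil hs
      exact ⟨_, _, _, _, h1.cden, h2, congrFun e 0⟩
  · rintro ⟨S, S', v, d, h1, h2, rfl⟩
    exact (Den.tensorE .nil h1 h2).cden

theorem cden_topI {T : Ty .pure} : CDen topI T u ↔ T = .top ∧ u = 0 := by
  constructor
  · intro h
    unfold CDen at h
    generalize e : (fun _ => u) = d at h
    cases h with
    | topI _ => exact ⟨rfl, congrFun e 0⟩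
  · rintro ⟨rfl, rfl⟩
    exact Den.topI []

theorem cden_pair {M N : Tm .pure} {T : Ty .pure} : CDen (pair M N) T u ↔
    ∃ P Q v w, T = .conj P Q ∧ CDen M P v ∧ CDen N Q w ∧ u = vpair v w := by
  constructor
  · intro h
    unfold CDen at h
    generalize e : (fun _ => u) = d at h
    cases h with
    | conjI h1 h2 => exact ⟨_, _, _, _, rfl, h1.cden, h2.cden, congrFun e 0⟩
  · rintro ⟨S, S', v, w, rfl, h1, h2, rfl⟩
    exact Den.conjI h1 h2

theorem cden_elimFst {M N : Tm .pure} {T : Ty .pure} : CDen (elimFst M N) T u ↔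
    ∃ P Q v d, CDen M (.conj P Q) v ∧ Den [some P] N T d ∧ u = d (econs (vfst v) 0) := by
  constructor
  · intro h
    unfold CDen at h
    generalize e : (fun _ => u) = d at h
    cases h with
    | conjE₁ hs h1 h2 =>
      obtain ⟨rfl, rfl⟩ := Ctx.split_nil hs
      exact ⟨_, _, _, _, h1.cden, h2, congrFun e 0⟩
  · rintro ⟨P, Q, v, d, h1, h2, rfl⟩
    exact (Den.conjE₁ .nil h1 h2).cden

theorem cden_elimSnd {M N : Tm .pure} {T : Ty .pure} : CDen (elimSnd M N) T u ↔
    ∃ P Q v d, CDen M (.conj P Q) v ∧ Den [some Q] N T d ∧ u = d (econs (vsnd v) 0) := by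
  constructor
  · intro h
    unfold CDen at h
    generalize e : (fun _ => u) = d at h
    cases h with
    | conjE₂ hs h1 h2 =>
      obtain ⟨rfl, rfl⟩ := Ctx.split_nil hs
      exact ⟨_, _, _, _, h1.cden, h2, congrFun e 0⟩
  · rintro ⟨P, Q, v, d, h1, h2, rfl⟩
    exact (Den.conjE₂ .nil h1 h2).cden

theorem cden_elimZero {M : Tm .mixed} {T : Ty .mixed} :
    CDen (elimZero M) T u ↔ (∃ v, CDen M .zero v) ∧ u = 0 := by
  constructor
  · intro h
    unfold CDen at h
    generalize e : (fun _ => u) = d at h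
    cases h with
    | zeroE _ hs h1 =>
      obtain ⟨rfl, rfl⟩ := Ctx.split_nil hs
      exact ⟨⟨_, h1.cden⟩, congrFun e 0⟩
  · rintro ⟨⟨v, h1⟩, rfl⟩
    exact Den.zeroE T .nil h1

theorem cden_inl {M : Tm .mixed} {T : Ty .mixed} :
    CDen (inl M) T u ↔ ∃ A B v, T = .plus A B ∧ CDen M A v ∧ u = vpair v 0 := by
  constructor
  · intro h
    unfold CDen at h
    generalize e : (fun _ => u) = d at h
    cases h with
    | plusI₁ _ h1 => exact ⟨_, _, _, rfl, h1.cden, congrFun e 0⟩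
  · rintro ⟨A, B, v, rfl, h1, rfl⟩
    exact Den.plusI₁ B h1

theorem cden_inr {M : Tm .mixed} {T : Ty .mixed} :
    CDen (inr M) T u ↔ ∃ A B v, T = .plus A B ∧ CDen M B v ∧ u = vpair 0 v := by
  constructor
  · intro h
    unfold CDen at h
    generalize e : (fun _ => u) = d at h
    cases h with
    | plusI₂ _ h1 => exact ⟨_, _, _, rfl, h1.cden, congrFun e 0⟩
  · rintro ⟨A, B, v, rfl, h1, rfl⟩
    exact Den.plusI₂ A h1

theorem cden_elimPlus {M N O : Tm .mixed} {T : Ty .mixed} : CDen (elimPlus M N O) T u ↔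
    ∃ A B v d d', CDen M (.plus A B) v ∧ Den [some A] N T d ∧ Den [some B] O T d' ∧
      u = d (econs (vfst v) 0) + d' (econs (vsnd v) 0) := by
  constructor
  · intro h
    unfold CDen at h
    generalize e : (fun _ => u) = d at h
    cases h with
    | plusE hs h1 h2 h3 =>
      obtain ⟨rfl, rfl⟩ := Ctx.split_nil hs
      exact ⟨_, _, _, _, _, h1.cden, h2, h3, congrFun e 0⟩
  · rintro ⟨A, B, v, d, d', h1, h2, h3, rfl⟩
    exact (Den.plusE .nil h1 h2 h3).cden

theorem cden_bang {M : Tm .pure} {T : Ty .mixed} :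
    CDen (bang M) T u ↔ ∃ P v, T = .bang P ∧ CDen M P v ∧ u = vtens v (vconj v) := by
  constructor
  · intro h
    unfold CDen at h
    generalize e : (fun _ => u) = d at h
    cases h with
    | bangI _ h1 => exact ⟨_, _, rfl, h1.cden, congrFun e 0⟩
  · rintro ⟨P, v, rfl, h1, rfl⟩
    exact Den.bangI Ctx.isEmpty_nil h1

theorem cden_tau {M : Tm .mixed} {T : Ty .mixed} : CDen (tau M) T u ↔
    ∃ P Q v, T = .bang (.tensor P Q) ∧ CDen M (.tensor (.bang P) (.bang Q)) v ∧ u = vtau v := by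
  constructor
  · intro h
    unfold CDen at h
    generalize e : (fun _ => u) = d at h
    cases h with
    | tau h1 => exact ⟨_, _, _, rfl, h1.cden, congrFun e 0⟩
  · rintro ⟨P, Q, v, rfl, h1, rfl⟩
    exact Den.tau h1

theorem Better.cden (h : Better M N) (hM : CDen M T u) : CDen N T u := by
  obtain ⟨d, h1, h2⟩ := h.sem hM
  have := h1.cden
  rwa [h2 0 (suppEnv_nil 0)] at this

/-- Substitution of a closed term for the only variable. -/
theorem Den.inst {S : Ty f} {d} (h : Den [some S] M T d) (hN : CDen N S v) :
    CDen (inst N M) T (d (econs v 0)) ∧ wt (inst N M) ≤ wt M * wt N := by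
  have := h.subst (Γ := []) (Θ := [some S]) rfl (s := scons N var) (σ := econs v 0)
    fun j S' hj => by
      cases j with
      | zero => obtain rfl : S = S' := by simpa using hj
                exact hN
      | succ j => simp at hj
  refine ⟨this.1, this.2.trans (le_of_eq ?_)⟩
  simp [Ctx.wprod, scons]

theorem Den.inst₂ {S S' : Ty f} {V W : Tm f} {d} (h : Den [some S', some S] M T d)
    (hV : CDen V S v) (hW : CDen W S' u) :
    CDen (inst₂ V W M) T (d (econs u (econs v 0))) ∧ wt (inst₂ V W M) ≤ wt M * (wt V * wt W) := by
  have := h.subst (Γ := []) (Θ := [some S', some S]) rfl (s := scons W (scons V var))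
    (σ := econs u (econs v 0)) fun j S' hj => by
      rcases j with _ | _ | j
      · obtain rfl := by simpa using hj
        exact hW
      · obtain rfl := by simpa using hj
        exact hV
      · simp at hj
  refine ⟨this.1, this.2.trans (le_of_eq ?_)⟩
  simp [Ctx.wprod, scons, mul_comm]

/-! ### Linear combinations of closed terms -/

theorem IsLin.ne_nil {l : List (Scal f × Tm f)} {s : Tm f} (h : IsLin l s) : l ≠ [] := by
  induction h <;> simp_all

/-- The vectors depend on the summand as a term and not on its occurrence. Such a choice is
consistent, even for repeated summands, by uniqueness of closed denotations; this is why the formula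
for `u` is first proved for every admissible `g`. -/
theorem IsLin.exists_cden {l : List (Scal f × Tm f)} {s : Tm f} (h : IsLin l s) {u : Vec}
    (hs : CDen s T u) : ∃ g : Tm f → Vec, (∀ p ∈ l, CDen p.2 T (g p.2)) ∧
      u = (l.map fun p => sc p.1 • g p.2).sum := by
  classical
  suffices H : (∀ p ∈ l, ∃ v, CDen p.2 T v) ∧ ∀ g : Tm f → Vec, (∀ p ∈ l, CDen p.2 T (g p.2)) →
      u = (l.map fun p => sc p.1 • g p.2).sum by
    let g : Tm f → Vec := fun M => if h : ∃ v, CDen M T v then h.choose else 0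
    have hg : ∀ p ∈ l, CDen p.2 T (g p.2) := fun p hp => by
      simp only [g, H.1 p hp, dif_pos]; exact (H.1 p hp).choose_spec
    exact ⟨g, hg, H.2 g hg⟩
  induction h generalizing u with
  | unit t =>
    refine ⟨fun p hp => ?_, fun g hg => ?_⟩
    · simp only [List.mem_singleton] at hp; subst hp; exact ⟨u, hs⟩
    · simpa using hs.unique (hg (1, t) (by simp))
  | smul a t =>
    obtain ⟨v, hv, rfl⟩ := cden_smul.1 hs
    refine ⟨fun p hp => ?_, fun g hg => ?_⟩
    · simp only [List.mem_singleton] at hp; subst hp; exact ⟨v, hv⟩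
    · simp [hv.unique (hg (a, t) (by simp))]
  | add _ _ ih ih' =>
    obtain ⟨v, w, hv, hw, rfl⟩ := cden_add.1 hs
    refine ⟨fun p hp => ?_, fun g hg => ?_⟩
    · exact (List.mem_append.1 hp).elim ((ih hv).1 p) ((ih' hw).1 p)
    · rw [List.map_append, List.sum_append,
        (ih hv).2 g fun p hp => hg p (List.mem_append_left _ hp),
        (ih' hw).2 g fun p hp => hg p (List.mem_append_right _ hp)]

theorem IsSum.den {ι : Type} {l : List ι} {a : ι → Scal f} {F : ι → Tm f} {t : Tm f}
    (h : IsSum (l.map fun p => smul (a p) (F p)) t) {Γ : Ctx f} {g : ι → (ℕ → Vec) → Vec}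
    (hg : ∀ p ∈ l, Den Γ (F p) T (g p)) :
    Den Γ t T fun ρ => (l.map fun p => sc (a p) • g p ρ).sum := by
  generalize e : l.map (fun p => Tm.smul (a p) (F p)) = k at h
  induction h generalizing l with
  | single t =>
    obtain ⟨p, rfl⟩ := List.length_eq_one_iff.1 (by simpa using congrArg List.length e)
    simp only [List.map_cons, List.map_nil, List.cons.injEq, and_true] at e
    subst e
    simpa using Den.prod (a p) (hg p (by simp))
  | add _ _ ih ih' =>
    obtain ⟨l₁, l₂, rfl, e1, e2⟩ := List.map_eq_append_iff.1 e
    simpa using (ih (fun p hp => hg p (List.mem_append_left _ hp)) e1).sum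
      (ih' (fun p hp => hg p (List.mem_append_right _ hp)) e2)

theorem IsSum.cden {ι : Type} {l : List ι} {a : ι → Scal f} {F : ι → Tm f} {t : Tm f}
    (h : IsSum (l.map fun p => smul (a p) (F p)) t) {g : ι → Vec}
    (hg : ∀ p ∈ l, CDen (F p) T (g p)) : CDen t T (l.map fun p => sc (a p) • g p).sum :=
  h.den (g := fun p _ => g p) hg

theorem map_list_sum {ι : Type} (φ : Vec → Vec)
    (hφ : ∀ (a b : ℂ) (v w : Vec), φ (a • v + b • w) = a • φ v + b • φ w) (l : List ι) (a : ι → ℂ)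
    (g : ι → Vec) : φ (l.map fun p => a p • g p).sum = (l.map fun p => a p • φ (g p)).sum := by
  induction l with
  | nil => simpa using hφ 0 0 0 0
  | cons p l ih => simpa [ih] using hφ (a p) 1 (g p) (l.map fun p => a p • g p).sum

theorem vlam_list_sum {ι : Type} (S : Ty f) (l : List ι) (a : ι → ℂ) (g : ι → Vec → Vec) :
    vlam S (fun v => (l.map fun p => a p • g p v).sum) =
      (l.map fun p => a p • vlam S (g p)).sum := by
  induction l with
  | nil => simpa using vlam_lin S 0 0 (g := fun _ => 0) (g' := fun _ => 0) (h := fun _ => 0) fun i => by simp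
  | cons p l ih =>
    have := vlam_lin S (a p) 1 (g := g p) (g' := fun v => (l.map fun p => a p • g p v).sum)
      (h := fun v => ((p :: l).map fun p => a p • g p v).sum) fun i => by simp
    simpa [ih] using this

end CDen

/-! ### Reduction preserves denotations and decreases the measure -/

/-- The measure decreases from `M` to `N`. -/
def Drop {f : Frag} (M N : Tm f) : Prop :=
  -- At equal weight, one of the potentials drops while the outward one does not grow. The last
  -- clause concerns a term that becomes a combination by reducing: an enclosing constructor may
  -- then have a new combination to move out, and the loss of outward potential has to cover its
  -- weight.
  wt N < wt M ∨ wt N = wt M ∧ outw N ≤ outw M ∧ (outw N < outw M ∨ inw N < inw M) ∧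
    (comb N = true → comb M = true ∨ outw N + wt N ≤ outw M)

-- Measures of sums and linear combinations

section sums
variable {f : Frag} {ι : Type} {l : List ι} {a : ι → Scal f} {F : ι → Tm f} {t : Tm f}

theorem IsSum.measure (h : IsSum (l.map fun p => smul (a p) (F p)) t) :
    wt t = (l.map fun p => wt (F p)).sum ∧ outw t = (l.map fun p => outw (F p)).sum ∧
      inw t = (l.map fun p => inw (F p)).sum + (l.map fun p => wt (F p)).sum ∧ comb t = true := by
  generalize e : l.map (fun p => Tm.smul (a p) (F p)) = k at h
  induction h generalizing l with
  | single t =>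
    obtain ⟨p, rfl⟩ := List.length_eq_one_iff.1 (by simpa using congrArg List.length e)
    simp only [List.map_cons, List.map_nil, List.cons.injEq, and_true] at e
    subst e
    simp [wt, outw, inw, comb]
  | add _ _ ih ih' =>
    obtain ⟨l₁, l₂, rfl, e1, e2⟩ := List.map_eq_append_iff.1 e
    obtain ⟨h1, h2, h3, -⟩ := ih e1
    obtain ⟨h4, h5, h6, -⟩ := ih' e2
    simp only [wt, outw, inw, comb, List.map_append, List.sum_append]
    refine ⟨by omega, by omega, by omega, trivial⟩

theorem IsLin.measure {l : List (Scal f × Tm f)} (h : IsLin l t) :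
    wt t = (l.map fun p => wt p.2).sum ∧ outw t = (l.map fun p => outw p.2).sum ∧
      (l.map fun p => inw p.2).sum ≤ inw t := by
  induction h with
  | unit t => simp
  | smul a t => simp [wt, outw, inw]
  | add _ _ ih ih' =>
    obtain ⟨a1, a2, a3⟩ := ih
    obtain ⟨b1, b2, b3⟩ := ih'
    simp only [wt, outw, inw, List.map_append, List.sum_append]
    exact ⟨by omega, by omega, by omega⟩

theorem IsComb.comb_eq (h : IsComb t) : comb t = true := by cases h <;> rfl

/-- The two cases in which a combination of abstractions or pairs commutes inwards: with at least
two summands the weight drops, and with a single scaled one the inward potential does. -/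
theorem IsLin.eq_smul_or_two_le {l : List (Scal f × Tm f)} (h : IsLin l t) (hc : IsComb t)
    (hl : ∀ p ∈ l, ¬ IsComb p.2) : 2 ≤ l.length ∨ ∃ a b, l = [(a, b)] ∧ t = Tm.smul a b := by
  cases h with
  | unit t => exact absurd hc (hl (1, t) (by simp))
  | smul a t => exact .inr ⟨a, t, rfl, rfl⟩
  | add h1 h2 =>
    have := List.length_pos_of_ne_nil h1.ne_nil
    have := List.length_pos_of_ne_nil h2.ne_nil
    exact .inl (by rw [List.length_append]; omega)

end sums

mutual

theorem IsVb.comb_eq : {f : Frag} → {v : Tm f} → IsVb v → comb v = false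
  | _, _, .star => rfl
  | _, _, .var _ => rfl
  | _, _, .tens hv hw => by simp [comb, IsVn.comb_eq hv, IsVn.comb_eq hw]
  | _, _, .inl _ => rfl
  | _, _, .inr _ => rfl
  | _, _, .bang _ => rfl

theorem IsVn.comb_eq : {f : Frag} → {v : Tm f} → IsVn v → comb v = false
  | _, _, .topI => rfl
  | _, _, .lam _ => rfl
  | _, _, .pair _ _ => rfl
  | _, _, .vb hv => IsVb.comb_eq hv

end

section Drop
variable {f : Frag} {M M' : Tm f}

/-- The one delicate case is a combination that has just become visible. Then `o' + w' ≤ o`, so `2 *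
o' + w' < 2 * o` because `w'` is positive; this is what the doubling in `outc` is for. -/
theorem outc_lt_of_drop {c w w' : ℕ} {o o' : ℕ} {b b' : Bool} (hc : 0 < c) (hw : w' = w) (hw0 : 0 < w')
    (ho : o' ≤ o) (hb : b' = true → b = true ∨ o' + w' ≤ o) :
    outc c o' w' b' ≤ outc c o w b ∧ (o' < o → outc c o' w' b' < outc c o w b) := by
  subst hw
  unfold outc
  refine ⟨Nat.mul_le_mul_left _ ?_, fun h => Nat.mul_lt_mul_of_pos_left ?_ hc⟩ <;>
  · cases b' <;> cases b <;> simp_all <;> omega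

/-- A context that multiplies the weight, adds to the potentials, and does not expose
combinations. -/
theorem Drop.frame {N N' : Tm f} (h : Drop M M') {c e k k' : ℕ} (hc : 0 < c)
    (hw : wt N = c * wt M + e) (hw' : wt N' = c * wt M' + e)
    (ho : outw N = outw M + k) (ho' : outw N' = outw M' + k)
    (hi : inw N = inw M + k') (hi' : inw N' = inw M' + k') (hb : comb N' = false) :
    Drop N N' := by
  rcases h with h | ⟨h1, h2, h3, h4⟩
  · exact .inl (by rw [hw, hw']; exact Nat.add_lt_add_right (Nat.mul_lt_mul_of_pos_left h hc) _)
  · exact .inr ⟨by rw [hw, hw', h1], by omega, by omega, by simp [hb]⟩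

/-- A context out of which combinations commute. -/
theorem Drop.frame_outc {g : Frag} {N N' : Tm g} (h : Drop M M') {c c' : ℕ} (hc : 0 < c) (hc' : 0 < c')
    (hw : wt N = c * wt M) (hw' : wt N' = c * wt M')
    (ho : outw N = outc c' (outw M) (wt M) (comb M))
    (ho' : outw N' = outc c' (outw M') (wt M') (comb M'))
    (hi : inw N = inw M) (hi' : inw N' = inw M') (hb : comb N' = false) :
    Drop N N' := by
  rcases h with h | ⟨h1, h2, h3, h4⟩
  · exact .inl (by rw [hw, hw']; exact Nat.mul_lt_mul_of_pos_left h hc)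
  · obtain ⟨a, b⟩ := outc_lt_of_drop hc' h1 (wt_pos _) h2 h4
    exact .inr ⟨by rw [hw, hw', h1], by omega, by rcases h3 with h3 | h3 <;> [have := b h3; skip] <;> omega,
      by simp [hb]⟩

theorem Drop.add (h : Drop M M') (N : Tm f) : Drop (add M N) (add M' N) := by
  rcases h with h | ⟨h1, h2, h3, h4⟩
  · exact .inl (by simp only [wt]; omega)
  · exact .inr (by simp only [wt, outw, inw, comb]; refine ⟨by omega, by omega, by omega, by simp⟩)

theorem Drop.smul (h : Drop M M') (a : Scal f) : Drop (smul a M) (smul a M') := by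
  rcases h with h | ⟨h1, h2, h3, h4⟩
  · exact .inl h
  · exact .inr (by simp only [wt, outw, inw, comb]; refine ⟨by omega, by omega, by omega, by simp⟩)

theorem Drop.tens_left (h : Drop M M') (N : Tm f) : Drop (tens M N) (tens M' N) := by
  have hp := wt_pos N
  rcases h with h | ⟨h1, h2, h3, h4⟩
  · exact .inl (Nat.mul_lt_mul_of_pos_right h hp)
  · refine .inr ⟨by simp only [wt, h1], ?_, ?_, ?_⟩ <;> simp only [wt, outw, inw, comb, h1]
    · exact Nat.add_le_add_right (Nat.mul_le_mul_right _ h2) _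
    · exact h3.imp (fun h3 => Nat.add_lt_add_right (Nat.mul_lt_mul_of_pos_right h3 hp) _)
        fun h3 => Nat.add_lt_add_right (Nat.mul_lt_mul_of_pos_right h3 hp) _
    · intro hc
      rcases Bool.or_eq_true_iff.1 hc with hc | hc
      · rcases h4 hc with h4 | h4
        · exact .inl (by simp [h4])
        · have := Nat.mul_le_mul_right (wt N) h4
          exact .inr (by rw [h1] at this; linarith)
      · exact .inl (by simp [hc])

theorem Drop.tens_right (h : Drop M M') (N : Tm f) : Drop (tens N M) (tens N M') := by
  have hp := wt_pos N
  rcases h with h | ⟨h1, h2, h3, h4⟩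
  · exact .inl (Nat.mul_lt_mul_of_pos_left h hp)
  · refine .inr ⟨by simp only [wt, h1], ?_, ?_, ?_⟩ <;> simp only [wt, outw, inw, comb, h1]
    · exact Nat.add_le_add_left (Nat.mul_le_mul_left _ h2) _
    · exact h3.imp (fun h3 => Nat.add_lt_add_left (Nat.mul_lt_mul_of_pos_left h3 hp) _)
        fun h3 => Nat.add_lt_add_left (Nat.mul_lt_mul_of_pos_left h3 hp) _
    · intro hc
      rcases Bool.or_eq_true_iff.1 hc with hc | hc
      · exact .inl (by simp [hc])
      · rcases h4 hc with h4 | h4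
        · exact .inl (by simp [h4])
        · have := Nat.mul_le_mul_left (wt N) h4
          exact .inr (by rw [h1] at this; linarith)

end Drop

theorem sum_eq_of_mem {ι : Type} {l : List ι} {p q : ι → ℕ} (h : ∀ x ∈ l, p x = q x) :
    (l.map p).sum = (l.map q).sum := by rw [List.map_congr_left h]

/-- A combination of values `v_b` moves out of a constructor. -/
theorem drop_comm {f g : Frag} {l : List (Scal f × Tm f)} {s : Tm f} {M t : Tm g}
    {a : Scal f × Tm f → Scal g} {F : Tm f → Tm g} {c c' : ℕ} (hc' : 0 < c')
    (hs : IsLin l s) (hc : IsComb s) (hv : ∀ p ∈ l, IsVb p.2)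
    (ht : IsSum (l.map fun p => smul (a p) (F p.2)) t)
    (hw : wt M = c * wt s) (hF : ∀ v, wt (F v) = c * wt v)
    (ho : outw M = outc c' (outw s) (wt s) (comb s))
    (hoF : ∀ v, outw (F v) = outc c' (outw v) (wt v) (comb v)) (hcc : c ≤ c') : Drop M t := by
  obtain ⟨a1, a2, -⟩ := hs.measure
  obtain ⟨b1, b2, -, -⟩ := ht.measure
  have h1 : wt t = wt M := by
    rw [b1, hw, a1, ← List.sum_map_mul_left]; exact sum_eq_of_mem fun p _ => hF _
  have h2 : outw t = c' * (2 * outw s) := by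
    rw [b2, a2, ← mul_assoc, ← List.sum_map_mul_left]
    exact sum_eq_of_mem fun p hp => by rw [hoF, outc, (hv p hp).comb_eq]; simp [mul_assoc]
  have h3 : outw M = outw t + c' * wt s := by
    rw [ho, outc, hc.comb_eq, h2]; simp [mul_add]
  have h4 : 0 < c' * wt s := Nat.mul_pos hc' (wt_pos s)
  -- The result is a combination itself, so the potential lost, `c' * wt s`, must also cover its
  -- weight; hence the requirement `c ≤ c'`.
  have h5 : wt M ≤ c' * wt s := by rw [hw]; exact Nat.mul_le_mul_right _ hcc
  exact .inr ⟨h1, by omega, .inl (by omega), fun _ => .inr (by omega)⟩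

theorem Den.econs_lin {f : Frag} {Γ : Ctx f} {S T : Ty f} {M : Tm f} {d}
    (h : Den (some S :: Γ) M T d) (a b : ℂ) (v w : Vec) (ρ : ℕ → Vec) :
    d (econs (a • v + b • w) ρ) = a • d (econs v ρ) + b • d (econs w ρ) :=
  h.linear (Ctx.has_zero.2 rfl) (Mix.head _ a b v w ρ)

theorem vapp₂_list_sum {ι κ : Type} (P : Ty .pure) (l : List ι) (k : List κ) (a : ι → ℂ) (b : κ → ℂ)
    (g : ι → Vec) (h : κ → Vec) :
    vapp₂ P (l.map fun p => a p • g p).sum (k.map fun q => b q • h q).sum =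
      ((l.product k).map fun r => (a r.1 * b r.2) • vapp₂ P (g r.1) (h r.2)).sum := by
  rw [map_list_sum (fun v => vapp₂ P v _) (fun a b v w => vapp₂_lin_left P a b v w _)]
  induction l with
  | nil => simp [List.product]
  | cons p l ih =>
    rw [List.map_cons, List.sum_cons, ih, show (p :: l).product k = k.map (Prod.mk p) ++ l.product k
      from rfl, List.map_append, List.sum_append, map_list_sum (fun v => vapp₂ P _ v)
      (fun a b v w => vapp₂_lin_right P a b v w _), List.smul_sum, List.map_map, List.map_map]
    simp [Function.comp_def, mul_smul]

theorem sum_product_mul {ι κ : Type} (l : List ι) (k : List κ) (a : ι → ℕ) (b : κ → ℕ) :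
    ((l.product k).map fun r => a r.1 * b r.2).sum = (l.map a).sum * (k.map b).sum := by
  induction l with
  | nil => simp [List.product]
  | cons p l ih =>
    rw [show (p :: l).product k = k.map (Prod.mk p) ++ l.product k from rfl, List.map_append,
      List.sum_append, ih, List.map_map, List.map_cons, List.sum_cons, add_mul,
      ← List.sum_map_mul_left, ← List.sum_map_mul_left]
    rfl

/-- Reduction preserves typing and denotation of closed terms, and decreases the measure. -/
theorem Step.sound {f : Frag} {M N : Tm f} (h : Step M N) :
    ∀ {T : Ty f} {u : Vec}, CDen M T u → CDen N T u ∧ Drop M N := by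
  induction h with
  | @one f a s M hs =>
    intro T u h
    obtain ⟨v, w, h1, h2, rfl⟩ := cden_elimOne.1 h
    obtain ⟨g, h3, rfl⟩ := hs.exists_cden h1
    obtain ⟨-, h4⟩ := cden_star.1 (h3 (a, star) (by simp))
    refine ⟨cden_smul.2 ⟨w, h2, by simp [h4, vunit, bas]⟩, .inl ?_⟩
    have := hs.measure.1
    have := wt_pos M
    simp_all [wt]
  | @beta f M V hV =>
    intro T u h
    rcases h.of_app with ⟨S, v, w, h1, h2, rfl⟩ | ⟨e, P, Q, v, w, e1, h1, h2, rfl⟩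
    · obtain ⟨S', T', d, e, h3, rfl⟩ := cden_lam.1 h1
      cases e
      obtain ⟨h4, h5⟩ := h3.inst h2
      rw [h3.vapp_vlam 0 h2.supp]
      refine ⟨h4, .inl (h5.trans_lt ?_)⟩
      have := wt_pos V; have := wt_pos M
      simp only [wt]; nlinarith
    · cases e
      obtain ⟨_, _, _, e, -⟩ := cden_lam.1 h1
      cases e
  | @fst v w t hv hw =>
    intro T u h
    obtain ⟨P, Q, x, d, h1, h2, rfl⟩ := cden_elimFst.1 h
    obtain ⟨P', Q', y, z, e, h3, h4, rfl⟩ := cden_pair.1 h1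
    cases e
    obtain ⟨h5, h6⟩ := h2.inst h3
    refine ⟨h5, .inl (h6.trans_lt ?_)⟩
    have := wt_pos v; have := wt_pos w; have := wt_pos t
    simp only [wt]; nlinarith
  | @snd v w t hv hw =>
    intro T u h
    obtain ⟨P, Q, x, d, h1, h2, rfl⟩ := cden_elimSnd.1 h
    obtain ⟨P', Q', y, z, e, h3, h4, rfl⟩ := cden_pair.1 h1
    cases e
    obtain ⟨h5, h6⟩ := h2.inst h4
    refine ⟨h5, .inl (h6.trans_lt ?_)⟩
    have := wt_pos v; have := wt_pos w; have := wt_pos t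
    simp only [wt]; nlinarith
  | @caseInl v m n hv =>
    intro T u h
    obtain ⟨A, B, x, d, d', h1, h2, h3, rfl⟩ := cden_elimPlus.1 h
    obtain ⟨A', B', y, e, h4, rfl⟩ := cden_inl.1 h1
    cases e
    obtain ⟨h5, h6⟩ := h2.inst h4
    -- The branch not taken is evaluated at the zero vector and contributes nothing, being linear in
    -- its bound variable.
    have h7 : d' (econs (vsnd (vpair y 0)) 0) = 0 := by
      have h0 : vsnd (vpair y 0) = 0 := rfl
      rw [h0]; simpa using h3.econs_lin 0 0 0 0 0
    rw [h7, add_zero]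
    refine ⟨h5, .inl (h6.trans_lt ?_)⟩
    have := wt_pos v; have := wt_pos m; have := wt_pos n
    simp only [wt]; nlinarith
  | @caseInr v m n hv =>
    intro T u h
    obtain ⟨A, B, x, d, d', h1, h2, h3, rfl⟩ := cden_elimPlus.1 h
    obtain ⟨A', B', y, e, h4, rfl⟩ := cden_inr.1 h1
    cases e
    obtain ⟨h5, h6⟩ := h3.inst h4
    have h7 : d (econs (vfst (vpair 0 y)) 0) = 0 := by
      have h0 : vfst (vpair 0 y) = 0 := rfl
      rw [h0]; simpa using h2.econs_lin 0 0 0 0 0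
    rw [h7, zero_add]
    refine ⟨h5, .inl (h6.trans_lt ?_)⟩
    have := wt_pos v; have := wt_pos m; have := wt_pos n
    simp only [wt]; nlinarith
  | @tensor f V W M hV hW =>
    intro T u h
    obtain ⟨S, S', x, d, h1, h2, rfl⟩ := cden_elimTens.1 h
    obtain ⟨S, S', v, w, e, h3, h4, rfl⟩ := cden_tens.1 h1
    cases e
    obtain ⟨h5, h6⟩ := h2.inst₂ h3 h4
    rw [h2.velim_vtens 0 h3.supp h4.supp]
    refine ⟨h5, .inl (h6.trans_lt ?_)⟩
    have := Nat.mul_pos (wt_pos M) (Nat.mul_pos (wt_pos V) (wt_pos W))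
    simp only [wt]; nlinarith
  | commTop a =>
    intro T u h
    obtain ⟨v, h1, rfl⟩ := cden_smul.1 h
    obtain ⟨rfl, rfl⟩ := cden_topI.1 h1
    exact ⟨cden_topI.2 ⟨rfl, by simp⟩, .inr (by simp [wt, outw, inw, comb])⟩
  | @commLam f l s t hs hc hd ht =>
    intro T u h
    obtain ⟨g, h1, rfl⟩ := hs.exists_cden h
    -- All summands have the same proposition, so one of them determines `S` and `S'` for all.
    obtain ⟨p₀, hp₀⟩ := List.exists_mem_of_ne_nil l (by simpa using hs.ne_nil)
    obtain ⟨S, S', _, rfl, -⟩ := cden_lam.1 (h1 (p₀.1, lam p₀.2) (List.mem_map_of_mem hp₀))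
    have h2 : ∀ p ∈ l, ∃ d, Den [some S] p.2 S' d ∧ g (lam p.2) = vlam S fun v => d (econs v 0) := by
      intro p hp
      obtain ⟨_, _, d, e, h3, h4⟩ := cden_lam.1 (h1 (p.1, lam p.2) (List.mem_map_of_mem hp))
      cases e
      exact ⟨d, h3, h4⟩
    choose! d hd1 hd2 using h2
    refine ⟨cden_lam.2 ⟨S, S', _, rfl, ht.den hd1, ?_⟩, ?_⟩
    · rw [vlam_list_sum, List.map_map]
      congr 1
      exact List.map_congr_left fun p hp => by simp [hd2 p hp]
    · obtain ⟨a1, a2, a3⟩ := hs.measure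
      obtain ⟨b1, b2, b3, -⟩ := ht.measure
      rcases hs.eq_smul_or_two_le hc (fun p hp => by
        obtain ⟨q, -, rfl⟩ := List.mem_map.1 hp
        exact fun h => by cases h) with h2 | ⟨a, b, h2, rfl⟩
      · left
        have : (l.map fun p => wt (lam p.2)).sum = (l.map fun p => wt p.2).sum + l.length := by
          simp [wt, List.sum_map_add]
        simp only [List.map_map, Function.comp_def, List.length_map] at a1 h2
        simp only [wt]; omega
      · obtain ⟨p, rfl⟩ := List.length_eq_one_iff.1 (by simpa using congrArg List.length h2)
        simp only [List.map_cons, List.map_nil, List.cons.injEq, and_true, Prod.mk.injEq] at h2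
        obtain ⟨rfl, rfl⟩ := h2
        simp only [List.map_cons, List.map_nil, List.sum_cons, List.sum_nil, add_zero] at b1
        -- A single scaled abstraction keeps its weight. Only the inward potential falls, since it
        -- ignores everything below an abstraction.
        exact .inr ⟨by simp only [wt, b1], le_rfl, .inr (by simp [wt, inw]), by simp [comb]⟩
  | @commPair l s t u hs hc hd hv ht hu =>
    intro T x h
    obtain ⟨g, h1, rfl⟩ := hs.exists_cden h
    obtain ⟨p₀, hp₀⟩ := List.exists_mem_of_ne_nil l (by simpa using hs.ne_nil)
    obtain ⟨P, Q, _, _, rfl, -⟩ := cden_pair.1 (h1 (p₀.1, pair p₀.2.1 p₀.2.2)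
      (List.mem_map.2 ⟨p₀, hp₀, rfl⟩))
    have h2 : ∀ p ∈ l, ∃ v w, CDen p.2.1 P v ∧ CDen p.2.2 Q w ∧ g (pair p.2.1 p.2.2) = vpair v w := by
      intro p hp
      obtain ⟨_, _, v, w, e, h3, h4⟩ := cden_pair.1 (h1 (p.1, pair p.2.1 p.2.2)
        (List.mem_map.2 ⟨p, hp, rfl⟩))
      cases e
      exact ⟨v, w, h3, h4⟩
    choose! v w hv1 hw1 hvw using h2
    refine ⟨cden_pair.2 ⟨P, Q, _, _, rfl, ht.cden hv1, hu.cden hw1, ?_⟩, ?_⟩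
    · have : ∀ l : List (Scal .pure × (Tm .pure × Tm .pure)),
          vpair (l.map fun p => sc p.1 • v p).sum (l.map fun p => sc p.1 • w p).sum =
            (l.map fun p => sc p.1 • vpair (v p) (w p)).sum := by
        intro l
        induction l with
        | nil => simpa using vpair_lin 0 0 0 0 0 0
        | cons p l ih =>
          simpa [← ih] using vpair_lin (sc p.1) 1 (v p) (l.map fun p => sc p.1 • v p).sum (w p)
            (l.map fun p => sc p.1 • w p).sum
      rw [this, List.map_map]
      congr 1
      exact List.map_congr_left fun p hp => by simp [hvw p hp]
    · obtain ⟨a1, a2, a3⟩ := hs.measure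
      obtain ⟨b1, b2, b3, -⟩ := ht.measure
      obtain ⟨c1, c2, c3, -⟩ := hu.measure
      have e1 : (l.map fun p => wt (pair p.2.1 p.2.2)).sum =
          (l.map fun p => wt p.2.1).sum + (l.map fun p => wt p.2.2).sum + l.length := by
        simp [wt, List.sum_map_add]
      have e2 : (l.map fun p => outw (pair p.2.1 p.2.2)).sum =
          (l.map fun p => outw p.2.1).sum + (l.map fun p => outw p.2.2).sum := by
        simp [outw, List.sum_map_add]
      simp only [List.map_map, Function.comp_def] at a1 a2
      rcases hs.eq_smul_or_two_le hc (fun p hp => by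
        obtain ⟨q, -, rfl⟩ := List.mem_map.1 hp
        exact fun h => by cases h) with h2 | ⟨a, b, h2, rfl⟩
      · left
        simp only [List.length_map] at h2
        simp only [wt]; omega
      · obtain ⟨p, rfl⟩ := List.length_eq_one_iff.1 (by simpa using congrArg List.length h2)
        simp only [List.map_cons, List.map_nil, List.cons.injEq, and_true, Prod.mk.injEq] at h2
        obtain ⟨rfl, rfl⟩ := h2
        simp only [List.map_cons, List.map_nil, List.sum_cons, List.sum_nil, add_zero] at *
        refine .inr ⟨?_, ?_, .inr ?_, by simp [comb]⟩ <;> simp only [wt, outw, inw] at * <;> omega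
  | @commPlus l s t m n hs hc hd hv ht =>
    intro T u h
    obtain ⟨A, B, x, d, d', h1, h2, h3, rfl⟩ := cden_elimPlus.1 h
    obtain ⟨g, h4, rfl⟩ := hs.exists_cden h1
    refine ⟨?_, drop_comm (c := 2 * (wt m + wt n)) (c' := 2 * (wt m + wt n))
      (F := fun v => elimPlus v m n) (by have := wt_pos m; omega) hs hc hv ht (by simp only [wt]; ring)
      (fun v => by simp only [wt]; ring) rfl (fun _ => rfl) le_rfl⟩
    rw [map_list_sum (fun v => d (econs (vfst v) 0) + d' (econs (vsnd v) 0)) fun a b v w => by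
      rw [vfst_lin, vsnd_lin, h2.econs_lin, h3.econs_lin]; module]
    exact ht.cden fun p hp => cden_elimPlus.2 ⟨A, B, _, d, d', h4 p hp, h2, h3, rfl⟩
  | @commTens f l s t M hs hc hd hv ht =>
    intro T u h
    obtain ⟨S, S', x, d, h1, h2, rfl⟩ := cden_elimTens.1 h
    obtain ⟨g, h4, rfl⟩ := hs.exists_cden h1
    refine ⟨?_, drop_comm (c := 2 * wt M) (c' := 2 * wt M)
      (F := fun v => elimTens v M) (by have := wt_pos M; omega) hs hc hv ht (by simp only [wt]; ring)
      (fun v => by simp only [wt]; ring) rfl (fun _ => rfl) le_rfl⟩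
    rw [map_list_sum (fun v => velim S S' v _) fun a b v w => velim_lin_left _ _ _ _ _ _ _]
    exact ht.cden fun p hp => cden_elimTens.2 ⟨S, S', _, d, h4 p hp, h2, rfl⟩
  | @commInl l s t hs hc hd hv ht =>
    intro T u h
    obtain ⟨A, B, x, rfl, h1, rfl⟩ := cden_inl.1 h
    obtain ⟨g, h4, rfl⟩ := hs.exists_cden h1
    refine ⟨?_, drop_comm (c := 1) (c' := 1) (F := inl) one_pos hs hc hv ht (one_mul _).symm
      (fun v => (one_mul _).symm) rfl (fun _ => rfl) le_rfl⟩
    rw [map_list_sum (fun v => vpair v 0) fun a b v w => by rw [← vpair_lin]; simp]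
    exact ht.cden fun p hp => cden_inl.2 ⟨A, B, _, rfl, h4 p hp, rfl⟩
  | @commInr l s t hs hc hd hv ht =>
    intro T u h
    obtain ⟨A, B, x, rfl, h1, rfl⟩ := cden_inr.1 h
    obtain ⟨g, h4, rfl⟩ := hs.exists_cden h1
    refine ⟨?_, drop_comm (c := 1) (c' := 1) (F := inr) one_pos hs hc hv ht (one_mul _).symm
      (fun v => (one_mul _).symm) rfl (fun _ => rfl) le_rfl⟩
    rw [map_list_sum (fun v => vpair 0 v) fun a b v w => by rw [← vpair_lin]; simp]
    exact ht.cden fun p hp => cden_inr.2 ⟨A, B, _, rfl, h4 p hp, rfl⟩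
  | @cast v w hv hw =>
    intro T u h
    obtain ⟨P, Q, x, rfl, h1, rfl⟩ := cden_tau.1 h
    obtain ⟨_, _, y, z, e, h2, h3, rfl⟩ := cden_tens.1 h1
    cases e
    obtain ⟨_, y', e, h4, rfl⟩ := cden_bang.1 h2
    cases e
    obtain ⟨_, z', e, h5, rfl⟩ := cden_bang.1 h3
    cases e
    refine ⟨cden_bang.2 ⟨_, _, rfl, cden_tens.2 ⟨_, _, _, _, rfl, h4, h5, rfl⟩, vtau_vtens _ _ _ _⟩,
      .inl ?_⟩
    have := Nat.mul_pos (wt_pos v) (wt_pos w)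
    simp only [wt]; nlinarith
  | @commTau l s t hs hc hd hv ht =>
    intro T u h
    obtain ⟨P, Q, x, rfl, h1, rfl⟩ := cden_tau.1 h
    obtain ⟨g, h4, rfl⟩ := hs.exists_cden h1
    refine ⟨?_, drop_comm (c := 2) (c' := 2) (F := tau) two_pos hs hc hv ht rfl
      (fun v => rfl) rfl (fun _ => rfl) le_rfl⟩
    rw [map_list_sum vtau fun a b v w => vtau_lin _ _ _ _]
    exact ht.cden fun p hp => cden_tau.2 ⟨P, Q, _, rfl, h4 p hp, rfl⟩
  | @commBang a v ha hv =>
    intro T u h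
    obtain ⟨P, x, rfl, h1, rfl⟩ := cden_bang.1 h
    obtain ⟨y, h2, rfl⟩ := cden_smul.1 h1
    refine ⟨cden_smul.2 ⟨_, cden_bang.2 ⟨_, _, rfl, h2, rfl⟩, ?_⟩, .inr ?_⟩
    -- The scalar occurs once in the vector and once conjugated in the conjugate factor.
    · have h3 : sc (f := .mixed) (‖a‖₊ ^ 2) = a * starRingEnd ℂ a := by
        rw [Complex.mul_conj, Complex.normSq_eq_norm_sq]
        simp [sc]
      rw [h3]
      funext i
      cases i <;> simp [vtens, vconj, sc]
      ring
    -- The outward potential loses `2 * wt v`, which is exactly the weight of the resulting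
    -- multiple, as the last clause of `Drop` requires.
    · have := wt_pos v
      simp [wt, outw, inw, comb, outc, hv.comb_eq]; omega
  | @commBangApp l k s t u hs hdl hvl ht hdk hvk hu =>
    intro T x h
    rcases h.of_app with ⟨S, v, w, h1, h2, rfl⟩ | ⟨e, P, Q, v, w, e1, h1, h2, rfl⟩
    · obtain ⟨g, h3, rfl⟩ := hs.exists_cden h1
      obtain ⟨p₀, hp₀⟩ := List.exists_mem_of_ne_nil _ hs.ne_nil
      have := h3 p₀ hp₀
      obtain ⟨q, -, rfl⟩ := List.mem_map.1 hp₀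
      obtain ⟨_, _, e, -⟩ := cden_bang.1 this
      cases e
    · cases e; cases e1
      obtain ⟨g, h3, rfl⟩ := hs.exists_cden h1
      obtain ⟨g', h4, rfl⟩ := ht.exists_cden h2
      refine ⟨?_, .inl ?_⟩
      · rw [List.map_map, List.map_map]
        simp only [Function.comp_def]
        rw [vapp₂_list_sum]
        have := hu.cden (T := .bang Q) (g := fun r => vapp₂ P (g (bang r.1.2)) (g' (bang r.2.2)))
          fun r hr => by
            obtain ⟨h5, h6⟩ := List.pair_mem_product.1 hr
            obtain ⟨_, y, e, h7, h8⟩ := cden_bang.1 (h3 _ (List.mem_map_of_mem h5))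
            cases e
            obtain ⟨_, z, e, h9, h10⟩ := cden_bang.1 (h4 _ (List.mem_map_of_mem h6))
            cases e
            refine cden_bang.2 ⟨_, _, rfl, h7.app_lolli h9, ?_⟩
            rw [← vapp₂_vtens, ← h8, ← h10]
        have e : (fun r : (Scal .mixed × Tm .pure) × (Scal .mixed × Tm .pure) =>
            sc (r.1.1 * r.2.1) • vapp₂ P (g r.1.2.bang) (g' r.2.2.bang)) = fun r =>
            (sc r.1.1 * sc r.2.1) • vapp₂ P (g r.1.2.bang) (g' r.2.2.bang) :=
          funext fun r => by rw [sc_mul r.1.1 r.2.1]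
        rwa [e] at this
      · have a1 := hs.measure.1
        have a2 := ht.measure.1
        have a3 := hu.measure.1
        rw [List.map_map] at a1 a2
        -- Each product term weighs `2 * (2 * wt v * wt w)`, which is the product of the weights of
        -- `bang v` and `bang w`. The factor 2 of the application is thus what is lost.
        have a4 : wt u = wt s * wt t := by
          rw [a1, a2, a3, ← sum_product_mul]
          exact sum_eq_of_mem fun r _ => by simp only [Function.comp_def, wt]; ring
        have := Nat.mul_pos (wt_pos s) (wt_pos t)
        simp only [wt]; nlinarith
  | ctxAdd N h ih =>
    intro T u h
    obtain ⟨v, w, h1, h2, rfl⟩ := cden_add.1 h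
    exact ⟨cden_add.2 ⟨v, w, (ih h1).1, h2, rfl⟩, (ih h1).2.add N⟩
  | ctxSmul a h ih =>
    intro T u h
    obtain ⟨v, h1, rfl⟩ := cden_smul.1 h
    exact ⟨cden_smul.2 ⟨v, (ih h1).1, rfl⟩, (ih h1).2.smul a⟩
  | ctxElimZero h ih =>
    intro T u h
    obtain ⟨⟨v, h1⟩, rfl⟩ := cden_elimZero.1 h
    exact ⟨cden_elimZero.2 ⟨⟨v, (ih h1).1⟩, rfl⟩,
      (ih h1).2.frame (c := 1) (e := 0) (k := 0) (k' := 0) one_pos (by simp [wt]) (by simp [wt]) rfl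
        rfl rfl rfl rfl⟩
  | @ctxElimOne f M M' N h ih =>
    intro T u h
    obtain ⟨v, w, h1, h2, rfl⟩ := cden_elimOne.1 h
    exact ⟨cden_elimOne.2 ⟨v, w, (ih h1).1, h2, rfl⟩,
      (ih h1).2.frame (c := 2 * wt N) (e := 0) (k := 0) (k' := 0)
        (by have := wt_pos N; omega) (by simp only [wt]; ring) (by simp only [wt]; ring) rfl rfl rfl rfl rfl⟩
  | @ctxAppL f M M' N h ih =>
    intro T u h
    have key : ∀ {T v}, CDen M T v → Drop (app M N) (app M' N) := fun h1 =>
      (ih h1).2.frame (c := 2 * wt N) (e := 0)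
        (by have := wt_pos N; omega) (by simp only [wt]; ring) (by simp only [wt]; ring) rfl rfl rfl rfl rfl
    rcases h.of_app with ⟨S, v, w, h1, h2, rfl⟩ | ⟨e, P, Q, v, w, e1, h1, h2, rfl⟩
    · exact ⟨(ih h1).1.app_lolli h2, key h1⟩
    · cases e; cases e1
      exact ⟨(ih h1).1.app_bang h2, key h1⟩
  | @ctxAppR f V N N' hV h ih =>
    intro T u h
    have key : ∀ {T v}, CDen N T v → Drop (app V N) (app V N') := fun h1 =>
      (ih h1).2.frame (c := 2 * wt V) (e := 0)
        (by have := wt_pos V; omega) (by simp only [wt]; ring) (by simp only [wt]; ring)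
        (Nat.add_comm _ _) (Nat.add_comm _ _) (Nat.add_comm _ _) (Nat.add_comm _ _) rfl
    rcases h.of_app with ⟨S, v, w, h1, h2, rfl⟩ | ⟨e, P, Q, v, w, e1, h1, h2, rfl⟩
    · exact ⟨h1.app_lolli (ih h2).1, key h2⟩
    · cases e; cases e1
      exact ⟨CDen.app_bang h1 (ih h2).1, key h2⟩
  | ctxPairL n h ih =>
    intro T u h
    obtain ⟨P, Q, v, w, rfl, h1, h2, rfl⟩ := cden_pair.1 h
    exact ⟨cden_pair.2 ⟨P, Q, v, w, rfl, (ih h1).1, h2, rfl⟩,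
      (ih h1).2.frame (c := 1) (e := wt n + 1) one_pos (by simp only [wt]; ring)
        (by simp only [wt]; ring) rfl rfl rfl rfl rfl⟩
  | @ctxPairR m n n' hv h ih =>
    intro T u h
    obtain ⟨P, Q, v, w, rfl, h1, h2, rfl⟩ := cden_pair.1 h
    exact ⟨cden_pair.2 ⟨P, Q, v, w, rfl, h1, (ih h2).1, rfl⟩,
      (ih h2).2.frame (c := 1) (e := wt m + 1) one_pos (by simp only [wt]; ring)
        (by simp only [wt]; ring) (Nat.add_comm _ _) (Nat.add_comm _ _) (Nat.add_comm _ _)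
        (Nat.add_comm _ _) rfl⟩
  | @ctxElimFst m m' n h ih =>
    intro T u h
    obtain ⟨P, Q, v, d, h1, h2, rfl⟩ := cden_elimFst.1 h
    exact ⟨cden_elimFst.2 ⟨P, Q, v, d, (ih h1).1, h2, rfl⟩,
      (ih h1).2.frame (c := 2 * wt n) (e := 0) (k := 0) (k' := 0)
        (by have := wt_pos n; omega) (by simp only [wt]; ring) (by simp only [wt]; ring) rfl rfl rfl rfl rfl⟩
  | @ctxElimSnd m m' n h ih =>
    intro T u h
    obtain ⟨P, Q, v, d, h1, h2, rfl⟩ := cden_elimSnd.1 h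
    exact ⟨cden_elimSnd.2 ⟨P, Q, v, d, (ih h1).1, h2, rfl⟩,
      (ih h1).2.frame (c := 2 * wt n) (e := 0) (k := 0) (k' := 0)
        (by have := wt_pos n; omega) (by simp only [wt]; ring) (by simp only [wt]; ring) rfl rfl rfl rfl rfl⟩
  | ctxInl h ih =>
    intro T u h
    obtain ⟨A, B, v, rfl, h1, rfl⟩ := cden_inl.1 h
    exact ⟨cden_inl.2 ⟨A, B, v, rfl, (ih h1).1, rfl⟩,
      (ih h1).2.frame_outc one_pos one_pos (one_mul _).symm (one_mul _).symm rfl rfl rfl rfl rfl⟩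
  | ctxInr h ih =>
    intro T u h
    obtain ⟨A, B, v, rfl, h1, rfl⟩ := cden_inr.1 h
    exact ⟨cden_inr.2 ⟨A, B, v, rfl, (ih h1).1, rfl⟩,
      (ih h1).2.frame_outc one_pos one_pos (one_mul _).symm (one_mul _).symm rfl rfl rfl rfl rfl⟩
  | @ctxElimPlus m m' n o h ih =>
    intro T u h
    obtain ⟨A, B, v, d, d', h1, h2, h3, rfl⟩ := cden_elimPlus.1 h
    have hp : 0 < 2 * (wt n + wt o) := by have := wt_pos n; omega
    exact ⟨cden_elimPlus.2 ⟨A, B, v, d, d', (ih h1).1, h2, h3, rfl⟩,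
      (ih h1).2.frame_outc hp hp (by simp only [wt]; ring) (by simp only [wt]; ring)
        rfl rfl rfl rfl rfl⟩
  | ctxTensL N h ih =>
    intro T u h
    obtain ⟨P, Q, v, w, rfl, h1, h2, rfl⟩ := cden_tens.1 h
    exact ⟨cden_tens.2 ⟨P, Q, v, w, rfl, (ih h1).1, h2, rfl⟩, (ih h1).2.tens_left N⟩
  | ctxTensR hV h ih =>
    intro T u h
    obtain ⟨P, Q, v, w, rfl, h1, h2, rfl⟩ := cden_tens.1 h
    exact ⟨cden_tens.2 ⟨P, Q, v, w, rfl, h1, (ih h2).1, rfl⟩, (ih h2).2.tens_right _⟩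
  | @ctxElimTens f M M' N h ih =>
    intro T u h
    obtain ⟨S, S', v, d, h1, h2, rfl⟩ := cden_elimTens.1 h
    have hp : 0 < 2 * wt N := by have := wt_pos N; omega
    exact ⟨cden_elimTens.2 ⟨S, S', v, d, (ih h1).1, h2, rfl⟩,
      (ih h1).2.frame_outc hp hp (by simp only [wt]; ring) (by simp only [wt]; ring)
        rfl rfl rfl rfl rfl⟩
  | ctxBang h ih =>
    intro T u h
    obtain ⟨P, v, rfl, h1, rfl⟩ := cden_bang.1 h
    exact ⟨cden_bang.2 ⟨P, v, rfl, (ih h1).1, rfl⟩,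
      (ih h1).2.frame_outc two_pos two_pos rfl rfl rfl rfl rfl rfl rfl⟩
  | ctxTau h ih =>
    intro T u h
    obtain ⟨P, Q, v, rfl, h1, rfl⟩ := cden_tau.1 h
    exact ⟨cden_tau.2 ⟨P, Q, v, rfl, (ih h1).1, rfl⟩,
      (ih h1).2.frame_outc two_pos two_pos rfl rfl rfl rfl rfl rfl rfl⟩

/-! ### Closed values -/

/-- The propositions whose closed values are combinations of values `v_b`. -/
def Ty.isPos : {f : Frag} → Ty f → Bool
  | _, .one => true
  | _, .tensor _ _ => true
  | _, .plus _ _ => true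
  | _, .bang _ => true
  | _, _ => false

section canon
variable {f : Frag} {b : Tm f} {T : Ty f} {u : Vec}

theorem IsVb.isPos (hb : IsVb b) (h : CDen b T u) : T.isPos = true := by
  cases hb with
  | star => obtain ⟨rfl, -⟩ := cden_star.1 h; rfl
  | var n => exact absurd h not_cden_var
  | tens _ _ => obtain ⟨_, _, _, _, rfl, -⟩ := cden_tens.1 h; rfl
  | inl _ => obtain ⟨_, _, _, rfl, -⟩ := cden_inl.1 h; rfl
  | inr _ => obtain ⟨_, _, _, rfl, -⟩ := cden_inr.1 h; rfl
  | bang _ => obtain ⟨_, _, rfl, -⟩ := cden_bang.1 h; rfl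

theorem IsVn.isVb (hb : IsVn b) (h : CDen b T u) (hT : T.isPos = true) : IsVb b := by
  cases hb with
  | topI => obtain ⟨rfl, -⟩ := cden_topI.1 h; simp [Ty.isPos] at hT
  | lam m => obtain ⟨_, _, _, rfl, -⟩ := cden_lam.1 h; simp [Ty.isPos] at hT
  | pair _ _ => obtain ⟨_, _, _, _, rfl, -⟩ := cden_pair.1 h; simp [Ty.isPos] at hT
  | vb h => exact h

theorem IsVn.eq_star (hb : IsVn b) (h : CDen b .one u) : b = star := by
  cases hb.isVb h rfl with
  | star => rfl
  | var n => exact absurd h not_cden_var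
  | tens _ _ => obtain ⟨_, _, _, _, e, -⟩ := cden_tens.1 h; cases e
  | inl _ => obtain ⟨_, _, _, e, -⟩ := cden_inl.1 h; cases e
  | inr _ => obtain ⟨_, _, _, e, -⟩ := cden_inr.1 h; cases e
  | bang _ => obtain ⟨_, _, e, -⟩ := cden_bang.1 h; cases e

theorem IsVn.eq_tens {S S' : Ty f} (hb : IsVn b) (h : CDen b (.tensor S S') u) :
    ∃ v w, b = tens v w ∧ IsVn v ∧ IsVn w := by
  cases hb.isVb h rfl with
  | star => obtain ⟨e, -⟩ := cden_star.1 h; cases e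
  | var n => exact absurd h not_cden_var
  | tens h1 h2 => exact ⟨_, _, rfl, h1, h2⟩
  | inl _ => obtain ⟨_, _, _, e, -⟩ := cden_inl.1 h; cases e
  | inr _ => obtain ⟨_, _, _, e, -⟩ := cden_inr.1 h; cases e
  | bang _ => obtain ⟨_, _, e, -⟩ := cden_bang.1 h; cases e

theorem IsVn.eq_inl_or_inr {b : Tm .mixed} {A B : Ty .mixed} (hb : IsVn b)
    (h : CDen b (.plus A B) u) : ∃ v, IsVn v ∧ (b = inl v ∨ b = inr v) := by
  cases hb.isVb h rfl with
  | star => obtain ⟨e, -⟩ := cden_star.1 h; cases e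
  | var n => exact absurd h not_cden_var
  | tens h1 h2 => obtain ⟨_, _, _, _, e, -⟩ := cden_tens.1 h; cases e
  | inl hv => exact ⟨_, hv, .inl rfl⟩
  | inr hv => exact ⟨_, hv, .inr rfl⟩
  | bang _ => obtain ⟨_, _, e, -⟩ := cden_bang.1 h; cases e

theorem IsVn.eq_bang {b : Tm .mixed} {P : Ty .pure} (hb : IsVn b)
    (h : CDen b (.bang P) u) : ∃ v, b = bang v ∧ IsVal v := by
  cases hb.isVb h rfl with
  | star => obtain ⟨e, -⟩ := cden_star.1 h; cases e
  | var n => exact absurd h not_cden_var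
  | tens h1 h2 => obtain ⟨_, _, _, _, e, -⟩ := cden_tens.1 h; cases e
  | inl _ => obtain ⟨_, _, _, e, -⟩ := cden_inl.1 h; cases e
  | inr _ => obtain ⟨_, _, _, e, -⟩ := cden_inr.1 h; cases e
  | bang hv => exact ⟨_, rfl, hv⟩

theorem IsVn.eq_lam {S S' : Ty f} (hb : IsVn b) (h : CDen b (.lolli S S') u) :
    ∃ m, b = Tm.lam m := by
  cases hb with
  | topI => obtain ⟨e, -⟩ := cden_topI.1 h; cases e
  | lam m => exact ⟨m, rfl⟩
  | pair _ _ => obtain ⟨_, _, _, _, e, -⟩ := cden_pair.1 h; cases e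
  | vb hb => exact absurd (hb.isPos h) (by simp [Ty.isPos])

theorem IsVn.eq_pair {b : Tm .pure} {P Q : Ty .pure} (hb : IsVn b) (h : CDen b (.conj P Q) u) :
    ∃ v w, b = Tm.pair v w ∧ IsVal v ∧ IsVal w := by
  cases hb with
  | topI => obtain ⟨e, -⟩ := cden_topI.1 h; cases e
  | lam m => obtain ⟨_, _, _, e, -⟩ := cden_lam.1 h; cases e
  | pair h1 h2 => exact ⟨_, _, rfl, h1, h2⟩
  | vb hb => exact absurd (hb.isPos h) (by simp [Ty.isPos])

theorem IsVn.eq_topI {b : Tm .pure} (hb : IsVn b) (h : CDen b .top u) : b = Tm.topI := by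
  cases hb with
  | topI => rfl
  | lam m => obtain ⟨_, _, _, e, -⟩ := cden_lam.1 h; cases e
  | pair h1 h2 => obtain ⟨_, _, _, _, e, -⟩ := cden_pair.1 h; cases e
  | vb hb => exact absurd (hb.isPos h) (by simp [Ty.isPos])

theorem not_isVn_zero {b : Tm .mixed} (hb : IsVn b) (h : CDen b .zero u) : False := by
  cases hb with
  | lam m => obtain ⟨_, _, _, e, -⟩ := cden_lam.1 h; cases e
  | vb hb => exact absurd (hb.isPos h) (by simp [Ty.isPos])

end canon

/-! ### Progress -/

section progress
variable {f : Frag}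

/-- The base form is a value or reduces. -/
def Ready (b : Tm f) : Prop := IsVn b ∨ ∃ N, Step b N

/-- The term improves to an algebraic form all of whose summands are values or reduce. -/
def Good (M : Tm f) : Prop := ∃ l, Better M (lin l) ∧ IsNF l ∧ ∀ p ∈ l, Ready p.2

theorem good_of_base {M b : Tm f} (h : Better M b) (hb : IsBase b) (hr : Ready b) : Good M :=
  ⟨[(1, b)], by simpa [lin] using h, isNF_singleton hb, by simpa using hr⟩

/-- The shapes in which a closed algebraic form reduces or is a value. -/
inductive Whn (M : Tm f) : Prop
  | step (h : ∃ N, Step M N)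
  | vn (h : IsVn M)
  | comb (l : List (Scal f × Tm f)) (hl : IsLin l M) (hc : IsComb M) (hv : IsVal M)
      (hd : (l.map Prod.snd).Nodup) (hb : ∀ p ∈ l, IsVb p.2)
      -- Values may still reduce, for example `bang (smul a star)` with `a ≠ 1`; this clause rules
      -- out such summands.
      (hn : ∀ p ∈ l, ∀ N, ¬ Step p.2 N)

theorem Whn.step_or_isVal {M : Tm f} (h : Whn M) : (∃ N, Step M N) ∨ IsVal M := by
  cases h with
  | step h => exact .inl h
  | vn h => exact .inr (.vn h)
  | comb _ _ _ hv _ _ _ => exact .inr hv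

theorem exists_isSum {l : List (Tm f)} (h : l ≠ []) : ∃ t, IsSum l t := by
  induction l with
  | nil => simp at h
  | cons a l ih =>
    by_cases hl : l = []
    · subst hl; exact ⟨a, .single a⟩
    · obtain ⟨t, ht⟩ := ih hl
      exact ⟨_, .add (.single a) ht⟩

theorem isSum_lin {l : List (Scal f × Tm f)} (h : l ≠ []) : IsSum (l.map tm) (lin l) := by
  induction l with
  | nil => simp at h
  | cons p l ih =>
    by_cases hl : l = []
    · subst hl; exact .single _
    · rw [lin_cons _ hl]; exact .add (.single _) (ih hl)

theorem isComb_lin {l : List (Scal f × Tm f)} (h : l ≠ []) (h1 : ∀ b, l ≠ [(1, b)]) :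
    IsComb (lin l) := by
  obtain ⟨⟨a, b⟩, l, rfl⟩ := List.exists_cons_of_ne_nil h
  by_cases hl : l = []
  · subst hl
    have : a ≠ 1 := fun e => h1 b (by rw [e])
    change IsComb (tm (a, b))
    rw [tm_of_ne b this]; exact .smul a b
  · rw [lin_cons _ hl]; exact .add _ _

/-- A value lists the scaled summands before the bare ones, so the summands are sorted by whether
their coefficient is 1. If all coefficients vanish the order is irrelevant. -/
theorem IsNF.exists_isVal {l : List (Scal f × Tm f)} (h : IsNF l) (hv : ∀ p ∈ l, IsVb p.2) :
    ∃ k, l.Perm k ∧ IsVal (lin k) := by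
  classical
  rcases h.coef with hz | hz
  · let q : Scal f × Tm f → Bool := fun p => decide (p.1 ≠ 1)
    have hp : (l.filter q ++ l.filter fun p => !q p).Perm l := List.filter_append_perm q l
    refine ⟨_, hp.symm, ?_⟩
    have hne := (h.perm hp.symm).ne_nil
    refine .comb (l.filter q) ((l.filter fun p => !q p).map Prod.snd) ?_ ?_ ?_ ?_ ?_
    · have := isSum_lin hne
      rw [List.map_append] at this
      convert this using 2
      · exact List.map_congr_left fun p hp => by
          have : p.1 ≠ 1 := by simpa [q] using (List.mem_filter.1 hp).2
          exact (tm_of_ne p.2 this).symm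
      · exact List.map_congr_left fun p hp => by
          have : p.1 = 1 := by simpa [q] using (List.mem_filter.1 hp).2
          obtain ⟨a, b⟩ := p
          obtain rfl : a = 1 := this
          exact (tm_one b).symm
    · rw [← List.map_append]; exact (h.perm hp.symm).nodup
    · intro p hp
      obtain ⟨h1, h2⟩ := List.mem_filter.1 hp
      exact ⟨hz p h1, by simpa [q] using h2⟩
    · exact fun p hp => hv p (List.mem_filter.1 hp).1
    · intro v hv'
      obtain ⟨p, hp, rfl⟩ := List.mem_map.1 hv'
      exact hv p (List.mem_filter.1 hp).1
  · refine ⟨l, .refl _, .null _ (isSum_lin_zero h.ne_nil hz) h.nodup fun v hv' => ?_⟩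
    obtain ⟨p, hp, rfl⟩ := List.mem_map.1 hv'
    exact hv p hp

theorem exists_eq_map {ι : Type} {l : List (Scal f × Tm f)} {F : ι → Tm f} {C : ι → Prop}
    (h : ∀ p ∈ l, ∃ v, p.2 = F v ∧ C v) :
    ∃ k : List (Scal f × ι), l = k.map (fun p => (p.1, F p.2)) ∧ ∀ p ∈ k, C p.2 := by
  induction l with
  | nil => exact ⟨[], rfl, by simp⟩
  | cons p l ih =>
    obtain ⟨k, rfl, hk⟩ := ih fun q hq => h q (by simp [hq])
    obtain ⟨v, hv, hc⟩ := h p (by simp)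
    refine ⟨(p.1, v) :: k, by simp [← hv], fun q hq => ?_⟩
    rcases List.mem_cons.1 hq with rfl | hq
    exacts [hc, hk q hq]

theorem nodup_of_map {ι : Type} {k : List (Scal f × ι)} {F : ι → Tm f}
    (h : ((k.map fun p => (p.1, F p.2)).map Prod.snd).Nodup) : (k.map Prod.snd).Nodup := by
  rw [List.map_map] at h
  exact List.Nodup.of_map F (by rwa [List.map_map])

theorem eq_singleton_of_nodup {l : List (Scal f × Tm f)} {b : Tm f} (hl : l ≠ [])
    (hd : (l.map Prod.snd).Nodup) (h : ∀ p ∈ l, p.2 = b) : ∃ a, l = [(a, b)] := by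
  obtain ⟨⟨a, b'⟩, l, rfl⟩ := List.exists_cons_of_ne_nil hl
  obtain rfl : b' = b := h (a, b') (by simp)
  cases l with
  | nil => exact ⟨a, rfl⟩
  | cons q l =>
    have := h q (by simp)
    simp [this] at hd

/-- A closed algebraic form with ready summands reduces or is a value, up to the order of its
summands. -/
theorem exists_whn {l : List (Scal f × Tm f)} (h : IsNF l) (hr : ∀ p ∈ l, Ready p.2) {T : Ty f}
    {u : Vec} (hT : CDen (lin l) T u) : ∃ k, l.Perm k ∧ Whn (lin k) := by
  by_cases hs : ∃ p ∈ l, ∃ N, Step p.2 N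
  · obtain ⟨p, hp, N, hN⟩ := hs
    obtain ⟨s, t, rfl⟩ := List.append_of_mem hp
    -- Evaluation reaches the left summand of a sum only, so the reducible summand is moved to the
    -- front.
    refine ⟨p :: (s ++ t), List.perm_middle, .step ?_⟩
    have : ∃ N, Step (tm p) N := by
      unfold tm; split
      exacts [⟨N, hN⟩, ⟨_, .ctxSmul _ hN⟩]
    by_cases hst : s ++ t = []
    · rw [hst]; exact this
    · obtain ⟨N, hN⟩ := this
      rw [lin_cons _ hst]; exact ⟨_, .ctxAdd _ hN⟩
  · push Not at hs
    have hv : ∀ p ∈ l, IsVn p.2 := fun p hp => (hr p hp).resolve_right fun ⟨N, hN⟩ => hs p hp N hN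
    obtain ⟨g, hg, -⟩ := (isLin_lin h.ne_nil).exists_cden hT
    by_cases h1 : ∃ b, l = [(1, b)]
    · obtain ⟨b, rfl⟩ := h1
      exact ⟨_, .refl _, .vn (by simpa [lin] using hv (1, b) (by simp))⟩
    · push Not at h1
      have hc := isComb_lin h.ne_nil h1
      -- At a positive proposition the summands are values `v_b` and can be arranged into a value.
      -- At any other proposition a combination of values moves inside the constructor.
      by_cases hpos : T.isPos = true
      · have hb : ∀ p ∈ l, IsVb p.2 := fun p hp => (hv p hp).isVb (hg p hp) hpos
        obtain ⟨k, hk, hval⟩ := h.exists_isVal hb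
        have hk' := h.perm hk
        refine ⟨k, hk, .comb k (isLin_lin hk'.ne_nil) (isComb_lin hk'.ne_nil fun b e => ?_) hval
          hk'.nodup (fun p hp => hb p (hk.mem_iff.2 hp)) fun p hp => hs p (hk.mem_iff.2 hp)⟩
        subst e; exact h1 b (List.perm_singleton.1 hk)
      · refine ⟨l, .refl _, .step ?_⟩
        cases T with
        | top =>
          -- All summands are `topI`; being distinct, there is only one, and its coefficient is not
          -- 1 since the combination is not a bare summand.
          obtain ⟨a, rfl⟩ := eq_singleton_of_nodup h.ne_nil h.nodup fun p hp =>
            (hv p hp).eq_topI (hg p hp)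
          have : a ≠ 1 := fun e => h1 topI (by rw [e])
          exact ⟨topI, by simpa [lin, tm_of_ne _ this] using Step.commTop a⟩
        | zero =>
          obtain ⟨p, hp⟩ := List.exists_mem_of_ne_nil l h.ne_nil
          exact (not_isVn_zero (hv p hp) (hg p hp)).elim
        | lolli S S' =>
          obtain ⟨k, rfl, -⟩ := exists_eq_map (F := lam) (C := fun _ => True) fun p hp => by
            simpa using (hv p hp).eq_lam (hg p hp)
          obtain ⟨t, ht⟩ := exists_isSum (l := k.map fun p => smul p.1 p.2)
            (by simpa using h.ne_nil)
          exact ⟨_, .commLam k (isLin_lin h.ne_nil) hc (nodup_of_map h.nodup) ht⟩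
        | conj P Q =>
          obtain ⟨k, rfl, hk⟩ := exists_eq_map (F := fun q : Tm .pure × Tm .pure => pair q.1 q.2)
            (C := fun q => IsVal q.1 ∧ IsVal q.2) fun p hp => by
              obtain ⟨v, w, h2, h3⟩ := (hv p hp).eq_pair (hg p hp)
              exact ⟨(v, w), h2, h3⟩
          obtain ⟨t, ht⟩ := exists_isSum (l := k.map fun p => smul p.1 p.2.1)
            (by simpa using h.ne_nil)
          obtain ⟨t', ht'⟩ := exists_isSum (l := k.map fun p => smul p.1 p.2.2)
            (by simpa using h.ne_nil)
          exact ⟨_, .commPair k (isLin_lin h.ne_nil) hc (nodup_of_map (F := fun q : Tm .pure × Tm .pure => pair q.1 q.2) h.nodup) hk ht ht'⟩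
        | one => simp [Ty.isPos] at hpos
        | tensor => simp [Ty.isPos] at hpos
        | plus => simp [Ty.isPos] at hpos
        | bang => simp [Ty.isPos] at hpos

theorem Good.exists_whn {M : Tm f} (h : Good M) {T : Ty f} {u : Vec} (hT : CDen M T u) :
    ∃ M', Better M M' ∧ IsAlg M' ∧ Whn M' := by
  obtain ⟨l, h1, h2, h3⟩ := h
  obtain ⟨k, h4, h5⟩ := BIMALL.exists_whn h2 h3 (h1.cden hT)
  exact ⟨_, h1.trans (.lin_perm h4), (h2.perm h4).isAlg, h5⟩

theorem exists_isAlg (M : Tm f) : ∃ M', Better M M' ∧ IsAlg M' := by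
  obtain ⟨l, h1, h2⟩ := exists_nf M
  exact ⟨_, h1, h2.isAlg⟩

/-- A combination of values `v_b` can only have a positive proposition, so its shape is excluded
here. -/
theorem Whn.isPos {M : Tm f} (h : Whn M) {T : Ty f} {u : Vec} (hT : CDen M T u)
    (hpos : T.isPos = false) : (∃ N, Step M N) ∨ IsVn M := by
  cases h with
  | step h => exact .inl h
  | vn h => exact .inr h
  | comb l hl hc hv hd hb _ =>
    obtain ⟨g, hg, -⟩ := hl.exists_cden hT
    obtain ⟨p, hp⟩ := List.exists_mem_of_ne_nil l hl.ne_nil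
    have := (hb p hp).isPos (hg p hp)
    simp [this] at hpos

/-- Brings a single `bang` value and a combination of them into the common form that
`Step.commBangApp` expects; a bare value is the combination with the omitted coefficient 1. -/
theorem Whn.isLin_bang {M : Tm .mixed} (h : Whn M) {P : Ty .pure} {u : Vec}
    (hT : CDen M (.bang P) u) : (∃ N, Step M N) ∨ IsVal M ∧ ∃ l : List (Scal .mixed × Tm .pure),
      IsLin (l.map fun p => (p.1, bang p.2)) M ∧ (l.map Prod.snd).Nodup ∧
        ∀ p ∈ l, IsVal p.2 := by
  cases h with
  | step h => exact .inl h
  | vn h =>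
    obtain ⟨v, rfl, hv⟩ := h.eq_bang hT
    exact .inr ⟨.vn h, [(1, v)], .unit _, by simp, by simpa using hv⟩
  | comb l hl hc hv hd hb _ =>
    obtain ⟨g, hg, -⟩ := hl.exists_cden hT
    obtain ⟨k, rfl, hk⟩ := exists_eq_map (F := bang) (C := IsVal) fun p hp =>
      (IsVn.vb (hb p hp)).eq_bang (hg p hp)
    exact .inr ⟨hv, k, hl, nodup_of_map hd, hk⟩

theorem exists_isSum_map {g : Frag} {l : List (Scal f × Tm f)} {s : Tm f} (h : IsLin l s)
    (F : Scal f × Tm f → Tm g) : ∃ t, IsSum (l.map F) t :=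
  exists_isSum (by simpa using h.ne_nil)

/-- Every closed term improves to an algebraic form all of whose summands are values or
reduce. -/
theorem CDen.good {M : Tm f} : ∀ {T : Ty f} {u : Vec}, CDen M T u → Good M := by
  induction M with
  | var n => intro T u h; exact absurd h not_cden_var
  | add m n ih ih' =>
    intro T u h
    obtain ⟨v, w, hv, hw, -⟩ := cden_add.1 h
    obtain ⟨⟨l, h1, h2, r1⟩, ⟨k, h3, h4, r2⟩⟩ := And.intro (ih hv) (ih' hw)
    obtain ⟨j, h5, h6, h7⟩ := exists_isNF (l ++ k) (by simp [h2.ne_nil]) fun p hp =>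
      (List.mem_append.1 hp).elim (h2.base p) (h4.base p)
    refine ⟨j, ((h1.add h3).trans (.lin_append h2.ne_nil h4.ne_nil)).trans h5, h6, fun p hp => ?_⟩
    obtain ⟨q, hq, e⟩ := List.mem_map.1 (h7 p hp)
    rw [← e]
    exact (List.mem_append.1 hq).elim (r1 q) (r2 q)
  | smul a m ih =>
    intro T u h
    obtain ⟨v, hv, -⟩ := cden_smul.1 h
    obtain ⟨l, h1, h2, r1⟩ := ih hv
    obtain ⟨j, h5, h6, h7⟩ := exists_isNF (l.map fun p => (a * p.1, p.2)) (by simp [h2.ne_nil])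
      fun p hp => by
        obtain ⟨q, hq, rfl⟩ := List.mem_map.1 hp
        exact h2.base q hq
    refine ⟨j, ((h1.smul a).trans (.lin_smul a h2.ne_nil)).trans h5, h6, fun p hp => ?_⟩
    obtain ⟨q, hq, e⟩ := List.mem_map.1 (h7 p hp)
    obtain ⟨r, hr, rfl⟩ := List.mem_map.1 hq
    rw [← e]
    exact r1 r hr
  | star => intro T u _; exact good_of_base (.refl _) .star (.inl (.vb .star))
  | elimOne m n ih _ =>
    intro T u h
    obtain ⟨v, w, hv, hw, -⟩ := cden_elimOne.1 h
    obtain ⟨m', h1, h2, h3⟩ := (ih hv).exists_whn hv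
    obtain ⟨n', h4, h5⟩ := exists_isAlg n
    refine good_of_base (h1.elimOne h4) (.elimOne h2 h5) (.inr ?_)
    have hm := h1.cden hv
    cases h3 with
    | step h => obtain ⟨N, h⟩ := h; exact ⟨_, .ctxElimOne _ h⟩
    | vn h => obtain rfl := h.eq_star hm; exact ⟨_, .one _ (.unit _)⟩
    | comb l hl hc hv hd hb _ =>
      obtain ⟨g, hg, -⟩ := hl.exists_cden hm
      -- Every summand is `star`, so distinctness leaves a single multiple of `star`, which is the
      -- redex required.
      obtain ⟨a, rfl⟩ := eq_singleton_of_nodup hl.ne_nil hd fun p hp =>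
        (IsVn.vb (hb p hp)).eq_star (hg p hp)
      exact ⟨_, .one _ hl⟩
  | lam m ih =>
    intro T u h
    -- The body is open and is never evaluated here; bringing it to algebraic form, which needs no
    -- typing, is enough.
    obtain ⟨m', h1, h2⟩ := exists_isAlg m
    exact good_of_base h1.lam (.lam h2) (.inl (.lam _))
  | app m n ih ih' =>
    intro T u h
    rcases h.of_app with ⟨S, v, w, hv, hw, -⟩ | ⟨e, P, Q, v, w, e1, hv, hw, -⟩
    · obtain ⟨m', h1, h2, h3⟩ := (ih hv).exists_whn hv
      obtain ⟨n', h4, h5, h6⟩ := (ih' hw).exists_whn hw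
      -- Both arguments have been normalised, as base forms require algebraic immediate subterms;
      -- evaluation then proceeds from the function to its argument.
      refine good_of_base (h1.app h4) (.app h2 h5) (.inr ?_)
      rcases h3.isPos (h1.cden hv) rfl with ⟨N, h⟩ | h
      · exact ⟨_, .ctxAppL _ h⟩
      · obtain ⟨t, rfl⟩ := h.eq_lam (h1.cden hv)
        rcases h6.step_or_isVal with ⟨N, h'⟩ | h'
        exacts [⟨_, .ctxAppR (.vn h) h'⟩, ⟨_, .beta _ h'⟩]
    · cases e; cases e1
      obtain ⟨m', h1, h2, h3⟩ := (ih hv).exists_whn hv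
      obtain ⟨n', h4, h5, h6⟩ := (ih' hw).exists_whn hw
      refine good_of_base (h1.app h4) (.app h2 h5) (.inr ?_)
      rcases h3.isLin_bang (h1.cden hv) with ⟨N, h⟩ | ⟨h, l, l1, l2, l3⟩
      · exact ⟨_, .ctxAppL _ h⟩
      · rcases h6.isLin_bang (h4.cden hw) with ⟨N, h'⟩ | ⟨h', k, k1, k2, k3⟩
        · exact ⟨_, .ctxAppR h h'⟩
        · obtain ⟨p, hp⟩ := List.exists_mem_of_ne_nil _ l1.ne_nil
          obtain ⟨q, hq⟩ := List.exists_mem_of_ne_nil _ k1.ne_nil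
          obtain ⟨p, hp, -⟩ := List.mem_map.1 hp
          obtain ⟨q, hq, -⟩ := List.mem_map.1 hq
          obtain ⟨t, ht⟩ := exists_isSum (l := (l.product k).map fun r =>
            smul (f := .mixed) (r.1.1 * r.2.1) (bang (app r.1.2 r.2.2)))
            (List.ne_nil_of_mem (List.mem_map_of_mem (List.pair_mem_product.2 ⟨hp, hq⟩)))
          exact ⟨_, .commBangApp l k l1 l2 l3 k1 k2 k3 ht⟩
  | tens m n ih ih' =>
    intro T u h
    obtain ⟨_, _, v, w, -, hv, hw, -⟩ := cden_tens.1 h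
    obtain ⟨⟨l, h1, h2, r1⟩, ⟨k, h3, h4, r2⟩⟩ := And.intro (ih hv) (ih' hw)
    obtain ⟨j, h5, h6, h7⟩ := exists_isNF
      (l.flatMap fun p => k.map fun q => (p.1 * q.1, tens p.2 q.2))
      (fun e => by
        rw [List.flatMap_eq_nil_iff] at e
        obtain ⟨q, hq⟩ := List.exists_mem_of_ne_nil l h2.ne_nil
        exact h4.ne_nil (List.map_eq_nil_iff.1 (e q hq)))
      fun p hp => by
        obtain ⟨q, hq, hp⟩ := List.mem_flatMap.1 hp
        obtain ⟨r, hr, rfl⟩ := List.mem_map.1 hp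
        exact .tens (h2.base q hq) (h4.base r hr)
    refine ⟨j, ((h1.tens h3).trans (.lin_tens_lin h2.ne_nil h4.ne_nil)).trans h5, h6, fun p hp => ?_⟩
    obtain ⟨q, hq, e⟩ := List.mem_map.1 (h7 p hp)
    obtain ⟨r, hr, hq⟩ := List.mem_flatMap.1 hq
    obtain ⟨s, hs, rfl⟩ := List.mem_map.1 hq
    rw [← e]
    -- Sums are pulled out of a tensor by the algebraic equivalence, so progress is examined for
    -- each product of summands: the left factor is evaluated first, then the right one.
    rcases r1 r hr with a | ⟨N, a⟩
    · rcases r2 s hs with b | ⟨N, b⟩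
      exacts [.inl (.vb (.tens a b)), .inr ⟨_, .ctxTensR (.vn a) b⟩]
    · exact .inr ⟨_, .ctxTensL _ a⟩
  | elimTens m n ih _ =>
    intro T u h
    obtain ⟨_, _, v, d, hv, -, -⟩ := cden_elimTens.1 h
    obtain ⟨m', h1, h2, h3⟩ := (ih hv).exists_whn hv
    obtain ⟨n', h4, h5⟩ := exists_isAlg n
    refine good_of_base (h1.elimTens h4) (.elimTens h2 h5) (.inr ?_)
    cases h3 with
    | step h => obtain ⟨N, h⟩ := h; exact ⟨_, .ctxElimTens _ h⟩
    | vn h =>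
      obtain ⟨v, w, rfl, a, b⟩ := h.eq_tens (h1.cden hv)
      exact ⟨_, .tensor _ a b⟩
    | comb l hl hc hv hd hb _ =>
      obtain ⟨t, ht⟩ := exists_isSum_map hl fun p => smul p.1 (elimTens p.2 n')
      exact ⟨_, .commTens l _ hl hc hd hb ht⟩
  | topI => intro T u _; exact good_of_base (.refl _) .topI (.inl .topI)
  | pair m n ih ih' =>
    intro T u h
    obtain ⟨_, _, v, w, -, hv, hw, -⟩ := cden_pair.1 h
    obtain ⟨m', h1, h2, h3⟩ := (ih hv).exists_whn hv
    obtain ⟨n', h4, h5, h6⟩ := (ih' hw).exists_whn hw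
    refine good_of_base (h1.pair h4) (.pair h2 h5) ?_
    rcases h3.step_or_isVal with ⟨N, a⟩ | a
    · exact .inr ⟨_, .ctxPairL _ a⟩
    · rcases h6.step_or_isVal with ⟨N, b⟩ | b
      exacts [.inr ⟨_, .ctxPairR a b⟩, .inl (.pair a b)]
  | elimFst m n ih _ =>
    intro T u h
    obtain ⟨_, _, v, d, hv, -, -⟩ := cden_elimFst.1 h
    obtain ⟨m', h1, h2, h3⟩ := (ih hv).exists_whn hv
    obtain ⟨n', h4, h5⟩ := exists_isAlg n
    refine good_of_base (h1.elimFst h4) (.elimFst h2 h5) (.inr ?_)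
    rcases h3.isPos (h1.cden hv) rfl with ⟨N, h⟩ | h
    · exact ⟨_, .ctxElimFst _ h⟩
    · obtain ⟨v, w, rfl, a, b⟩ := h.eq_pair (h1.cden hv)
      exact ⟨_, .fst _ a b⟩
  | elimSnd m n ih _ =>
    intro T u h
    obtain ⟨_, _, v, d, hv, -, -⟩ := cden_elimSnd.1 h
    obtain ⟨m', h1, h2, h3⟩ := (ih hv).exists_whn hv
    obtain ⟨n', h4, h5⟩ := exists_isAlg n
    refine good_of_base (h1.elimSnd h4) (.elimSnd h2 h5) (.inr ?_)
    rcases h3.isPos (h1.cden hv) rfl with ⟨N, h⟩ | h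
    · exact ⟨_, .ctxElimSnd _ h⟩
    · obtain ⟨v, w, rfl, a, b⟩ := h.eq_pair (h1.cden hv)
      exact ⟨_, .snd _ a b⟩
  | elimZero m ih =>
    intro T u h
    obtain ⟨⟨v, hv⟩, -⟩ := cden_elimZero.1 h
    obtain ⟨m', h1, h2, h3⟩ := (ih hv).exists_whn hv
    refine good_of_base h1.elimZero (.elimZero h2) (.inr ?_)
    rcases h3.isPos (h1.cden hv) rfl with ⟨N, h⟩ | h
    · exact ⟨_, .ctxElimZero h⟩
    · exact (not_isVn_zero h (h1.cden hv)).elim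
  | inl m ih =>
    intro T u h
    obtain ⟨_, _, v, -, hv, -⟩ := cden_inl.1 h
    obtain ⟨m', h1, h2, h3⟩ := (ih hv).exists_whn hv
    refine good_of_base h1.inl (.inl h2) ?_
    cases h3 with
    | step h => obtain ⟨N, h⟩ := h; exact .inr ⟨_, .ctxInl h⟩
    | vn h => exact .inl (.vb (.inl h))
    | comb l hl hc hv hd hb _ =>
      obtain ⟨t, ht⟩ := exists_isSum_map hl fun p => smul p.1 (inl p.2)
      exact .inr ⟨_, .commInl l hl hc hd hb ht⟩
  | inr m ih =>
    intro T u h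
    obtain ⟨_, _, v, -, hv, -⟩ := cden_inr.1 h
    obtain ⟨m', h1, h2, h3⟩ := (ih hv).exists_whn hv
    refine good_of_base h1.inr (.inr h2) ?_
    cases h3 with
    | step h => obtain ⟨N, h⟩ := h; exact .inr ⟨_, .ctxInr h⟩
    | vn h => exact .inl (.vb (.inr h))
    | comb l hl hc hv hd hb _ =>
      obtain ⟨t, ht⟩ := exists_isSum_map hl fun p => smul p.1 (inr p.2)
      exact .inr ⟨_, .commInr l hl hc hd hb ht⟩
  | elimPlus m n o ih _ _ =>
    intro T u h
    obtain ⟨_, _, v, d, d', hv, -, -, -⟩ := cden_elimPlus.1 h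
    obtain ⟨m', h1, h2, h3⟩ := (ih hv).exists_whn hv
    obtain ⟨n', h4, h5⟩ := exists_isAlg n
    obtain ⟨o', h6, h7⟩ := exists_isAlg o
    refine good_of_base (h1.elimPlus h4 h6) (.elimPlus h2 h5 h7) (.inr ?_)
    cases h3 with
    | step h => obtain ⟨N, h⟩ := h; exact ⟨_, .ctxElimPlus _ _ h⟩
    | vn h =>
      obtain ⟨v, a, rfl | rfl⟩ := h.eq_inl_or_inr (h1.cden hv)
      exacts [⟨_, .caseInl _ _ (.vn a)⟩, ⟨_, .caseInr _ _ (.vn a)⟩]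
    | comb l hl hc hv hd hb _ =>
      obtain ⟨t, ht⟩ := exists_isSum_map hl fun p => smul p.1 (elimPlus p.2 n' o')
      exact ⟨_, .commPlus l _ _ hl hc hd hb ht⟩
  | bang m ih =>
    intro T u h
    obtain ⟨_, v, -, hv, -⟩ := cden_bang.1 h
    obtain ⟨m', h1, h2, h3⟩ := (ih hv).exists_whn hv
    refine good_of_base h1.bang (.bang h2) ?_
    rcases h3.step_or_isVal with ⟨N, a⟩ | a
    exacts [.inr ⟨_, .ctxBang a⟩, .inl (.vb (.bang a))]
  | tau m ih =>
    intro T u h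
    obtain ⟨_, _, v, -, hv, -⟩ := cden_tau.1 h
    obtain ⟨m', h1, h2, h3⟩ := (ih hv).exists_whn hv
    refine good_of_base h1.tau (.tau h2) (.inr ?_)
    have hm := h1.cden hv
    cases h3 with
    | step h => obtain ⟨N, h⟩ := h; exact ⟨_, .ctxTau h⟩
    | vn h =>
      obtain ⟨v, w, rfl, a, b⟩ := h.eq_tens hm
      obtain ⟨_, _, _, _, e, c, d, -⟩ := cden_tens.1 hm
      cases e
      obtain ⟨v', rfl, hv'⟩ := a.eq_bang c
      obtain ⟨w', rfl, hw'⟩ := b.eq_bang d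
      exact ⟨_, .cast hv' hw'⟩
    | comb l hl hc hv hd hb _ =>
      obtain ⟨t, ht⟩ := exists_isSum_map hl fun p => smul p.1 (tau p.2)
      exact ⟨_, .commTau l hl hc hd hb ht⟩

end progress

/-! ### Adequacy -/

section
variable {f : Frag}

theorem IsSum.ne_nil {l : List (Tm f)} {t : Tm f} (h : IsSum l t) : l ≠ [] := by
  induction h <;> simp_all

theorem IsSum.eq_of_singleton {s t : Tm f} (h : IsSum [s] t) : t = s := by
  generalize e : [s] = l at h
  cases h with
  | single t => simpa using e.symm
  | add h1 h2 =>
    have := List.length_pos_of_ne_nil h1.ne_nil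
    have := List.length_pos_of_ne_nil h2.ne_nil
    have := congrArg List.length e
    simp only [List.length_singleton, List.length_append] at this
    omega

theorem IsSum.exists_cden {l : List (Tm f)} {t : Tm f} (h : IsSum l t) {T : Ty f} {u : Vec}
    (ht : CDen t T u) : ∀ s ∈ l, ∃ v, CDen s T v := by
  induction h generalizing u with
  | single t => simpa using ⟨u, ht⟩
  | add _ _ ih ih' =>
    obtain ⟨v, w, hv, hw, -⟩ := cden_add.1 ht
    exact fun s hs => (List.mem_append.1 hs).elim (ih hv s) (ih' hw s)

theorem IsLin.algEq_of_singleton {a : Scal f} {b t : Tm f} (h : IsLin [(a, b)] t) :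
    AlgEq t (tm (a, b)) := by
  refine AlgEq.trans ?_ (algEq_tm (a, b)).symm
  generalize e : [(a, b)] = l at h
  cases h with
  | unit t =>
    simp only [List.cons.injEq, Prod.mk.injEq, and_true] at e
    obtain ⟨rfl, rfl⟩ := e
    exact (AlgEq.one_smul _).symm
  | smul a t =>
    simp only [List.cons.injEq, Prod.mk.injEq, and_true] at e
    obtain ⟨rfl, rfl⟩ := e
    exact .refl _
  | add h1 h2 =>
    have := List.length_pos_of_ne_nil h1.ne_nil
    have := List.length_pos_of_ne_nil h2.ne_nil
    have := congrArg List.length e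
    simp only [List.length_singleton, List.length_append] at this
    omega

theorem list_eq_singleton {α : Type} {l : List α} {b : α} (hl : l ≠ []) (hd : l.Nodup)
    (h : ∀ x ∈ l, x = b) : l = [b] := by
  rw [List.eq_replicate_iff.2 ⟨rfl, h⟩] at hd ⊢
  have := List.nodup_replicate.1 hd
  have := List.length_pos_of_ne_nil hl
  rw [show l.length = 1 by omega]; rfl

/-- Closed values of the unit proposition. -/
theorem IsVal.eq_star_or_smul {v : Tm f} (hv : IsVal v) {u : Vec} (h : CDen v .one u) :
    v = star ∨ ∃ a, a ≠ 1 ∧ v = smul a star := by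
  cases hv with
  | vn hv => exact .inl (hv.eq_star h)
  | comb l k ht hd hl hvl hvk =>
    have hty := ht.exists_cden h
    have h1 : ∀ x ∈ l.map Prod.snd ++ k, x = star := by
      intro x hx
      rcases List.mem_append.1 hx with hx | hx
      · obtain ⟨p, hp, rfl⟩ := List.mem_map.1 hx
        obtain ⟨v, hv⟩ := hty (smul p.1 p.2)
          (List.mem_append_left _ (List.mem_map.2 ⟨p, hp, rfl⟩))
        obtain ⟨w, hw, -⟩ := cden_smul.1 hv
        exact (IsVn.vb (hvl p hp)).eq_star hw
      · obtain ⟨v, hv⟩ := hty x (List.mem_append_right _ hx)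
        exact (IsVn.vb (hvk x hx)).eq_star hv
    have h2 : l.map Prod.snd ++ k ≠ [] := fun e => ht.ne_nil (by
      obtain ⟨e1, rfl⟩ := List.append_eq_nil_iff.1 e
      simp [List.map_eq_nil_iff.1 e1])
    have h3 := list_eq_singleton h2 hd h1
    cases l with
    | nil =>
      obtain rfl : k = [star] := h3
      exact .inl ht.eq_of_singleton
    | cons p l =>
      simp only [List.map_cons, List.cons_append, List.cons.injEq, List.append_eq_nil_iff,
        List.map_eq_nil_iff] at h3
      obtain ⟨h3, rfl, rfl⟩ := h3
      refine .inr ⟨p.1, (hl p (by simp)).2, ?_⟩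
      rw [← h3]; exact ht.eq_of_singleton
  | null l ht hd hv =>
    have hty := ht.exists_cden h
    have h1 : ∀ x ∈ l, x = star := by
      intro x hx
      obtain ⟨v, hv'⟩ := hty (smul 0 x) (List.mem_map.2 ⟨x, hx, rfl⟩)
      obtain ⟨w, hw, -⟩ := cden_smul.1 hv'
      exact (IsVn.vb (hv x hx)).eq_star hw
    obtain rfl := list_eq_singleton (by simpa using ht.ne_nil) hd h1
    exact .inr ⟨0, scal_one_ne_zero.symm, ht.eq_of_singleton⟩

theorem isVal_tm {b : Tm f} (hb : IsVb b) (a : Scal f) : IsVal (tm (a, b)) := by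
  by_cases h1 : a = 1
  · subst h1; rw [tm_one]; exact .vn (.vb hb)
  · rw [tm_of_ne b h1]
    by_cases h0 : a = 0
    · subst h0; exact .null [b] (.single _) (by simp) (by simpa using hb)
    · exact .comb [(a, b)] [] (.single _) (by simp) (by simpa using ⟨h0, h1⟩) (by simpa using hb)
        (by simp)

/-- If all irreducible closed terms of proposition `T` are multiples of `b`, then every closed
term of proposition `T` reduces to one. -/
theorem CDen.reds {T : Ty f} {b : Tm f} {w : Vec} (hb : CDen b T w) (hv : IsVb b)
    (hT : ∀ {c : Tm f} {u}, IsVn c → CDen c T u → (∀ N, ¬ Step c N) → c = b) (P : Tm f) {u : Vec}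
    (h : CDen P T u) : ∃ a, u = sc a • w ∧ Reds P (tm (a, b)) := by
  -- Any reduct will do. The case distinction follows the definition of `Red`, which permits a step
  -- from an algebraic form only if the term itself has no `Step`.
  by_cases hs : ∃ N, Step P N
  · obtain ⟨N, hN⟩ := hs
    obtain ⟨h1, h2⟩ := hN.sound h
    have hlt : Prod.Lex (· < ·) (Prod.Lex (· < ·) (· < ·)) (wt N, outw N, inw N)
        (wt P, outw P, inw P) := by
      simp only [Prod.lex_def]
      rcases h2 with h2 | ⟨h2, h3, h4, -⟩ <;> omega
    obtain ⟨a, h3, h4⟩ := CDen.reds hb hv hT N h1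
    exact ⟨a, h3, .head (.step hN) h4⟩
  · obtain ⟨A, h1, h2, h3⟩ := h.good.exists_whn h
    have hA := h1.cden h
    by_cases hs' : ∃ N, Step A N
    · obtain ⟨N, hN⟩ := hs'
      obtain ⟨h4, h5⟩ := hN.sound hA
      have hlt : Prod.Lex (· < ·) (Prod.Lex (· < ·) (· < ·)) (wt N, outw N, inw N)
          (wt P, outw P, inw P) := by
        -- Normalisation does not increase the lexicographic measure, so the strict decrease from
        -- `A` to `N` gives one from `P` to `N`.
        have := h1.wt; have := h1.outw; have := h1.inw
        simp only [Prod.lex_def]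
        rcases h5 with h5 | ⟨h5, h6, h7, -⟩ <;> omega
      obtain ⟨a, h6, h7⟩ := CDen.reds hb hv hT N h4
      exact ⟨a, h6, .head (.alg hs h1.alg h2 hN) h7⟩
    · push Not at hs'
      -- All summands of the irreducible form equal `b` by `hT`, and distinctness leaves one of
      -- them.
      have key : ∃ a, IsLin [(a, b)] A := by
        cases h3 with
        | step h => obtain ⟨N, h⟩ := h; exact absurd h (hs' N)
        | vn h => obtain rfl := hT h hA hs'; exact ⟨1, .unit A⟩
        | comb l hl hc _ hd hb hn =>
          obtain ⟨g, hg, -⟩ := hl.exists_cden hA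
          obtain ⟨a, rfl⟩ := eq_singleton_of_nodup hl.ne_nil hd fun p hp =>
            hT (.vb (hb p hp)) (hg p hp) (hn p hp)
          exact ⟨a, hl⟩
      obtain ⟨a, h4⟩ := key
      obtain ⟨g, hg, rfl⟩ := h4.exists_cden hA
      have hg' := (hg (a, b) (by simp)).unique hb
      exact ⟨a, by simp [hg'], .single (.val (h1.alg.trans h4.algEq_of_singleton) (isVal_tm hv a))⟩
termination_by (wt P, outw P, inw P)
decreasing_by all_goals exact hlt

/-- The denotation of a closed term of an observable proposition determines a value to which the
term reduces. -/
theorem IsObs.exists_common_value {T : Ty f} (hT : IsObs T) {P Q : Tm f} {u : Vec}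
    (hP : CDen P T u) (hQ : CDen Q T u) : ∃ V, IsVal V ∧ Reds P V ∧ Reds Q V := by
  -- The coordinate `i` at which the vector of `b` is 1 reads the coefficient off the common
  -- denotation, so both terms reach the same multiple of `b`.
  suffices H : ∃ (b : Tm f) (w : Vec) (i : Ix), w i = 1 ∧ IsVb b ∧ CDen b T w ∧
      ∀ {c : Tm f} {u}, IsVn c → CDen c T u → (∀ N, ¬ Step c N) → c = b by
    obtain ⟨b, w, i, hi, hb, hw, hc⟩ := H
    obtain ⟨a, e1, h1⟩ := hw.reds hb hc P hP
    obtain ⟨a', e2, h2⟩ := hw.reds hb hc Q hQ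
    have : a = a' := sc_injective (by simpa [hi] using congrFun (e1.symm.trans e2) i)
    subst this
    exact ⟨_, isVal_tm hb a, h1, h2⟩
  cases hT with
  | one =>
    exact ⟨star, vunit, .unit, by simp [vunit, bas], .star, cden_star.2 ⟨rfl, rfl⟩,
      fun hc h _ => hc.eq_star h⟩
  | bang =>
    refine ⟨Tm.bang star, _, .pr .unit .unit, ?_, .bang (.vn (.vb .star)),
      cden_bang.2 ⟨_, _, rfl, cden_star.2 ⟨rfl, rfl⟩, rfl⟩, fun hc h hn => ?_⟩
    · simp [vtens, vconj, vunit, bas]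
    · obtain ⟨v, rfl, hv⟩ := hc.eq_bang h
      obtain ⟨_, x, e, hx, -⟩ := cden_bang.1 h
      cases e
      -- Under `bang`, a multiple of `star` with coefficient other than 1, zero included, is still
      -- reducible, since its scalar moves out. Only `bang star` is left.
      rcases hv.eq_star_or_smul hx with rfl | ⟨a, ha, rfl⟩
      · rfl
      · exact absurd (Step.commBang a ha .star) (hn _)

-- Closed instances and contextual equivalence

theorem Closes.exists_env {s : ℕ → Tm f} {Δ : Ctx f} (h : Closes s Δ) :
    ∃ σ : ℕ → Vec, ∀ i S, Δ.Has i S → CDen (s i) S (σ i) := by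
  have : ∀ i, ∃ v : Vec, ∀ S, Δ.Has i S → CDen (s i) S v := by
    intro i
    by_cases hi : ∃ S, Δ.Has i S
    · obtain ⟨S, hS⟩ := hi
      obtain ⟨d, hd⟩ := (h i S hS).exists_den
      refine ⟨d 0, fun S' hS' => ?_⟩
      obtain rfl := hS.unique hS'
      exact hd.cden
    · exact ⟨0, fun S hS => absurd ⟨S, hS⟩ hi⟩
  choose σ hσ using this
  exact ⟨σ, hσ⟩

/-- Terms with equal denotations are contextually equivalent. -/
theorem Den.ctxEquivIn {Δ : Ctx f} {U : Ty f} {M N : Tm f} {d e} (hM : Den Δ M U d)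
    (hN : Den Δ N U e) (hde : ∀ ρ, SuppEnv Δ ρ → d ρ = e ρ) : CtxEquivIn Δ U M N := by
  intro s hs E T _ hT hE
  obtain ⟨σ, hσ⟩ := hs.exists_env
  obtain ⟨c, hc⟩ := hE.exists_den
  have h1 : CDen (Tm.subst s M) U (d σ) := (hM.subst (Γ := []) rfl hσ).1
  have h2 : CDen (Tm.subst s N) U (e σ) := (hN.subst (Γ := []) rfl hσ).1
  -- Both closed instances now denote the same vector, and the elimination context acts on it by one
  -- and the same map.
  rw [← hde σ fun i S hi => (hσ i S hi).supp] at h2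
  exact hT.exists_common_value (hc.inst h1).1 (hc.inst h2).1

end

end BIMALL

-- The linearity corollary

theorem mainTheorem8 {f : BIMALL.Frag} {S T : BIMALL.Ty f} {Δ : BIMALL.Ctx f}
    {M N₁ N₂ : BIMALL.Tm f} (α β : BIMALL.Scal f)
    (hM : BIMALL.HasType [some S] M T)
    (hN₁ : BIMALL.HasType Δ N₁ S) (hN₂ : BIMALL.HasType Δ N₂ S) :
    BIMALL.CtxEquivIn Δ T
      (.app (.lam M) (.add (.smul α N₁) (.smul β N₂)))
      (.add (.smul α (.app (.lam M) N₁)) (.smul β (.app (.lam M) N₂))) := by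
  obtain ⟨d, hd⟩ := hM.exists_den
  obtain ⟨e₁, he₁⟩ := hN₁.exists_den
  obtain ⟨e₂, he₂⟩ := hN₂.exists_den
  -- The abstraction is closed, so all variables of `Δ` go to its argument. With one derivation of
  -- the abstraction used in all three applications, what remains is linearity of `vapp` in its
  -- second argument.
  obtain ⟨Θ, hΘ, hs⟩ := BIMALL.Ctx.exists_isEmpty_split Δ
  have hlam := BIMALL.Den.lolliI (hd.append_isEmpty hΘ)
  exact BIMALL.Den.ctxEquivIn (.lolliE hs hlam (.sum (.prod α he₁) (.prod β he₂)))
    (.sum (.prod α (.lolliE hs hlam he₁)) (.prod β (.lolliE hs hlam he₂)))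
    fun ρ _ => BIMALL.vapp_lin_right _ _ _ _ _ _
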